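/- **Model.** Let $\alpha>2$ and $0<\theta<2\pi$. In the plane let the mmWave base stations (BSs), the users, and the centres of indoor discs of radius $R$ form independent homogeneous Poisson point processes $\Phi_{\rm m},\Phi_{\rm u},\Phi_g$ of densities $\lambda_{\rm m},\lambda_{\rm u},\lambda_g>0$, and put $S=\pi R^2$. The indoor region is the union of the discs; its boundary consists of walls that mmWave signals cannot penetrate; its complement is the outdoor region. A typical user $U_0$ at the origin is added to the users. For a user at $y$ and a unit vector $u$, the non-blockage distance is the length of the line from $y$ in direction $u$ to the first wall it meets; a BS is non-blocked for the user if this distance in the direction of the BS exceeds the distance of the BS. Each user is served by its nearest non-blocked BS, and BSs that serve no user are turned off. Towards each user it serves, a BS directs a beam of unit power whose main lobe has angle $\theta$ and is centred at that user; gain is $1$ inside the lobe and $0$ outside. The links from the BSs to $U_0$ have independent exponential fading powers $\eta_i$ with mean $1$. With $r$, $\eta$ the distance and fading power of the serving BS of $U_0$, and noise power $\sigma^2>0$, let $$\mathsf{SINR}=\frac{\eta\, r^{-\beta}}{\sum_{i}\Theta_i\eta_i r_i^{-\beta}+\sigma^2},\qquad \beta=\begin{cases}\alpha & \text{if } U_0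 \text{ is outdoors},\\ 2&\text{if } U_0\text{ is indoors},\end{cases}$$ and $\mathsf{SINR}=0$ if every BS is blocked for $U_0$. The sum is over the active BSs other than the serving one that are non-blocked for $U_0$, $r_i$ is their distance from $U_0$, and $\Theta_i$ is the number of beams of BS $i$ whose main lobe contains $U_0$. The downlink mmWave spectral efficiency is $\gamma_{\rm m}=\mathsf E\log(1+\mathsf{SINR})$ (in nats). Put $\rho_{\rm m}=\int_0^\infty \frac{du}{1+u^{\alpha/2}}$. **Proposition (Downlink mmWave).** In the regime of an interference-limited outdoor region, a noise-limited indoor region and ultra-dense BSs ($\lambda_{\rm m}\gg\lambda_{\rm u}$), $$\gamma_{\rm m} > \log\left(1+\frac{\pi\,\lambda_{\rm m}^{\left(\frac{\alpha}{2}-1\right)e^{-\lambda_g S}+1}}{\sigma^2}\left[\frac{2\sigma^2}{\theta}\left(\frac{e^{\lambda_g S}}{\rho_{\rm m}\lambda_{\rm u}}\right)^{\alpha/2}\right]^{e^{-\lambda_g S}}\right).$$ Precisely: there is a constant $c>0$ that depends only on $\alpha$ and $\theta$ such that for all $\lambda_{\rm u},\sigma>0$ with $\sigma^2<c\,\lambda_{\rm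 u}^{\alpha/2}$ and all $\lambda_g>0$ there is $S_0>0$ such that for every $S\in(0,S_0)$ there is $K>0$ such that the inequality holds for all $\lambda_{\rm m}>K\lambda_{\rm u}$. -/

import Mathlib

open MeasureTheory ProbabilityTheory
open scoped ENNReal NNReal

noncomputable section

namespace MmWave

/-- The plane `ℝ²` with its Euclidean norm. -/
abbrev Plane : Type := EuclideanSpace ℝ (Fin 2)

/-! ### Poisson point processes -/

/-- Number of points of the configuration `ξ` that fall in `B`. -/
def count {X : Type*} (ξ B : Set X) : ℕ∞ := (ξ ∩ B).encard

/-- `Φ` is a Poisson point process with intensity measure `Λ`: the number of points in a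
measurable set of finite intensity is a Poisson variable with mean the intensity of the set, and
the numbers of points in finitely many pairwise disjoint measurable sets are independent. -/
structure IsPoissonProcess {Ω X : Type*} [MeasurableSpace Ω] [MeasurableSpace X]
    (P : Measure Ω) (Φ : Ω → Set X) (Λ : Measure X) : Prop where
  measurable_count : ∀ B : Set X, MeasurableSet B → Measurable fun ω => count (Φ ω) B
  law_count : ∀ B : Set X, MeasurableSet B → Λ B ≠ ∞ →
    P.map (fun ω => count (Φ ω) B) =
      (poissonMeasure (Λ B).toNNReal).map (fun n : ℕ => (n : ℕ∞))
  indep_count : ∀ (n : ℕ) (B : Fin n → Set X), (∀ i, MeasurableSet (B i)) →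
    Pairwise (fun i j => Disjoint (B i) (B j)) →
    iIndepFun (fun i ω => count (Φ ω) (B i)) P

/-- The σ-algebra generated by the point counts of a random configuration. -/
@[reducible] def sigmaOf {Ω X : Type*} [MeasurableSpace X] (Φ : Ω → Set X) : MeasurableSpace Ω :=
  ⨆ (B : Set X) (_ : MeasurableSet B),
    MeasurableSpace.comap (fun ω => count (Φ ω) B) inferInstance

/-- The random network. `Φm` is the process of mmWave base stations (BSs); a point `(x, η)` of it
is a BS at `x` whose link to the typical user has fading power `η`. The locations form a
homogeneous Poisson process of density `lm` and the fading powers are independent exponential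
variables with mean one (Rayleigh fading). `Φu` is the process of the users other than the typical
one and `Φg` the process of the centres of the indoor discs, homogeneous Poisson processes of
densities `lu` and `lg`. The three processes are independent. -/
structure IsNetwork {Ω : Type*} [MeasurableSpace Ω] (P : Measure Ω) (lm lu lg : ℝ)
    (Φm : Ω → Set (Plane × ℝ)) (Φu Φg : Ω → Set Plane) : Prop where
  stations : IsPoissonProcess P Φm
    ((ENNReal.ofReal lm • (volume : Measure Plane)).prod (expMeasure 1))
  users : IsPoissonProcess P Φu (ENNReal.ofReal lu • (volume : Measure Plane))
  rooms : IsPoissonProcess P Φg (ENNReal.ofReal lg • (volume : Measure Plane))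
  indep : iIndep ![sigmaOf Φm, sigmaOf Φu, sigmaOf Φg] P

/-! ### Indoor regions and blockage -/

/-- The indoor region: the union of the discs of radius `R` centred at the points of `G`.
Its complement is the outdoor region. -/
def indoor (G : Set Plane) (R : ℝ) : Set Plane := ⋃ c ∈ G, Metric.closedBall c R

/-- The impenetrable walls: the boundary of the indoor region. -/
def walls (G : Set Plane) (R : ℝ) : Set Plane := frontier (indoor G R)

/-- The non-blockage distance from `y` in the direction `u`: the length of the line from `y` to
the point where it first meets a wall (`∞` if it meets none). -/
def nonBlockageDist (W : Set Plane) (y u : Plane) : ℝ≥0∞ :=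
  ⨅ t ∈ {t : ℝ | 0 ≤ t ∧ y + t • u ∈ W}, ENNReal.ofReal t

/-- The unit vector from `y` to `x`. -/
def direction (y x : Plane) : Plane := ‖x - y‖⁻¹ • (x - y)

/-- The link between a user at `y` and a BS at `x` is not blocked: the non-blockage distance from
`y` towards `x` exceeds their distance. -/
def Visible (W : Set Plane) (y x : Plane) : Prop :=
  ENNReal.ofReal (dist y x) < nonBlockageDist W y (direction y x)

/-! ### Association, activity and antenna gain -/

/-- The BS `b` serves the user at `y`: it is a nearest one among the non-blocked BSs of `y`. -/
def Serves (W : Set Plane) (B : Set (Plane × ℝ)) (y : Plane) (b : Plane × ℝ) : Prop :=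
  b ∈ B ∧ Visible W y b.1 ∧ ∀ b' ∈ B, Visible W y b'.1 → dist y b.1 ≤ dist y b'.1

/-- The users of `U` that are served by the BS `b`. -/
def servedUsers (W : Set Plane) (B : Set (Plane × ℝ)) (U : Set Plane) (b : Plane × ℝ) :
    Set Plane :=
  {y ∈ U | Serves W B y b}

/-- A BS is active if it serves at least one user; the others are turned off. -/
def Active (W : Set Plane) (B : Set (Plane × ℝ)) (U : Set Plane) (b : Plane × ℝ) : Prop :=
  (servedUsers W B U b).Nonempty

/-- The antenna gain of the BS `b` towards the typical user at the origin: the BS directs to each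
user it serves a beam of unit power whose main lobe has angle `θ` and is centred at that user, and
the gain is the number of these main lobes that contain the origin. -/
def gain (θ : ℝ) (W : Set Plane) (B : Set (Plane × ℝ)) (U : Set Plane) (b : Plane × ℝ) : ℕ∞ :=
  {y ∈ servedUsers W B U b | InnerProductGeometry.angle (y - b.1) (0 - b.1) ≤ θ / 2}.encard

/-- The interfering BSs of the typical user at the origin: the active non-blocked BSs other than
its own one. As the walls separate the indoor and the outdoor regions, these are outdoor BSs if
the origin is outdoors, and BSs in the same indoor region if it is indoors. -/
def interferers (W : Set Plane) (B : Set (Plane × ℝ)) (U : Set Plane) : Set (Plane × ℝ) :=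
  {b ∈ B | Active W B U b ∧ Visible W 0 b.1 ∧ ¬ Serves W B 0 b}

/-! ### SINR and spectral efficiency -/

/-- Power received at the origin from the BS `b` through a link of unit gain, with path loss
exponent `β`: fading power times distance to the power `-β`. -/
def receivedPower (β : ℝ) (b : Plane × ℝ) : ℝ≥0∞ :=
  ENNReal.ofReal (b.2 * dist 0 b.1 ^ (-β))

/-- The power of the desired signal at the origin. The serving BS is almost surely unique if it
exists; the power is `0` if every BS is blocked. -/
def signal (β : ℝ) (W : Set Plane) (B : Set (Plane × ℝ)) : ℝ≥0∞ :=
  ∑' b : {b : Plane × ℝ | Serves W B 0 b}, receivedPower β b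

/-- The aggregate interference at the origin. -/
def interference (θ β : ℝ) (W : Set Plane) (B : Set (Plane × ℝ)) (U : Set Plane) : ℝ≥0∞ :=
  ∑' b : interferers W B U, (gain θ W B U b : ℝ≥0∞) * receivedPower β b

/-- The signal-to-interference-plus-noise ratio at the origin, with noise power `σ ^ 2` and path
loss exponent `β`. -/
def sinrWith (θ β σ : ℝ) (W : Set Plane) (B : Set (Plane × ℝ)) (U : Set Plane) : ℝ≥0∞ :=
  signal β W B / (interference θ β W B U + ENNReal.ofReal (σ ^ 2))

open scoped Classical in
/-- The SINR of the typical user located at the origin, when the other users are at the points of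
`U`: the path loss exponent is `2` if the origin is indoors and `α` if it is outdoors. -/
def sinr (α θ σ R : ℝ) (B : Set (Plane × ℝ)) (U G : Set Plane) : ℝ≥0∞ :=
  if (0 : Plane) ∈ indoor G R then sinrWith θ 2 σ (walls G R) B (insert 0 U)
  else sinrWith θ α σ (walls G R) B (insert 0 U)

/-- The downlink mmWave spectral efficiency `E log (1 + SINR)` of the typical user, in nats. -/
def spectralEfficiency {Ω : Type*} [MeasurableSpace Ω] (P : Measure Ω) (α θ σ R : ℝ)
    (Φm : Ω → Set (Plane × ℝ)) (Φu Φg : Ω → Set Plane) : ℝ≥0∞ :=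
  ∫⁻ ω, ENNReal.ofReal (Real.log (1 + (sinr α θ σ R (Φm ω) (Φu ω) (Φg ω)).toReal)) ∂P

/-- The constant `ρ = ∫₀^∞ du / (1 + u ^ (α / 2))`. -/
def rho (α : ℝ) : ℝ := ∫ u in Set.Ioi (0 : ℝ), 1 / (1 + u ^ (α / 2))

end MmWave

end

/-! Write log SINR as log(signal/noise) - log(1 + I/σ²), where I is the interference, and use log(1
+ SINR) ≥ log SINR. When stations are dense, the nearest one is non-blocked with high probability.
Its depth lm·π·r² and its fading power are independent mean-one exponential variables, so the first
term has mean (β/2) log(π lm) - log σ² + (1 - β/2) E log η up to small errors. Here β = α with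
probability p = exp(-lg S), the probability that the origin is outdoors, and β = 2 otherwise.

For the second term, log(1 + x) is an integral of 1 - exp(-s x) against exp(-s)/s ds
(`lintegral_one_sub_exp`), so a lower bound for the Laplace transform of I suffices. On good
configurations I is at most a sum over users of the power of the serving station whenever its beam
covers the origin. Given the stations, the users form a Poisson process. Jensen's inequality and the
subadditivity of 1 - exp(-s x) remove the dependence between users; Campbell's formula and Tonelli
then leave, for each station, the mass that the nearest-point density gives to a lobe, which is
θ/(2π). Hence the transform of I/σ² is at least exp(-(s/τ)^(2/α)) with τ close to
σ²/(lu·rho·θ/2)^(α/2) (`le_lintegral_exp_crowdSum`). The logarithmic moment of this stable law is at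
most (1 - α/2) E log η - log τ + O(√τ) (`lintegral_stable_le`). Its first term cancels that of the
signal outdoors, and the smallness of σ²/lu^(α/2) controls √τ.

The geometry is confined to `Regular` configurations. A long line of sight would need a long chain
of covered, or of uncovered, points at independent places, and users rarely lie close to walls; away
from walls the nearest non-blocked station is the nearest station. The exceptional probability tends
to 0 even after multiplication by log lm (`eventually_irregularBound_le`). Indoors, the exponent 2
worsens the interference only beyond distance 1, where visibility again needs a chain of discs; the
mean of this part is O(R).

The strict inequality comes from a gap in the claimed bound: it has 2/θ to the power p where the
true asymptotics has (2/θ)^(pα/2), and similarly for π. In logarithms the gap is p·m with m = (α/2 -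
1) log(2π/θ), positive because θ < 2π. Every error is made a small fraction of m (`log_target_lt`).
-/

noncomputable section

namespace MmWave

/-! ### Poisson processes: void probabilities, Campbell formulas, Laplace functional of counts. -/

section PoissonProcess

variable {Ω X : Type*}

/-- The sum of `f` over the points of the configuration `ξ`. -/
def pointSum {X : Type*} (ξ : Set X) (f : X → ℝ≥0∞) : ℝ≥0∞ := ∑' b : ξ, f b

lemma pointSum_add (ξ : Set X) (f g : X → ℝ≥0∞) :
    pointSum ξ (fun x => f x + g x) = pointSum ξ f + pointSum ξ g := ENNReal.tsum_add

lemma pointSum_mono (ξ : Set X) {f g : X → ℝ≥0∞} (h : ∀ x ∈ ξ, f x ≤ g x) :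
    pointSum ξ f ≤ pointSum ξ g := ENNReal.tsum_le_tsum fun b => h b b.2

lemma pointSum_indicator_const (ξ B : Set X) (c : ℝ≥0∞) :
    pointSum ξ (B.indicator fun _ => c) = c * (count ξ B : ℝ≥0∞) := by
  unfold pointSum count
  rw [tsum_subtype ξ (B.indicator fun _ => c), Set.indicator_indicator,
    ← tsum_subtype (ξ ∩ B) (fun _ => c), ENNReal.tsum_set_const, mul_comm]

lemma pointSum_iSup (ξ : Set X) (f : ℕ → X → ℝ≥0∞) (hf : Monotone f) :
    pointSum ξ (fun x => ⨆ n, f n x) = ⨆ n, pointSum ξ (f n) := by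
  unfold pointSum
  -- With the discrete σ-algebra the sum is an integral against counting measure, so monotone
  -- convergence needs no countability of `ξ`.
  let _ : MeasurableSpace ξ := ⊤
  simp_rw [← lintegral_count' (measurable_from_top)]
  rw [lintegral_iSup (fun n => measurable_from_top)]
  exact fun i j hij x => hf hij x

variable [MeasurableSpace X] {Φ : Ω → Set X}

lemma measurable_count_sigmaOf {B : Set X} (hB : MeasurableSet B) :
    Measurable[sigmaOf Φ] fun ω => count (Φ ω) B := by
  intro s hs
  refine MeasurableSpace.le_def.mp (le_iSup₂_of_le (f := fun B (_ : MeasurableSet B) =>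
    MeasurableSpace.comap (fun ω => count (Φ ω) B) inferInstance) B hB le_rfl) _ ⟨s, hs, rfl⟩

/-- Measurability is kept relative to `sigmaOf Φ` rather than the ambient σ-algebra, because
independence of the processes is stated for these σ-algebras. -/
lemma measurable_pointSum {f : X → ℝ≥0∞} (hf : Measurable f) :
    Measurable[sigmaOf Φ] fun ω => pointSum (Φ ω) f := by
  refine Measurable.ennreal_induction
    (motive := fun f => Measurable[sigmaOf Φ] fun ω => pointSum (Φ ω) f) ?_ ?_ ?_ hf
  · intro c s hs
    simp_rw [pointSum_indicator_const]
    exact (measurable_from_top.comp (measurable_count_sigmaOf hs)).const_mul c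
  · intro f g _ hf hg ihf ihg
    have : (fun ω => pointSum (Φ ω) (f + g)) =
        fun ω => pointSum (Φ ω) f + pointSum (Φ ω) g := by
      funext ω; exact pointSum_add _ _ _
    rw [this]
    exact ihf.add ihg
  · intro f hf hmono ih
    simp_rw [pointSum_iSup _ f hmono]
    exact Measurable.iSup ih

variable [mΩ : MeasurableSpace Ω] {P : Measure Ω} {Λ : Measure X} (hΦ : IsPoissonProcess P Φ Λ)
include hΦ

lemma IsPoissonProcess.sigmaOf_le : sigmaOf Φ ≤ mΩ :=
  iSup₂_le fun B hB => (hΦ.measurable_count B hB).comap_le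

lemma IsPoissonProcess.lintegral_comp_count {B : Set X} (hB : MeasurableSet B) (hB' : Λ B ≠ ∞)
    (f : ℕ∞ → ℝ≥0∞) :
    ∫⁻ ω, f (count (Φ ω) B) ∂P = ∑' n : ℕ, f n *
      ENNReal.ofReal (Real.exp (-(Λ B).toReal) * (Λ B).toReal ^ n / n.factorial) := by
  rw [← lintegral_map (f := f) measurable_from_top (hΦ.measurable_count B hB),
    hΦ.law_count B hB hB', lintegral_map measurable_from_top measurable_from_top,
    lintegral_countable']
  simp_rw [poissonMeasure_singleton]
  rfl

lemma IsPoissonProcess.measure_count_eq {B : Set X} (hB : MeasurableSet B) (hB' : Λ B ≠ ∞)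
    (n : ℕ) : P {ω | count (Φ ω) B = n} =
      ENNReal.ofReal (Real.exp (-(Λ B).toReal) * (Λ B).toReal ^ n / n.factorial) := by
  have h := hΦ.lintegral_comp_count hB hB' (({(n : ℕ∞)} : Set ℕ∞).indicator 1)
  have h2 : (fun ω => ({(n : ℕ∞)} : Set ℕ∞).indicator (1 : ℕ∞ → ℝ≥0∞) (count (Φ ω) B)) =
      {ω | count (Φ ω) B = n}.indicator 1 := by
    funext ω; simp [Set.indicator_apply]
  have h3 := lintegral_indicator_one (μ := P)
    (hΦ.measurable_count B hB (MeasurableSet.of_discrete (s := {(n : ℕ∞)})))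
  rw [h2] at h
  refine h3.symm.trans (h.trans ?_)
  rw [tsum_eq_single n]
  · simp
  · intro m hm
    simp [hm]

lemma IsPoissonProcess.measure_void {B : Set X} (hB : MeasurableSet B) (hB' : Λ B ≠ ∞) :
    P {ω | count (Φ ω) B = 0} = ENNReal.ofReal (Real.exp (-(Λ B).toReal)) := by
  simpa using hΦ.measure_count_eq hB hB' 0

lemma IsPoissonProcess.lintegral_count {B : Set X} (hB : MeasurableSet B) (hB' : Λ B ≠ ∞) :
    ∫⁻ ω, (count (Φ ω) B : ℝ≥0∞) ∂P = Λ B := by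
  rw [hΦ.lintegral_comp_count hB hB' (fun n => (n : ℝ≥0∞))]
  set r := (Λ B).toReal with hr
  have hr0 : 0 ≤ r := ENNReal.toReal_nonneg
  have h1 : ∀ n : ℕ, ((n : ℕ∞) : ℝ≥0∞) * ENNReal.ofReal (Real.exp (-r) * r ^ n / n.factorial) =
      ENNReal.ofReal (n * (Real.exp (-r) * r ^ n / n.factorial)) := by
    intro n
    rw [ENNReal.ofReal_mul (by positivity)]
    simp
  simp_rw [h1]
  have h2 : HasSum (fun n : ℕ => (n : ℝ) * (Real.exp (-r) * r ^ n / n.factorial)) r := by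
    rw [← hasSum_nat_add_iff' 1]
    have h3 : HasSum (fun n : ℕ => Real.exp (-r) * r * (r ^ n / n.factorial))
        (Real.exp (-r) * r * Real.exp r) := by
      rw [show Real.exp r = NormedSpace.exp r by rw [Real.exp_eq_exp_ℝ]]
      exact (NormedSpace.expSeries_div_hasSum_exp (𝔸 := ℝ) r).mul_left _
    have h4 : Real.exp (-r) * r * Real.exp r = r := by
      rw [mul_right_comm, ← Real.exp_add]; simp
    rw [h4] at h3
    have h5 : (fun n : ℕ => ((n + 1 : ℕ) : ℝ) * (Real.exp (-r) * r ^ (n + 1) /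
        (n + 1).factorial)) = fun n : ℕ => Real.exp (-r) * r * (r ^ n / n.factorial) := by
      funext n
      rw [Nat.factorial_succ]
      push_cast
      field_simp
      ring
    rw [h5]
    simpa using h3
  rw [← ENNReal.ofReal_tsum_of_nonneg (fun n => by positivity) h2.summable, h2.tsum_eq, hr,
    ENNReal.ofReal_toReal hB']

lemma IsPoissonProcess.lintegral_exp_count {B : Set X} (hB : MeasurableSet B) (hB' : Λ B ≠ ∞)
    {x : ℝ} :
    ∫⁻ ω, ENNReal.ofReal (Real.exp (-(x * (count (Φ ω) B).toNat))) ∂P =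
      ENNReal.ofReal (Real.exp (-((Λ B).toReal * (1 - Real.exp (-x))))) := by
  rw [hΦ.lintegral_comp_count hB hB' (fun n => ENNReal.ofReal (Real.exp (-(x * n.toNat))))]
  set r := (Λ B).toReal with hr
  have hr0 : 0 ≤ r := ENNReal.toReal_nonneg
  simp_rw [← ENNReal.ofReal_mul (Real.exp_pos _).le]
  have h3 : HasSum (fun n : ℕ => Real.exp (-r) * ((r * Real.exp (-x)) ^ n / n.factorial))
        (Real.exp (-r) * Real.exp (r * Real.exp (-x))) := by
    rw [show Real.exp (r * Real.exp (-x)) = NormedSpace.exp (r * Real.exp (-x)) by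
      rw [Real.exp_eq_exp_ℝ]]
    exact (NormedSpace.expSeries_div_hasSum_exp (𝔸 := ℝ) _).mul_left _
  have h4 : (fun n : ℕ => Real.exp (-(x * ((n : ℕ∞).toNat : ℝ))) *
      (Real.exp (-r) * r ^ n / n.factorial)) =
      fun n : ℕ => Real.exp (-r) * ((r * Real.exp (-x)) ^ n / n.factorial) := by
    funext n
    have : Real.exp (-(x * (n : ℝ))) = Real.exp (-x) ^ n := by
      rw [← Real.exp_nat_mul]; congr 1; ring
    simp only [ENat.toNat_natCast, this]
    rw [mul_pow]; ring
  rw [← ENNReal.ofReal_tsum_of_nonneg (fun n => by positivity) (h4 ▸ h3.summable), h4, h3.tsum_eq,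
    ← Real.exp_add]
  congr 2; ring

lemma IsPoissonProcess.measure_count_ne_zero_le {B : Set X} (hB : MeasurableSet B) :
    P {ω | count (Φ ω) B ≠ 0} ≤ Λ B := by
  by_cases hB' : Λ B = ∞
  · simp [hB']
  rw [← hΦ.lintegral_count hB hB']
  have h := mul_meas_ge_le_lintegral (μ := P) (f := fun ω => (count (Φ ω) B : ℝ≥0∞))
    (measurable_from_top.comp (hΦ.measurable_count B hB)) 1
  rw [one_mul] at h
  refine (measure_mono fun ω hω => ?_).trans h
  show (1 : ℝ≥0∞) ≤ _
  have h1 : (1 : ℕ∞) ≤ count (Φ ω) B := Order.one_le_iff_ne_zero.mpr hω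
  exact_mod_cast ENat.toENNReal_le.mpr h1

lemma IsPoissonProcess.ae_count_eq_zero {B : Set X} (hB : MeasurableSet B) (h0 : Λ B = 0) :
    ∀ᵐ ω ∂P, count (Φ ω) B = 0 := by
  rw [ae_iff]
  exact le_antisymm ((hΦ.measure_count_ne_zero_le hB).trans h0.le) bot_le

lemma IsPoissonProcess.ae_count_ne_top {B : Set X} (hB : MeasurableSet B) (hB' : Λ B ≠ ∞) :
    ∀ᵐ ω ∂P, count (Φ ω) B ≠ ⊤ := by
  have h := ae_lt_top (μ := P) (f := fun ω => (count (Φ ω) B : ℝ≥0∞))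
    (measurable_from_top.comp (hΦ.measurable_count B hB))
    (by rw [hΦ.lintegral_count hB hB']; exact hB')
  filter_upwards [h] with ω hω
  exact (ENat.toENNReal_lt_top.mp hω).ne

lemma IsPoissonProcess.iIndepFun_count {ι : Type*} [Finite ι] {B : ι → Set X}
    (hB : ∀ i, MeasurableSet (B i)) (hd : Pairwise fun i j => Disjoint (B i) (B j)) :
    iIndepFun (fun i ω => count (Φ ω) (B i)) P := by
  obtain ⟨n, ⟨e⟩⟩ := Finite.exists_equiv_fin ι
  have h := (hΦ.indep_count n (B ∘ e.symm) (fun i => hB _)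
    (fun i j hij => hd (e.symm.injective.ne hij))).precomp e.injective
  simpa using h

lemma IsPoissonProcess.indepFun_count {B C : Set X} (hB : MeasurableSet B)
    (hC : MeasurableSet C) (hd : Disjoint B C) :
    IndepFun (fun ω => count (Φ ω) B) (fun ω => count (Φ ω) C) P := by
  have h := hΦ.iIndepFun_count (ι := Fin 2) (B := ![B, C])
    (by intro i; fin_cases i <;> simpa)
    (by intro i j hij; fin_cases i <;> fin_cases j <;> simp_all [hd.symm])
  exact h.indepFun (i := 0) (j := 1) (by decide)

/-- A formula for the number of points in the subsets of `C` on an event extends to sums over the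
points in `C`. -/
lemma IsPoissonProcess.lintegral_indicator_mul_pointSum {V : Set Ω} (hV : MeasurableSet V)
    {C : Set X} (hC : MeasurableSet C) {κ : ℝ≥0∞}
    (h : ∀ s, MeasurableSet s →
      ∫⁻ ω, V.indicator 1 ω * (count (Φ ω) (C ∩ s) : ℝ≥0∞) ∂P = κ * Λ (C ∩ s))
    {f : X → ℝ≥0∞} (hf : Measurable f) :
    ∫⁻ ω, V.indicator 1 ω * pointSum (Φ ω) (C.indicator f) ∂P = κ * ∫⁻ x in C, f x ∂Λ := by
  have hle := hΦ.sigmaOf_le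
  have hm : ∀ {f : X → ℝ≥0∞}, Measurable f →
      Measurable fun ω => V.indicator (1 : Ω → ℝ≥0∞) ω * pointSum (Φ ω) (C.indicator f) :=
    fun hf => (measurable_one.indicator hV).mul
      ((measurable_pointSum (hf.indicator hC)).mono hle le_rfl)
  refine Measurable.ennreal_induction (motive := fun f => ∫⁻ ω, V.indicator 1 ω *
    pointSum (Φ ω) (C.indicator f) ∂P = κ * ∫⁻ x in C, f x ∂Λ) ?_ ?_ ?_ hf
  · intro c s hs
    rw [Set.indicator_indicator]
    simp_rw [pointSum_indicator_const, mul_left_comm _ c]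
    rw [lintegral_const_mul, h s hs, lintegral_indicator_const hs, Measure.restrict_apply hs,
      Set.inter_comm, mul_left_comm]
    exact (measurable_one.indicator hV).mul
      (measurable_from_top.comp (hΦ.measurable_count _ (hC.inter hs)))
  · intro f g _ hf hg ihf ihg
    have h1 : ∀ ω, V.indicator (1 : Ω → ℝ≥0∞) ω *
        pointSum (Φ ω) (C.indicator (f + g)) =
        V.indicator 1 ω * pointSum (Φ ω) (C.indicator f) +
        V.indicator 1 ω * pointSum (Φ ω) (C.indicator g) := by
      intro ω
      rw [← mul_add, ← pointSum_add]
      congr 2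
      exact Set.indicator_add _ _ _
    simp_rw [h1]
    rw [lintegral_add_left (hm hf), ihf, ihg, ← mul_add]
    congr 1
    exact (lintegral_add_left hf _).symm
  · intro f hf hmono ih
    have h1 : ∀ ω, V.indicator (1 : Ω → ℝ≥0∞) ω *
        pointSum (Φ ω) (C.indicator fun x => ⨆ n, f n x) =
        ⨆ n, V.indicator 1 ω * pointSum (Φ ω) (C.indicator (f n)) := by
      intro ω
      rw [← ENNReal.mul_iSup, ← pointSum_iSup]
      · congr 2
        funext x
        by_cases hx : x ∈ C <;> simp [hx]
      · exact fun i j hij x => Set.indicator_le_indicator (hmono hij x)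
    simp_rw [h1]
    rw [lintegral_iSup, lintegral_iSup hf hmono, ENNReal.mul_iSup]
    · simp_rw [ih]
    · exact fun n => hm (hf n)
    · exact fun i j hij ω => mul_le_mul_right (pointSum_mono _ fun x _ =>
        Set.indicator_le_indicator (hmono hij x)) _

/-- Campbell's formula on the event that a disjoint set is void. -/
lemma IsPoissonProcess.lintegral_void_mul_pointSum {B C : Set X} (hB : MeasurableSet B)
    (hC : MeasurableSet C) (hd : Disjoint B C) (hB' : Λ B ≠ ∞) (hC' : Λ C ≠ ∞)
    {f : X → ℝ≥0∞} (hf : Measurable f) :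
    ∫⁻ ω, {ω | count (Φ ω) B = 0}.indicator 1 ω * pointSum (Φ ω) (C.indicator f) ∂P =
      ENNReal.ofReal (Real.exp (-(Λ B).toReal)) * ∫⁻ x in C, f x ∂Λ := by
  have hvm : MeasurableSet {ω | count (Φ ω) B = 0} :=
    hΦ.measurable_count B hB (MeasurableSet.of_discrete (s := {(0 : ℕ∞)}))
  refine hΦ.lintegral_indicator_mul_pointSum hvm hC (fun s hs => ?_) hf
  have hm : MeasurableSet (C ∩ s) := hC.inter hs
  have hfin : Λ (C ∩ s) ≠ ∞ := ne_top_of_le_ne_top hC' (measure_mono Set.inter_subset_left)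
  -- Voidness of `B` and the count in `C ∩ s` concern disjoint sets, so the mean of the product
  -- factors.
  have hind0 := hΦ.indepFun_count hB hm (hd.mono_right Set.inter_subset_left)
  have hind : IndepFun (({0} : Set ℕ∞).indicator (1 : ℕ∞ → ℝ≥0∞) ∘ fun ω => count (Φ ω) B)
      ((fun n : ℕ∞ => (n : ℝ≥0∞)) ∘ fun ω => count (Φ ω) (C ∩ s)) P := by
    exact IndepFun.comp (_mβ := ENat.instMeasurableSpace) (_mβ' := ENat.instMeasurableSpace)
      hind0 measurable_from_top measurable_from_top
  have h := lintegral_mul_eq_lintegral_mul_lintegral_of_indepFun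
    (measurable_from_top.comp (hΦ.measurable_count B hB))
    (measurable_from_top.comp (hΦ.measurable_count _ hm)) hind
  have h2 : (({0} : Set ℕ∞).indicator (1 : ℕ∞ → ℝ≥0∞) ∘ fun ω => count (Φ ω) B) =
    {ω | count (Φ ω) B = 0}.indicator 1 := by
    funext ω
    by_cases h0 : count (Φ ω) B = 0 <;> simp [h0]
  rw [h2] at h
  refine h.trans ?_
  rw [lintegral_indicator_one hvm, hΦ.measure_void hB hB']
  congr 1
  exact hΦ.lintegral_count hm hfin

/-- Campbell's formula for a set with a single point, on the event that a disjoint set is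
void. -/
lemma IsPoissonProcess.lintegral_void_single_mul_pointSum {B C : Set X} (hB : MeasurableSet B)
    (hC : MeasurableSet C) (hd : Disjoint B C) (hB' : Λ B ≠ ∞) (hC' : Λ C ≠ ∞)
    {f : X → ℝ≥0∞} (hf : Measurable f) :
    ∫⁻ ω, {ω | count (Φ ω) B = 0 ∧ count (Φ ω) C = 1}.indicator 1 ω *
        pointSum (Φ ω) (C.indicator f) ∂P =
      ENNReal.ofReal (Real.exp (-(Λ B).toReal)) * ENNReal.ofReal (Real.exp (-(Λ C).toReal)) *
        ∫⁻ x in C, f x ∂Λ := by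
  have hvm : MeasurableSet {ω | count (Φ ω) B = 0 ∧ count (Φ ω) C = 1} :=
    (hΦ.measurable_count B hB (MeasurableSet.of_discrete (s := {(0 : ℕ∞)}))).inter
      (hΦ.measurable_count C hC (MeasurableSet.of_discrete (s := {(1 : ℕ∞)})))
  refine hΦ.lintegral_indicator_mul_pointSum hvm hC (fun s hs => ?_) hf
  have hm : MeasurableSet (C ∩ s) := hC.inter hs
  have hm' : MeasurableSet (C \ s) := hC.diff hs
  have hfin : Λ (C ∩ s) ≠ ∞ := ne_top_of_le_ne_top hC' (measure_mono Set.inter_subset_left)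
  have hfin' : Λ (C \ s) ≠ ∞ := ne_top_of_le_ne_top hC' (measure_mono Set.sdiff_subset)
  have hcount : ∀ ω, count (Φ ω) C = count (Φ ω) (C ∩ s) + count (Φ ω) (C \ s) := by
    intro ω
    unfold count
    rw [← Set.encard_union_eq]
    · rw [← Set.inter_union_distrib_left, Set.inter_union_sdiff]
    · exact Set.disjoint_left.mpr fun x hx hx' => hx'.2.2 hx.2.2
  have hmem : (⋂ i : Fin 3, (fun ω => count (Φ ω)
      (![B, C ∩ s, C \ s] i)) ⁻¹' (![{0}, {1}, {0}] i : Set ℕ∞)) = {ω | count (Φ ω) B = 0 ∧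
      count (Φ ω) (C ∩ s) = 1 ∧ count (Φ ω) (C \ s) = 0} := by
    ext ω
    simp [Fin.forall_fin_succ]
  -- If `C` holds a single point, the count in `C ∩ s` is 0 or 1, so the product is the indicator of
  -- the counts (0, 1, 0) in `B`, `C ∩ s`, `C \ s`.
  have hset : ∀ ω, {ω | count (Φ ω) B = 0 ∧ count (Φ ω) C = 1}.indicator (1 : Ω → ℝ≥0∞) ω *
      (count (Φ ω) (C ∩ s) : ℝ≥0∞) = {ω | count (Φ ω) B = 0 ∧
      count (Φ ω) (C ∩ s) = 1 ∧ count (Φ ω) (C \ s) = 0}.indicator 1 ω := by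
    intro ω
    simp only [Set.indicator_apply, Set.mem_ofPred_eq]
    by_cases h0 : count (Φ ω) B = 0
    · by_cases h1 : count (Φ ω) (C ∩ s) = 1
      · by_cases h2 : count (Φ ω) (C \ s) = 0
        · simp [h0, h1, h2, hcount]
        · have : ¬ (1 + count (Φ ω) (C \ s) = 1) := by
            intro h
            have h' : 1 + count (Φ ω) (C \ s) = 1 + 0 := by simpa using h
            exact h2 (ENat.add_right_injective_of_ne_top (by simp) h')
          simp [h0, h1, h2, hcount, this]
      · by_cases h3 : count (Φ ω) (C ∩ s) = 0
        · simp [h0, h3]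
        · have : ¬ (count (Φ ω) C = 1) := by
            intro h
            have hle1 : count (Φ ω) (C ∩ s) ≤ 1 := by
              rw [← h, hcount]; exact le_self_add
            exact h1 (le_antisymm hle1 (Order.one_le_iff_ne_zero.mpr h3))
          simp [h0, h1, this]
    · simp [h0]
  simp_rw [hset, ← hmem]
  have hBi : ∀ i : Fin 3, MeasurableSet (![B, C ∩ s, C \ s] i) := by
    intro i; fin_cases i <;> simpa
  have hind := hΦ.iIndepFun_count (ι := Fin 3) (B := ![B, C ∩ s, C \ s]) hBi
    (by
      have h1 : Disjoint B (C ∩ s) := hd.mono_right Set.inter_subset_left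
      have h2 : Disjoint B (C \ s) := hd.mono_right Set.sdiff_subset
      have h3 : Disjoint (C ∩ s) (C \ s) :=
        Set.disjoint_left.mpr fun x hx hx' => hx'.2 hx.2
      intro i j hij
      fin_cases i <;> fin_cases j <;> first | exact absurd rfl hij | simp [h1, h2, h3, h1.symm, h2.symm, h3.symm])
  have hmeas := hind.meas_iInter (s := fun i => (fun ω => count (Φ ω)
        (![B, C ∩ s, C \ s] i)) ⁻¹' (![{0}, {1}, {0}] i : Set ℕ∞))
        (fun i => ⟨_, MeasurableSet.of_discrete, rfl⟩)
  rw [lintegral_indicator_one, hmeas]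
  · simp only [Fin.prod_univ_three]
    have e1 := hΦ.measure_void hB hB'
    have e2 := hΦ.measure_count_eq hm hfin 1
    have e3 := hΦ.measure_void hm' hfin'
    change P {ω | count (Φ ω) B = 0} * P {ω | count (Φ ω) (C ∩ s) = (1 : ℕ∞)} *
      P {ω | count (Φ ω) (C \ s) = 0} = _
    rw [e1, e3]
    rw [Nat.cast_one] at e2
    rw [e2]
    -- The exponential factors of the two parts of `C` recombine to that of `C`; the factor Λ(C ∩ s)
    -- of the one-point probability remains.
    have hadd : (Λ C).toReal = (Λ (C ∩ s)).toReal + (Λ (C \ s)).toReal := by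
      rw [← ENNReal.toReal_add hfin hfin', measure_inter_add_sdiff _ hs]
    rw [hadd, neg_add, Real.exp_add, ENNReal.ofReal_mul (Real.exp_pos _).le]
    simp only [pow_one, Nat.factorial_one, Nat.cast_one, div_one]
    rw [ENNReal.ofReal_mul (Real.exp_pos _).le, ENNReal.ofReal_toReal hfin]
    ring
  · exact MeasurableSet.iInter fun i => hΦ.measurable_count _ (hBi i) MeasurableSet.of_discrete

/-- The Laplace functional of the counts in finitely many disjoint sets. -/
lemma IsPoissonProcess.lintegral_exp_sum_count {ι : Type*} [Fintype ι] {B : ι → Set X}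
    (hB : ∀ i, MeasurableSet (B i)) (hd : Pairwise fun i j => Disjoint (B i) (B j))
    (hB' : ∀ i, Λ (B i) ≠ ∞) (x : ι → ℝ) :
    ∫⁻ ω, ENNReal.ofReal (Real.exp (-∑ i, x i * (count (Φ ω) (B i)).toNat)) ∂P =
      ENNReal.ofReal (Real.exp (-∑ i, (Λ (B i)).toReal * (1 - Real.exp (-x i)))) := by
  have hind := (hΦ.iIndepFun_count hB hd).comp
    (fun i (n : ℕ∞) => ENNReal.ofReal (Real.exp (-(x i * n.toNat)))) (fun i => measurable_from_top)
  have h := lintegral_prod_eq_prod_lintegral_of_indepFun Finset.univ _ hind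
    (fun i => measurable_from_top.comp (hΦ.measurable_count _ (hB i)))
  simp only [Function.comp_apply] at h
  simp_rw [fun i => hΦ.lintegral_exp_count (hB i) (hB' i) (x := x i)] at h
  simp_rw [← ENNReal.ofReal_prod_of_nonneg fun i _ => (Real.exp_pos _).le, ← Real.exp_sum,
    Finset.sum_neg_distrib] at h
  simpa using h

end PoissonProcess

/-! ### Radial integrals in the plane and exponential integrals. -/

section Integrals

open Set

lemma lintegral_Ioi_comp_mul {a : ℝ} (ha : 0 < a) (f : ℝ → ℝ≥0∞) :
    ∫⁻ t in Ioi (0 : ℝ), ENNReal.ofReal a * f (a * t) = ∫⁻ t in Ioi (0 : ℝ), f t := by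
  have h := lintegral_image_eq_lintegral_abs_deriv_mul (s := Ioi (0 : ℝ)) (f := fun t => a * t)
    (f' := fun _ => a) measurableSet_Ioi
    (fun x _ => by simpa using ((hasDerivAt_id x).const_mul a).hasDerivWithinAt)
    (fun x _ y _ hxy => mul_left_cancel₀ ha.ne' hxy) f
  have himg : (fun t => a * t) '' Ioi (0 : ℝ) = Ioi 0 := by
    rw [image_mul_left_Ioi ha, mul_zero]
  rw [himg, abs_of_pos ha] at h
  exact h.symm

/-- Discs of radius r have area π r², so area becomes Lebesgue measure on the half-line. This
replaces polar coordinates for radial functions and makes depths a unit-rate process. -/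
lemma map_volume_norm_sq :
    (volume : Measure Plane).map (fun b => Real.pi * ‖b‖ ^ 2) = volume.restrict (Ioi 0) := by
  have hm : Measurable fun b : Plane => Real.pi * ‖b‖ ^ 2 := by fun_prop
  symm
  refine Real.measure_ext_Ioo_rat fun a b => ?_
  rw [Measure.map_apply hm measurableSet_Ioo, Measure.restrict_apply measurableSet_Ioo,
    Ioo_inter_Ioi, Real.volume_Ioo]
  rcases le_or_gt (b : ℝ) 0 with hb | hb
  · have : (fun x : Plane => Real.pi * ‖x‖ ^ 2) ⁻¹' Ioo (a : ℝ) b = ∅ := by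
      ext x
      simp only [mem_preimage, mem_Ioo, mem_empty_iff_false, iff_false, not_and, not_lt]
      intro _
      exact hb.trans (by positivity)
    rw [this, measure_empty, ENNReal.ofReal_of_nonpos]
    linarith [le_max_right (a : ℝ) 0]
  have hball : ∀ c : ℝ, 0 ≤ c → {x : Plane | Real.pi * ‖x‖ ^ 2 < c} =
      Metric.ball 0 (Real.sqrt (c / Real.pi)) := by
    intro c hc
    ext x
    rw [mem_ball_zero_iff, Real.lt_sqrt (norm_nonneg x), lt_div_iff₀ Real.pi_pos, mem_ofPred_eq,
      mul_comm]
  have hcball : ∀ c : ℝ, 0 ≤ c → {x : Plane | Real.pi * ‖x‖ ^ 2 ≤ c} =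
      Metric.closedBall 0 (Real.sqrt (c / Real.pi)) := by
    intro c hc
    ext x
    rw [mem_closedBall_zero_iff, Real.le_sqrt (norm_nonneg x), le_div_iff₀ Real.pi_pos,
      mem_ofPred_eq, mul_comm]
    positivity
  have hvol : ∀ c : ℝ, 0 ≤ c → ENNReal.ofReal (Real.sqrt (c / Real.pi)) ^ 2 *
      ENNReal.ofReal Real.pi = ENNReal.ofReal c := by
    intro c hc
    rw [← ENNReal.ofReal_pow (Real.sqrt_nonneg _), ← ENNReal.ofReal_mul (by positivity),
      Real.sq_sqrt (by positivity), div_mul_cancel₀ _ Real.pi_ne_zero]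
  rcases lt_or_ge (a : ℝ) 0 with ha | ha
  · have : (fun x : Plane => Real.pi * ‖x‖ ^ 2) ⁻¹' Ioo (a : ℝ) b =
        {x : Plane | Real.pi * ‖x‖ ^ 2 < b} := by
      ext x
      simp only [mem_preimage, mem_Ioo, mem_ofPred_eq, and_iff_right_iff_imp]
      intro _
      exact ha.trans_le (by positivity)
    rw [this, hball _ hb.le, EuclideanSpace.volume_ball_fin_two, hvol _ hb.le,
      max_eq_right ha.le, sub_zero]
  · have : (fun x : Plane => Real.pi * ‖x‖ ^ 2) ⁻¹' Ioo (a : ℝ) b =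
        {x : Plane | Real.pi * ‖x‖ ^ 2 < b} \ {x : Plane | Real.pi * ‖x‖ ^ 2 ≤ a} := by
      ext x
      simp only [mem_preimage, mem_Ioo, mem_sdiff, mem_ofPred_eq, not_le]
      tauto
    rw [this, max_eq_left ha]
    rcases le_or_gt (b : ℝ) a with hab | hab
    · rw [ENNReal.ofReal_of_nonpos (by linarith)]
      symm
      have he : {x : Plane | Real.pi * ‖x‖ ^ 2 < b} \ {x : Plane | Real.pi * ‖x‖ ^ 2 ≤ a} = ∅ := by
        ext x
        simp only [mem_sdiff, mem_ofPred_eq, not_le, mem_empty_iff_false, iff_false, not_and, not_lt]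
        intro h
        linarith
      rw [he, measure_empty]
    · rw [measure_sdiff, hball _ hb.le, hcball _ ha, EuclideanSpace.volume_ball_fin_two,
        EuclideanSpace.volume_closedBall_fin_two, hvol _ hb.le, hvol _ ha, ENNReal.ofReal_sub _ ha]
      · intro x hx
        exact lt_of_le_of_lt hx hab
      · exact (measurableSet_le hm measurable_const).nullMeasurableSet
      · rw [hcball _ ha, EuclideanSpace.volume_closedBall_fin_two, hvol _ ha]
        exact ENNReal.ofReal_ne_top

lemma lintegral_comp_norm_sq {f : ℝ → ℝ≥0∞} (hf : Measurable f) :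
    ∫⁻ b : Plane, f (Real.pi * ‖b‖ ^ 2) = ∫⁻ t in Ioi (0 : ℝ), f t := by
  rw [← map_volume_norm_sq, lintegral_map hf (by fun_prop)]

instance : IsProbabilityMeasure (expMeasure 1) := isProbabilityMeasure_expMeasure one_pos

lemma lintegral_expMeasure {f : ℝ → ℝ≥0∞} (hf : Measurable f) :
    ∫⁻ x, f x ∂expMeasure 1 = ∫⁻ x in Ioi (0 : ℝ), ENNReal.ofReal (Real.exp (-x)) * f x := by
  have h1 : expMeasure 1 = volume.withDensity (exponentialPDF 1) := rfl
  rw [h1, lintegral_withDensity_eq_lintegral_mul _ _ hf]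
  · rw [← setLIntegral_congr Ioi_ae_eq_Ici.symm, ← lintegral_indicator measurableSet_Ici]
    congr 1
    funext x
    rcases lt_or_ge x 0 with hx | hx
    · simp [exponentialPDF_of_neg hx, hx]
    · simp [exponentialPDF_of_nonneg hx, hx]
  · exact (measurable_exponentialPDFReal 1).ennreal_ofReal

lemma ae_expMeasure_pos : ∀ᵐ x ∂expMeasure 1, 0 < x := by
  rw [ae_iff, ← lintegral_indicator_one (by measurability), lintegral_expMeasure
    (measurable_one.indicator (by measurability))]
  rw [lintegral_eq_zero_iff' (by
    refine AEMeasurable.mul (by fun_prop) ?_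
    exact (measurable_one.indicator (by measurability)).aemeasurable)]
  filter_upwards [ae_restrict_mem measurableSet_Ioi] with x hx
  have : (0 : ℝ) < x := hx
  simp [this]

lemma lintegral_exp_neg_mul_Ioi {c : ℝ} (hc : 0 < c) :
    ∫⁻ x in Ioi (0 : ℝ), ENNReal.ofReal (Real.exp (-(c * x))) = ENNReal.ofReal (1 / c) := by
  have h0 : IntegrableOn (fun x : ℝ => Real.exp (-c * x)) (Ioi 0) :=
    integrableOn_exp_mul_Ioi (by linarith) 0
  have h := integral_exp_mul_Ioi (a := -c) (by linarith) 0
  have h2 : (fun x : ℝ => Real.exp (-c * x)) = fun x => Real.exp (-(c * x)) := by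
    funext x; ring_nf
  rw [h2] at h0 h
  rw [← ofReal_integral_eq_lintegral_ofReal h0 (Filter.Eventually.of_forall fun x =>
    (Real.exp_pos _).le), h]
  congr 1
  simp [neg_div]

lemma lintegral_exp_expMeasure {c : ℝ} (hc : 0 ≤ c) :
    ∫⁻ x, ENNReal.ofReal (Real.exp (-(c * x))) ∂expMeasure 1 = ENNReal.ofReal (1 / (1 + c)) := by
  rw [lintegral_expMeasure (by fun_prop), ← lintegral_exp_neg_mul_Ioi (by linarith)]
  congr 1
  funext x
  rw [← ENNReal.ofReal_mul (Real.exp_pos _).le, ← Real.exp_add]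
  congr 2; ring

end Integrals

/-! ### The mass of the nearest-point density in an antenna lobe. -/

section Lobe

open Set InnerProductGeometry

/-- The vectors that a main lobe of angle `θ` in direction `e` covers, as a closed cone. -/
def lobe (θ : ℝ) (e : Plane) : Set Plane := {v | Real.cos (θ / 2) * (‖v‖ * ‖e‖) ≤ inner ℝ v e}

lemma mem_lobe_of_angle_le {θ : ℝ} {v e : Plane} (hθ : θ < 2 * Real.pi) (h : angle v e ≤ θ / 2) :
    v ∈ lobe θ e := by
  have h1 := Real.cos_le_cos_of_nonneg_of_le_pi (angle_nonneg v e) (by linarith) h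
  have h2 := cos_angle_mul_norm_mul_norm v e
  show Real.cos (θ / 2) * (‖v‖ * ‖e‖) ≤ inner ℝ v e
  rw [← h2]
  gcongr

lemma angle_le_of_mem_lobe {θ : ℝ} {v e : Plane} (hθ : 0 < θ) (hθ' : θ < 2 * Real.pi)
    (hv : v ≠ 0) (he : e ≠ 0) (h : v ∈ lobe θ e) : angle v e ≤ θ / 2 := by
  have h2 := cos_angle_mul_norm_mul_norm v e
  have h3 : Real.cos (θ / 2) * (‖v‖ * ‖e‖) ≤ inner ℝ v e := h
  rw [← h2] at h3
  have hpos : 0 < ‖v‖ * ‖e‖ := by positivity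
  exact (Real.strictAntiOn_cos.le_iff_ge ⟨by linarith, by linarith⟩
    ⟨angle_nonneg v e, angle_le_pi v e⟩).mp (le_of_mul_le_mul_right h3 hpos)

lemma isClosed_lobe (θ : ℝ) (e : Plane) : IsClosed (lobe θ e) :=
  isClosed_le (by fun_prop) (by fun_prop)

/-- The mean mass that the nearest-point density of intensity `lm` gives to a lobe, both
thickened on the scale `h`. -/
def lobeMass (lm θ h : ℝ) (e : Plane) : ℝ≥0∞ :=
  ∫⁻ v in Metric.cthickening (2 * h) (lobe θ e),
    ENNReal.ofReal (lm * Real.exp (-(lm * (Real.pi * (max (‖v‖ - 4 * h) 0) ^ 2))))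

lemma measurableSet_lobe (θ : ℝ) (e : Plane) : MeasurableSet (lobe θ e) :=
  (isClosed_lobe θ e).measurableSet

lemma measurableSet_cthickening_lobe (θ : ℝ) {r : ℝ} (hr : 0 ≤ r) :
    MeasurableSet {p : Plane × Plane | p.1 ∈ Metric.cthickening r (lobe θ p.2)} := by
  -- The thickening is the projection of a closed set along a compact ball of displacements, hence
  -- closed jointly in the point and the direction.
  have hC : IsClosed {q : (Plane × Plane) × Metric.closedBall (0 : Plane) r |
      Real.cos (θ / 2) * (‖q.1.1 + q.2‖ * ‖q.1.2‖) ≤ inner ℝ (q.1.1 + q.2) q.1.2} :=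
    isClosed_le (by fun_prop) (by fun_prop)
  refine IsClosed.measurableSet ?_
  convert isClosedMap_fst_of_compactSpace _ hC using 1
  ext ⟨v, e⟩
  rw [mem_ofPred_eq, (isClosed_lobe θ e).cthickening_eq_biUnion_closedBall hr]
  simp only [mem_iUnion, Metric.mem_closedBall, exists_prop, mem_image, mem_ofPred_eq,
    Prod.exists, exists_and_right, exists_eq_right]
  constructor
  · rintro ⟨x, hx, hd⟩
    refine ⟨⟨x - v, by simpa [← dist_eq_norm, dist_comm] using hd⟩, ?_⟩
    simpa [lobe] using hx
  · rintro ⟨⟨d, hd⟩, h⟩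
    exact ⟨v + d, h, by simpa [dist_eq_norm] using hd⟩

/-- In polar coordinates the radial factor integrates to 1/(2π) and the angle ranges over an
interval of length at most θ. The computation is done in ℂ, where the angle with 1 is |arg|. -/
lemma lintegral_lobe_one {lm θ : ℝ} (hlm : 0 < lm) (hθ : 0 < θ) :
    ∫⁻ v in {v : ℂ | angle v 1 ≤ θ / 2},
      ENNReal.ofReal (lm * Real.exp (-(lm * (Real.pi * ‖v‖ ^ 2)))) ≤
      ENNReal.ofReal (θ / (2 * Real.pi)) := by
  have hmeas : MeasurableSet {v : ℂ | angle v 1 ≤ θ / 2} := by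
    refine measurableSet_le ?_ measurable_const
    unfold angle
    fun_prop
  rw [← lintegral_indicator hmeas, ← Complex.lintegral_comp_polarCoord_symm]
  have hle : ∀ p ∈ polarCoord.target, ENNReal.ofReal p.1 • {v : ℂ | angle v 1 ≤ θ / 2}.indicator
      (fun v => ENNReal.ofReal (lm * Real.exp (-(lm * (Real.pi * ‖v‖ ^ 2)))))
        (Complex.polarCoord.symm p) ≤
      ((Ioi (0 : ℝ)).indicator (fun r => ENNReal.ofReal (r * (lm * Real.exp (-(lm * (Real.pi * r ^ 2)))))) p.1) *
        ((Icc (-(θ / 2)) (θ / 2)).indicator 1 p.2) := by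
    intro p hp
    have hp' : p ∈ Complex.polarCoord.target := hp
    have hinv := Complex.polarCoord.right_inv hp'
    rw [Complex.polarCoord_apply] at hinv
    have h1 : ‖Complex.polarCoord.symm p‖ = p.1 := congrArg Prod.fst hinv
    have h2 : (Complex.polarCoord.symm p).arg = p.2 := congrArg Prod.snd hinv
    rw [polarCoord_target] at hp
    have hr : 0 < p.1 := hp.1
    have hne : Complex.polarCoord.symm p ≠ 0 := by
      rw [← norm_pos_iff, h1]; exact hr
    by_cases hmem : angle (Complex.polarCoord.symm p) 1 ≤ θ / 2
    · rw [indicator_of_mem (by exact hmem), indicator_of_mem (show p.1 ∈ Ioi (0 : ℝ) from hr),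
        indicator_of_mem, h1, smul_eq_mul, ← ENNReal.ofReal_mul hr.le]
      · simp
      · rw [Complex.angle_one_right hne, h2] at hmem
        exact abs_le.mp hmem
    · rw [indicator_of_notMem (by exact hmem)]
      simp
  have hmt : MeasurableSet polarCoord.target := polarCoord.open_target.measurableSet
  refine (setLIntegral_mono' hmt hle).trans ?_
  refine (lintegral_mono' Measure.restrict_le_self le_rfl).trans ?_
  rw [Measure.volume_eq_prod, lintegral_prod_mul]
  · rw [lintegral_indicator measurableSet_Ioi, lintegral_indicator_one measurableSet_Icc,
      Real.volume_Icc]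
    have hI : ∫⁻ r in Ioi (0 : ℝ), ENNReal.ofReal (r * (lm * Real.exp (-(lm * (Real.pi * r ^ 2))))) =
        ENNReal.ofReal (1 / (2 * Real.pi)) := by
      have hint : IntegrableOn (fun r : ℝ => r * (lm * Real.exp (-(lm * (Real.pi * r ^ 2))))) (Ioi 0) := by
        have h := (integrable_mul_exp_neg_mul_sq (b := lm * Real.pi) (by positivity)).integrableOn
          (s := Ioi 0)
        refine (h.const_mul lm).congr (Filter.Eventually.of_forall fun r => ?_)
        simp only
        rw [show -(lm * Real.pi) * r ^ 2 = -(lm * (Real.pi * r ^ 2)) by ring]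
        ring
      rw [← ofReal_integral_eq_lintegral_ofReal hint]
      · congr 1
        have := integral_Ioi_of_hasDerivAt_of_tendsto (a := 0) (m := 0)
          (f := fun r : ℝ => -(1 / (2 * Real.pi)) * Real.exp (-(lm * (Real.pi * r ^ 2))))
          (f' := fun r : ℝ => r * (lm * Real.exp (-(lm * (Real.pi * r ^ 2)))))
          (by fun_prop) ?_ hint ?_
        · rw [this]; simp
        · intro x _
          have hd : HasDerivAt (fun r : ℝ => -(lm * (Real.pi * r ^ 2)))
              (-(lm * (Real.pi * (2 * x)))) x := by
            have hd0 := (((hasDerivAt_pow 2 x).const_mul Real.pi).const_mul lm).fun_neg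
            simpa using hd0
          have hpi := Real.pi_ne_zero
          refine (hd.exp.const_mul (-(1 / (2 * Real.pi)))).congr_deriv ?_
          field_simp
        · have h0 : Filter.Tendsto (fun r : ℝ => Real.exp (-(lm * (Real.pi * r ^ 2))))
              Filter.atTop (nhds 0) := by
            refine Real.tendsto_exp_neg_atTop_nhds_zero.comp ?_
            exact ((Filter.tendsto_pow_atTop two_ne_zero).const_mul_atTop Real.pi_pos).const_mul_atTop hlm
          simpa using h0.const_mul (-(1 / (2 * Real.pi)))
      · filter_upwards [ae_restrict_mem measurableSet_Ioi] with r hr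
        have : (0 : ℝ) < r := hr
        positivity
    rw [hI, ← ENNReal.ofReal_mul (by positivity)]
    refine ENNReal.ofReal_le_ofReal (le_of_eq ?_)
    field_simp
    ring
  · exact (Measurable.indicator (by fun_prop) measurableSet_Ioi).aemeasurable
  · exact (measurable_one.indicator measurableSet_Icc).aemeasurable

/-- The density is radial and thickenings are carried along by isometries, so the mass does not
depend on the direction of the lobe. -/
lemma lobeMass_map (lm θ h : ℝ) (e : Plane) (U : Plane ≃ₗᵢ[ℝ] Plane) :
    lobeMass lm θ h (U e) = lobeMass lm θ h e := by
  unfold lobeMass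
  rw [← lintegral_indicator Metric.isClosed_cthickening.measurableSet,
    ← lintegral_indicator Metric.isClosed_cthickening.measurableSet,
    ← U.measurePreserving.lintegral_comp_emb U.toHomeomorph.measurableEmbedding]
  congr 1
  funext v
  have hlobe : U ⁻¹' lobe θ (U e) = lobe θ e := by
    ext v
    simp [lobe, U.inner_map_map]
  have hmem : U v ∈ Metric.cthickening (2 * h) (lobe θ (U e)) ↔
      v ∈ Metric.cthickening (2 * h) (lobe θ e) := by
    rw [Metric.mem_cthickening_iff, Metric.mem_cthickening_iff, ← hlobe]
    have := Metric.infEDist_image (Φ := U) U.isometry (x := v) (t := U ⁻¹' lobe θ (U e))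
    rw [image_preimage_eq _ U.surjective] at this
    rw [this]
  by_cases hv : v ∈ Metric.cthickening (2 * h) (lobe θ e)
  · rw [indicator_of_mem hv, indicator_of_mem (hmem.mpr hv), U.norm_map]
  · rw [indicator_of_notMem hv, indicator_of_notMem (fun hh => hv (hmem.mp hh))]

lemma lobe_smul (θ : ℝ) (e : Plane) {r : ℝ} (hr : 0 < r) : lobe θ (r • e) = lobe θ e := by
  ext v
  simp only [lobe, mem_ofPred_eq, norm_smul, inner_smul_right, Real.norm_of_nonneg hr.le]
  rw [show Real.cos (θ / 2) * (‖v‖ * (r * ‖e‖)) = r * (Real.cos (θ / 2) * (‖v‖ * ‖e‖)) by ring,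
    mul_le_mul_iff_right₀ hr]

/-- Only the direction of `e` matters, and a reflection exchanges any two unit vectors. -/
lemma lobeMass_eq (lm θ h : ℝ) {e e' : Plane} (he : e ≠ 0) (he' : e' ≠ 0) :
    lobeMass lm θ h e = lobeMass lm θ h e' := by
  have hnorm : ∀ e : Plane, e ≠ 0 → lobeMass lm θ h (‖e‖⁻¹ • e) = lobeMass lm θ h e := by
    intro e he
    unfold lobeMass
    rw [lobe_smul _ _ (by positivity)]
  rw [← hnorm e he, ← hnorm e' he', ← lobeMass_map lm θ h (‖e‖⁻¹ • e)
    (Submodule.reflection (Submodule.span ℝ {‖e‖⁻¹ • e - ‖e'‖⁻¹ • e'})ᗮ), Submodule.reflection_sub]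
  rw [norm_smul, norm_smul, norm_inv, norm_inv, norm_norm, norm_norm,
    inv_mul_cancel₀ (norm_ne_zero_iff.mpr he), inv_mul_cancel₀ (norm_ne_zero_iff.mpr he')]

lemma exists_unit_lintegral_lobe_le {lm θ : ℝ} (hlm : 0 < lm) (hθ : 0 < θ)
    (hθ' : θ < 2 * Real.pi) :
    ∃ e : Plane, e ≠ 0 ∧ ∫⁻ v in lobe θ e,
      ENNReal.ofReal (lm * Real.exp (-(lm * (Real.pi * ‖v‖ ^ 2)))) ≤
      ENNReal.ofReal (θ / (2 * Real.pi)) := by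
  let U : ℂ ≃ₗᵢ[ℝ] Plane := Complex.orthonormalBasisOneI.repr
  refine ⟨U 1, by simp, le_trans ?_ (lintegral_lobe_one hlm hθ)⟩
  have hmeas : MeasurableSet {v : ℂ | angle v 1 ≤ θ / 2} := by
    refine measurableSet_le ?_ measurable_const
    unfold angle
    fun_prop
  rw [← lintegral_indicator (measurableSet_lobe _ _), ← lintegral_indicator hmeas,
    ← U.measurePreserving.lintegral_comp_emb U.toHomeomorph.measurableEmbedding]
  have h0 : ∀ᵐ v : ℂ, v ≠ 0 := by
    rw [ae_iff]; simp
  refine lintegral_mono_ae ?_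
  filter_upwards [h0] with v hv
  have h := U.toLinearIsometry.angle_map v 1
  simp only [LinearIsometryEquiv.coe_toLinearIsometry] at h
  by_cases hm : U v ∈ lobe θ (U 1)
  · have h1 := angle_le_of_mem_lobe hθ hθ' (by simpa using hv) (by simp) hm
    rw [h] at h1
    rw [indicator_of_mem hm, indicator_of_mem (by exact h1), U.norm_map]
  · rw [indicator_of_notMem hm]
    exact zero_le

/-- As the scale `h` tends to `0`, the mass of a lobe of angle `θ` is at most `θ / (2 π)`. -/
lemma exists_lobeMass_le {lm θ ε : ℝ} (hlm : 0 < lm) (hθ : 0 < θ) (hθ' : θ < 2 * Real.pi) (hε : 0 < ε) :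
    ∃ h : ℝ, 0 < h ∧ h < 1 ∧ ∀ e : Plane, e ≠ 0 →
      lobeMass lm θ h e ≤ ENNReal.ofReal (θ / (2 * Real.pi) + ε) := by
  obtain ⟨e, he, hle⟩ := exists_unit_lintegral_lobe_le hlm hθ hθ'
  let F : ℝ → Plane → ℝ≥0∞ := fun h => (Metric.cthickening (2 * h) (lobe θ e)).indicator fun v =>
    ENNReal.ofReal (lm * Real.exp (-(lm * (Real.pi * (max (‖v‖ - 4 * h) 0) ^ 2))))
  let F0 : Plane → ℝ≥0∞ := (lobe θ e).indicator fun v =>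
    ENNReal.ofReal (lm * Real.exp (-(lm * (Real.pi * ‖v‖ ^ 2))))
  let bd : Plane → ℝ≥0∞ := fun v => ENNReal.ofReal (lm * Real.exp (16 * lm * Real.pi)) *
    ENNReal.ofReal (Real.exp (-(lm / 2 * (Real.pi * ‖v‖ ^ 2))))
  have hlim : Filter.Tendsto (fun h => ∫⁻ v, F h v) (nhdsWithin 0 (Ioi 0)) (nhds (∫⁻ v, F0 v)) := by
    refine tendsto_lintegral_filter_of_dominated_convergence bd ?_ ?_ ?_ ?_
    · exact Filter.Eventually.of_forall fun h => Measurable.indicator (by fun_prop)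
        Metric.isClosed_cthickening.measurableSet
    · have : Ioo (0 : ℝ) 1 ∈ nhdsWithin (0 : ℝ) (Ioi 0) := Ioo_mem_nhdsGT one_pos
      filter_upwards [this] with h hh
      refine Filter.Eventually.of_forall fun v => ?_
      refine (indicator_le_self _ _ _).trans ?_
      simp only [bd]
      rw [← ENNReal.ofReal_mul (by positivity)]
      refine ENNReal.ofReal_le_ofReal ?_
      rw [mul_assoc, ← Real.exp_add]
      have hpi := Real.pi_pos
      -- This is (a - b)² ≥ a²/2 - b² with b = 4h < 4; it makes the bound Gaussian and uniform in
      -- `h`.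
      have hkey : ‖v‖ ^ 2 / 2 - 16 ≤ (max (‖v‖ - 4 * h) 0) ^ 2 := by
        rcases le_total (‖v‖ - 4 * h) 0 with h1 | h1
        · rw [max_eq_right h1]
          nlinarith [norm_nonneg v, hh.1, hh.2]
        · rw [max_eq_left h1]
          nlinarith [sq_nonneg (‖v‖ - 8 * h), hh.1, hh.2]
      gcongr
      have h2 : lm * (Real.pi * (‖v‖ ^ 2 / 2 - 16)) ≤
        lm * (Real.pi * (max (‖v‖ - 4 * h) 0) ^ 2) := by gcongr
      linarith
    · rw [lintegral_const_mul _ (by fun_prop)]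
      refine ENNReal.mul_ne_top ENNReal.ofReal_ne_top ?_
      have h := lintegral_comp_norm_sq (f := fun t => ENNReal.ofReal (Real.exp (-(lm / 2 * t))))
        (by fun_prop)
      rw [h, lintegral_exp_neg_mul_Ioi (by positivity)]
      exact ENNReal.ofReal_ne_top
    · refine Filter.Eventually.of_forall fun v => ?_
      by_cases hvl : v ∈ lobe θ e
      · have hmem : ∀ h, v ∈ Metric.cthickening (2 * h) (lobe θ e) :=
          fun h => Metric.self_subset_cthickening _ hvl
        simp only [F, F0, indicator_of_mem hvl, indicator_of_mem (hmem _)]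
        have hc : Continuous fun h : ℝ => ENNReal.ofReal
            (lm * Real.exp (-(lm * (Real.pi * (max (‖v‖ - 4 * h) 0) ^ 2)))) :=
          ENNReal.continuous_ofReal.comp (by fun_prop)
        have := (hc.tendsto 0).mono_left (nhdsWithin_le_nhds (s := Ioi (0 : ℝ)))
        simpa using this
      · have hcl : v ∉ closure (lobe θ e) := by rwa [(isClosed_lobe θ e).closure_eq]
        rw [Metric.closure_eq_iInter_cthickening] at hcl
        simp only [mem_iInter, not_forall] at hcl
        obtain ⟨δ, hδ, hvδ⟩ := hcl
        refine Filter.Tendsto.congr' ?_ tendsto_const_nhds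
        have : Ioo (0 : ℝ) (δ / 2) ∈ nhdsWithin (0 : ℝ) (Ioi 0) := Ioo_mem_nhdsGT (by positivity)
        filter_upwards [this] with h hh
        have h1 : v ∉ Metric.cthickening (2 * h) (lobe θ e) := fun h2 =>
          hvδ (Metric.cthickening_mono (by linarith [hh.2]) _ h2)
        simp only [F, F0, indicator_of_notMem hvl, indicator_of_notMem h1]
  have hlt : ∫⁻ v, F0 v < ENNReal.ofReal (θ / (2 * Real.pi) + ε) := by
    rw [lintegral_indicator (measurableSet_lobe _ _)]
    refine hle.trans_lt ?_
    rw [ENNReal.ofReal_lt_ofReal_iff] <;> have := Real.pi_pos <;> first | linarith | positivity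
  have hev := hlim.eventually_lt_const hlt
  have h1 : Ioo (0 : ℝ) 1 ∈ nhdsWithin (0 : ℝ) (Ioi 0) := Ioo_mem_nhdsGT one_pos
  obtain ⟨h, hh1, hh2⟩ := (hev.and h1).exists
  refine ⟨h, hh2.1, hh2.2, fun e' he' => ?_⟩
  rw [lobeMass_eq lm θ h he' he]
  rw [lobeMass, ← lintegral_indicator Metric.isClosed_cthickening.measurableSet]
  exact hh1.le

end Lobe

/-! ### Logarithmic moments through Laplace transforms; the stable law and the constant rho. -/

section RealIntegrals

open Set

lemma lintegral_exp_Ioc {s x : ℝ} (hs : 0 < s) (hx : 0 ≤ x) :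
    ∫⁻ u in Ioc 0 x, ENNReal.ofReal (Real.exp (-(s * (1 + u)))) =
      ENNReal.ofReal ((1 - Real.exp (-(s * x))) * Real.exp (-s) / s) := by
  have hc : Continuous fun u : ℝ => Real.exp (-(s * (1 + u))) := by fun_prop
  rw [← ofReal_integral_eq_lintegral_ofReal
    ((hc.integrableOn_Icc (a := 0) (b := x)).mono_set Ioc_subset_Icc_self)
    (Filter.Eventually.of_forall fun u => (Real.exp_pos _).le),
    ← intervalIntegral.integral_of_le hx]
  congr 1
  rw [intervalIntegral.integral_eq_sub_of_hasDerivAt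
    (f := fun u => -(1 / s) * Real.exp (-(s * (1 + u))))]
  · rw [show -(s * (1 + x)) = -(s * x) + -s by ring, Real.exp_add]
    simp only [add_zero, mul_one]
    field_simp
    ring
  · intro u _
    have hd : HasDerivAt (fun u : ℝ => -(s * (1 + u))) (-s) u := by
      simpa using (((hasDerivAt_id u).const_add 1).const_mul s).fun_neg
    refine (hd.exp.const_mul (-(1 / s))).congr_deriv ?_
    field_simp
  · exact hc.intervalIntegrable _ _

/-- `log (1 + x)` as a mixture of the functions `1 - exp (-s x)`. -/
lemma lintegral_one_sub_exp {x : ℝ} (hx : 0 ≤ x) :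
    ∫⁻ s in Ioi (0 : ℝ), ENNReal.ofReal ((1 - Real.exp (-(s * x))) * Real.exp (-s) / s) =
      ENNReal.ofReal (Real.log (1 + x)) := by
  -- Both sides equal the integral of 1/(1 + u) over 0 < u ≤ x, where 1/(1 + u) is itself the
  -- integral of exp(-s(1 + u)) over s > 0.
  have h1 : ∫⁻ s in Ioi (0 : ℝ), ENNReal.ofReal ((1 - Real.exp (-(s * x))) * Real.exp (-s) / s) =
      ∫⁻ s in Ioi (0 : ℝ), ∫⁻ u in Ioc 0 x, ENNReal.ofReal (Real.exp (-(s * (1 + u)))) :=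
    setLIntegral_congr_fun measurableSet_Ioi fun s hs => (lintegral_exp_Ioc hs hx).symm
  rw [h1, lintegral_lintegral_swap (by fun_prop)]
  have h2 : ∫⁻ u in Ioc 0 x, ∫⁻ s in Ioi (0 : ℝ), ENNReal.ofReal (Real.exp (-(s * (1 + u)))) =
      ∫⁻ u in Ioc 0 x, ENNReal.ofReal (1 / (1 + u)) := by
    refine setLIntegral_congr_fun measurableSet_Ioc fun u hu => ?_
    have h0 : 0 < 1 + u := by linarith [hu.1]
    rw [← lintegral_exp_neg_mul_Ioi h0]
    simp_rw [mul_comm]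
  have hint : IntegrableOn (fun u : ℝ => 1 / (1 + u)) (Icc 0 x) := by
    refine ContinuousOn.integrableOn_Icc (ContinuousOn.div (by fun_prop) (by fun_prop) ?_)
    intro u hu
    linarith [hu.1]
  rw [h2, ← ofReal_integral_eq_lintegral_ofReal (hint.mono_set Ioc_subset_Icc_self),
    ← intervalIntegral.integral_of_le hx]
  · congr 1
    rw [intervalIntegral.integral_eq_sub_of_hasDerivAt (f := fun u => Real.log (1 + u))]
    · simp
    · intro u hu
      rw [uIcc_of_le hx] at hu
      exact ((hasDerivAt_id u).const_add 1).log (by simp only [id]; linarith [hu.1])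
    · rw [intervalIntegrable_iff, uIoc_of_le hx]
      exact hint.mono_set Ioc_subset_Icc_self
  · filter_upwards [ae_restrict_mem measurableSet_Ioc] with u hu
    have : 0 < u := hu.1
    positivity

lemma integrable_rpow_expMeasure {q : ℝ} (hq : -1 < q) :
    Integrable (fun x : ℝ => x ^ q) (expMeasure 1) := by
  have h := Real.GammaIntegral_convergent (s := q + 1) (by linarith)
  refine ⟨by fun_prop, ?_⟩
  rw [hasFiniteIntegral_iff_enorm, lintegral_expMeasure (by fun_prop)]
  refine lt_of_le_of_lt (le_of_eq ?_) h.2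
  refine setLIntegral_congr_fun measurableSet_Ioi fun x hx => ?_
  simp only [add_sub_cancel_right]
  rw [enorm_mul]
  congr 1
  rw [Real.enorm_eq_ofReal (Real.exp_pos _).le]

lemma log_le_two_mul_sqrt {x : ℝ} (hx : 0 < x) : Real.log x ≤ 2 * x ^ (1 / 2 : ℝ) := by
  have h := Real.log_le_rpow_div hx.le (ε := 1 / 2) (by norm_num)
  linarith

/-- |log x| is at most 2(x^(1/2) + x^(-1/2)), and both powers have finite mean under the exponential
law. -/
lemma integrable_log_expMeasure : Integrable Real.log (expMeasure 1) := by
  have h1 := (integrable_rpow_expMeasure (q := 1 / 2) (by norm_num)).const_mul 2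
  have h2 := (integrable_rpow_expMeasure (q := -(1 / 2)) (by norm_num)).const_mul 2
  refine (h1.add h2).mono' Real.measurable_log.aestronglyMeasurable ?_
  filter_upwards [ae_expMeasure_pos] with x hx
  have h3 := log_le_two_mul_sqrt hx
  have h4 := log_le_two_mul_sqrt (inv_pos.mpr hx)
  rw [Real.log_inv, Real.inv_rpow hx.le, ← Real.rpow_neg hx.le] at h4
  have h5 : 0 ≤ x ^ (1 / 2 : ℝ) := by positivity
  have h6 : 0 ≤ x ^ (-(1 / 2) : ℝ) := by positivity
  simp only [Pi.add_apply]
  rw [Real.norm_eq_abs, abs_le]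
  constructor <;> linarith

/-- The mean of the logarithm of an exponential variable. -/
def meanLogExp : ℝ := ∫ x, Real.log x ∂expMeasure 1

lemma measure_expMeasure_lt {x : ℝ} (hx : 0 ≤ x) :
    expMeasure 1 (Ioi x) = ENNReal.ofReal (Real.exp (-x)) := by
  have h := cdf_expMeasure_eq one_pos x
  rw [if_pos hx, one_mul] at h
  have h2 := ofReal_cdf (expMeasure 1) x
  rw [h] at h2
  rw [← compl_Iic, measure_compl measurableSet_Iic (measure_ne_top _ _), ← h2, measure_univ,
    ← ENNReal.ofReal_one, ← ENNReal.ofReal_sub _ (by simp [hx])]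
  congr 1; ring

lemma measure_expMeasure_le {x : ℝ} (hx : 0 ≤ x) :
    expMeasure 1 (Iic x) = ENNReal.ofReal (1 - Real.exp (-x)) := by
  have h := cdf_expMeasure_eq one_pos x
  rw [if_pos hx, one_mul] at h
  rw [← ofReal_cdf (expMeasure 1) x, h]

lemma lintegral_inv_Ico {x y : ℝ} (hx : 0 < x) (hy : 0 < y) :
    ∫⁻ s in Ico x y, ENNReal.ofReal (1 / s) = ENNReal.ofReal (Real.log y - Real.log x) := by
  rcases le_or_gt y x with hxy | hxy
  · rw [Ico_eq_empty (not_lt.mpr hxy), Measure.restrict_empty, lintegral_zero_measure,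
      ENNReal.ofReal_of_nonpos]
    linarith [Real.log_le_log hy hxy]
  · have hint : IntegrableOn (fun u : ℝ => 1 / u) (Icc x y) :=
      ContinuousOn.integrableOn_Icc (ContinuousOn.div (by fun_prop) (by fun_prop)
        fun u hu => by linarith [hu.1])
    rw [setLIntegral_congr Ico_ae_eq_Ioc,
      ← ofReal_integral_eq_lintegral_ofReal (hint.mono_set Ioc_subset_Icc_self),
      ← intervalIntegral.integral_of_le hxy.le, integral_one_div_of_pos hx (hx.trans hxy),
      Real.log_div (hx.trans hxy).ne' hx.ne']
    filter_upwards [ae_restrict_mem measurableSet_Ioc] with u hu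
    have : 0 < u := hx.trans hu.1
    positivity

/-- The constant in the error term of `lintegral_stable_le`. -/
def lossConst (a : ℝ) : ℝ :=
  2 * (∫ x, x ^ (a / 2) ∂expMeasure 1) * ∫ x, x ^ (-(1 / 2) : ℝ) ∂expMeasure 1

/-- The logarithmic moment of a stable law of index `1 / a`, up to an error that vanishes with
the scale `τ` of the offset. -/
lemma lintegral_stable_le {a τ : ℝ} (ha : 0 < a) (hτ : 0 < τ) :
    ∫⁻ s in Ioi (0 : ℝ),
      ENNReal.ofReal ((1 - Real.exp (-(s / τ) ^ (1 / a))) * Real.exp (-s) / s) ≤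
    ENNReal.ofReal ((1 - a) * meanLogExp - Real.log τ + τ ^ (1 / 2 : ℝ) * lossConst a) := by
  let ν := (expMeasure 1).prod (expMeasure 1)
  have hpos : ∀ᵐ p ∂ν, 0 < p.1 ∧ 0 < p.2 := by
    have h1 : ∀ᵐ p ∂ν, 0 < p.1 := Measure.quasiMeasurePreserving_fst.ae ae_expMeasure_pos
    have h2 : ∀ᵐ p ∂ν, 0 < p.2 := Measure.quasiMeasurePreserving_snd.ae ae_expMeasure_pos
    exact h1.and h2
  -- For independent exponential X and Y, the integrand is P(τ X^a ≤ s < Y)/s. Integrating over `s`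
  -- first leaves the mean of the positive part of log Y - log(τ X^a).
  let E : Set (ℝ × (ℝ × ℝ)) := {q | τ * q.2.1 ^ a ≤ q.1 ∧ q.1 < q.2.2}
  have hE : MeasurableSet E := by
    refine MeasurableSet.inter (s₁ := {q : ℝ × (ℝ × ℝ) | τ * q.2.1 ^ a ≤ q.1})
      (s₂ := {q : ℝ × (ℝ × ℝ) | q.1 < q.2.2}) ?_ ?_
    · exact measurableSet_le (by fun_prop) (by fun_prop)
    · exact measurableSet_lt (by fun_prop) (by fun_prop)
  let K : ℝ → ℝ × ℝ → ℝ≥0∞ := fun s p => E.indicator (fun q => ENNReal.ofReal (1 / q.1)) (s, p)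
  have hK : Measurable (Function.uncurry K) := Measurable.indicator (by fun_prop) hE
  have h1 : ∀ s ∈ Ioi (0 : ℝ),
      ENNReal.ofReal ((1 - Real.exp (-(s / τ) ^ (1 / a))) * Real.exp (-s) / s) =
      ∫⁻ p, K s p ∂ν := by
    intro s hs
    have hs : 0 < s := hs
    have hst : 0 ≤ (s / τ) ^ (1 / a) := by positivity
    have h2 : ∫⁻ p, K s p ∂ν = ∫⁻ p, (Iic ((s / τ) ^ (1 / a)) ×ˢ Ioi s).indicator
        (fun _ => ENNReal.ofReal (1 / s)) p ∂ν := by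
      refine lintegral_congr_ae ?_
      filter_upwards [hpos] with p hp
      have : (s, p) ∈ E ↔ p ∈ Iic ((s / τ) ^ (1 / a)) ×ˢ Ioi s := by
        simp only [E, mem_ofPred_eq, mem_prod, mem_Iic, mem_Ioi]
        rw [one_div, Real.le_rpow_inv_iff_of_pos hp.1.le (by positivity) ha,
          le_div_iff₀ hτ, mul_comm]
      by_cases hm : (s, p) ∈ E
      · simp only [K]
        rw [indicator_of_mem hm, indicator_of_mem (this.mp hm)]
      · simp only [K]
        rw [indicator_of_notMem hm, indicator_of_notMem (fun h => hm (this.mpr h))]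
    rw [h2, lintegral_indicator_const (measurableSet_Iic.prod measurableSet_Ioi),
      Measure.prod_prod, measure_expMeasure_lt hs.le, measure_expMeasure_le hst,
      ← ENNReal.ofReal_mul, ← ENNReal.ofReal_mul (by positivity)]
    · congr 1; ring
    · rw [sub_nonneg, Real.exp_le_one_iff]; linarith
  rw [setLIntegral_congr_fun measurableSet_Ioi h1, lintegral_lintegral_swap hK.aemeasurable]
  -- For z = log(Y/(τ X^a)), the positive part of z is at most z + 2 exp(-z/2), by log x ≤ 2√x at x
  -- = exp(-z). The correction has mean √τ times `lossConst a`.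
  let G : ℝ × ℝ → ℝ := fun p => Real.log p.2 - (Real.log τ + a * Real.log p.1) +
    2 * τ ^ (1 / 2 : ℝ) * (p.1 ^ (a / 2) * p.2 ^ (-(1 / 2) : ℝ))
  have h3 : ∀ᵐ p ∂ν, ∫⁻ s in Ioi (0 : ℝ), K s p ≤ ENNReal.ofReal (G p) ∧ 0 ≤ G p := by
    filter_upwards [hpos] with p hp
    have hx : 0 < τ * p.1 ^ a := mul_pos hτ (Real.rpow_pos_of_pos hp.1 a)
    have h4 : ∫⁻ s in Ioi (0 : ℝ), K s p ≤ ENNReal.ofReal (Real.log p.2 - Real.log (τ * p.1 ^ a)) := by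
      rw [← lintegral_inv_Ico hx hp.2, ← lintegral_indicator measurableSet_Ico]
      refine (lintegral_mono' Measure.restrict_le_self le_rfl).trans (lintegral_mono fun s => ?_)
      simp only [K, E, indicator_apply, mem_ofPred_eq, mem_Ico]
      exact le_rfl
    have h5 : Real.log (τ * p.1 ^ a) = Real.log τ + a * Real.log p.1 := by
      rw [Real.log_mul hτ.ne' (Real.rpow_pos_of_pos hp.1 a).ne', Real.log_rpow hp.1]
    have h6 := log_le_two_mul_sqrt (div_pos hx hp.2)
    rw [Real.log_div hx.ne' hp.2.ne', h5, Real.div_rpow hx.le hp.2.le,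
      Real.mul_rpow hτ.le (Real.rpow_nonneg hp.1.le a), ← Real.rpow_mul hp.1.le,
      div_eq_mul_inv _ (p.2 ^ _), ← Real.rpow_neg hp.2.le, mul_one_div] at h6
    have h7 : 0 ≤ 2 * τ ^ (1 / 2 : ℝ) * (p.1 ^ (a / 2) * p.2 ^ (-(1 / 2) : ℝ)) := by
      have := hp.1; have := hp.2; positivity
    refine ⟨h4.trans (ENNReal.ofReal_le_ofReal ?_), ?_⟩
    · rw [h5]; simp only [G]; linarith
    · simp only [G]; nlinarith
  have hl1 : Integrable (fun p : ℝ × ℝ => Real.log p.1) ν := integrable_log_expMeasure.comp_fst _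
  have hl2 : Integrable (fun p : ℝ × ℝ => Real.log p.2) ν := integrable_log_expMeasure.comp_snd _
  have hr : Integrable (fun p : ℝ × ℝ => p.1 ^ (a / 2) * p.2 ^ (-(1 / 2) : ℝ)) ν :=
    (integrable_rpow_expMeasure (by linarith)).mul_prod (integrable_rpow_expMeasure (by norm_num))
  have hc : Integrable (fun _ : ℝ × ℝ => Real.log τ) ν := integrable_const _
  have hG1 : Integrable (fun p : ℝ × ℝ => Real.log τ + a * Real.log p.1) ν :=
    hc.add (hl1.const_mul a)
  have hG2 : Integrable (fun p : ℝ × ℝ => Real.log p.2 - (Real.log τ + a * Real.log p.1)) ν :=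
    hl2.sub hG1
  have hG : Integrable G ν := hG2.add (hr.const_mul _)
  refine (lintegral_mono_ae (h3.mono fun p hp => hp.1)).trans ?_
  rw [← ofReal_integral_eq_lintegral_ofReal hG (h3.mono fun p hp => hp.2)]
  refine ENNReal.ofReal_le_ofReal (le_of_eq ?_)
  have e1 : ∫ p, Real.log p.1 ∂ν = meanLogExp := by
    have := integral_fun_fst (μ := expMeasure 1) (ν := expMeasure 1) Real.log
    simpa [ν, meanLogExp] using this
  have e2 : ∫ p, Real.log p.2 ∂ν = meanLogExp := by
    have := integral_fun_snd (μ := expMeasure 1) (ν := expMeasure 1) Real.log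
    simpa [ν, meanLogExp] using this
  have e3 : ∫ p, p.1 ^ (a / 2) * p.2 ^ (-(1 / 2) : ℝ) ∂ν =
      (∫ x, x ^ (a / 2) ∂expMeasure 1) * ∫ x, x ^ (-(1 / 2) : ℝ) ∂expMeasure 1 :=
    integral_prod_mul (fun x : ℝ => x ^ (a / 2)) (fun x : ℝ => x ^ (-(1 / 2) : ℝ))
  simp only [G]
  rw [integral_add hG2 (hr.const_mul _), integral_sub hl2 hG1, integral_add hc (hl1.const_mul a),
    integral_const_mul, integral_const_mul, e1, e2, e3, integral_const]
  simp only [probReal_univ, smul_eq_mul, one_mul, lossConst]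
  ring

lemma lossConst_nonneg (a : ℝ) : 0 ≤ lossConst a := by
  have h : ∀ q : ℝ, 0 ≤ ∫ x, x ^ q ∂expMeasure 1 := fun q =>
    integral_nonneg_of_ae (ae_expMeasure_pos.mono fun x hx => Real.rpow_nonneg (le_of_lt hx) q)
  unfold lossConst
  have := h (a / 2)
  have := h (-(1 / 2))
  positivity

lemma integrableOn_rho {a : ℝ} (ha : 1 < a) :
    IntegrableOn (fun u : ℝ => 1 / (1 + u ^ a)) (Ioi 0) := by
  rw [← Ioc_union_Ioi_eq_Ioi (zero_le_one' ℝ), integrableOn_union]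
  have hm : Measurable fun u : ℝ => 1 / (1 + u ^ a) := by fun_prop
  constructor
  · refine Measure.integrableOn_of_bounded (M := 1) (by simp) hm.aestronglyMeasurable ?_
    filter_upwards [ae_restrict_mem measurableSet_Ioc] with u hu
    have h0 : 0 ≤ u ^ a := Real.rpow_nonneg hu.1.le a
    rw [Real.norm_of_nonneg (by positivity), div_le_one (by positivity)]
    linarith
  · refine (integrableOn_Ioi_rpow_of_lt (a := -a) (by linarith) one_pos).mono'
      hm.aestronglyMeasurable ?_
    filter_upwards [ae_restrict_mem measurableSet_Ioi] with u hu
    have hu0 : 0 < u := one_pos.trans hu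
    have h0 : 0 < u ^ a := Real.rpow_pos_of_pos hu0 a
    rw [Real.norm_of_nonneg (by positivity), Real.rpow_neg hu0.le, one_div]
    exact inv_anti₀ h0 (by linarith)

lemma rho_pos {α : ℝ} (hα : 2 < α) : 0 < rho α := by
  have hi := integrableOn_rho (a := α / 2) (by linarith)
  unfold rho
  rw [setIntegral_pos_iff_support_of_nonneg_ae _ hi]
  · have : Ioo (0 : ℝ) 1 ⊆ Function.support (fun u : ℝ => 1 / (1 + u ^ (α / 2))) ∩ Ioi 0 := by
      intro u hu
      have h0 : 0 ≤ u ^ (α / 2) := Real.rpow_nonneg hu.1.le _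
      exact ⟨by simp only [Function.mem_support]; positivity, hu.1⟩
    refine lt_of_lt_of_le ?_ (measure_mono this)
    simp
  · filter_upwards [ae_restrict_mem measurableSet_Ioi] with u hu
    have h0 : 0 ≤ u ^ (α / 2) := Real.rpow_nonneg (le_of_lt hu) _
    simp only [Pi.zero_apply]
    positivity

/-- The substitution t = s^(2/α) u takes all dependence on `s` out of the integral. -/
lemma lintegral_rho {α s : ℝ} (hα : 2 < α) (hs : 0 < s) :
    ∫⁻ t in Ioi (0 : ℝ), ENNReal.ofReal (1 - 1 / (1 + s * t ^ (-(α / 2)))) =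
      ENNReal.ofReal (s ^ (2 / α) * rho α) := by
  have hc : 0 < s ^ (2 / α) := by positivity
  rw [← lintegral_Ioi_comp_mul hc, lintegral_const_mul _ (by fun_prop),
    ENNReal.ofReal_mul hc.le, rho, ofReal_integral_eq_lintegral_ofReal
      (integrableOn_rho (a := α / 2) (by linarith))]
  · congr 1
    refine setLIntegral_congr_fun measurableSet_Ioi fun u hu => ?_
    have hu : 0 < u := hu
    have h0 : 0 < u ^ (α / 2) := by positivity
    have h1 : s * (s ^ (2 / α) * u) ^ (-(α / 2)) = (u ^ (α / 2))⁻¹ := by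
      rw [Real.mul_rpow hc.le hu.le, ← Real.rpow_mul hs.le, Real.rpow_neg hu.le,
        show 2 / α * -(α / 2) = -1 by field_simp, Real.rpow_neg_one, ← mul_assoc,
        mul_inv_cancel₀ hs.ne', one_mul]
    simp only [h1]
    congr 1
    field_simp
    ring
  · filter_upwards [ae_restrict_mem measurableSet_Ioi] with u hu
    have h0 : 0 ≤ u ^ (α / 2) := Real.rpow_nonneg (le_of_lt hu) _
    simp only [Pi.zero_apply]
    positivity

/-- The exponent of the Laplace transform of the interference from a Poisson process of unit
density with Rayleigh fading. -/
lemma lintegral_one_sub_exp_power {α s : ℝ} (hα : 2 < α) (hs : 0 < s) :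
    ∫⁻ b : Plane × ℝ, ENNReal.ofReal (1 - Real.exp (-(s * (receivedPower α b).toReal)))
      ∂((volume : Measure Plane).prod (expMeasure 1)) =
      ENNReal.ofReal (s ^ (2 / α) * (Real.pi * rho α)) := by
  have hpi := Real.pi_pos
  have hm : Measurable fun b : Plane × ℝ => (receivedPower α b).toReal := by
    unfold receivedPower
    simp only [dist_zero_left]
    fun_prop
  rw [lintegral_prod _
    ((((hm.const_mul s).fun_neg.exp).const_sub 1).ennreal_ofReal).aemeasurable]
  -- Averaging over the fading turns 1 - exp(-cη) into 1 - 1/(1 + c). The result is written in t =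
  -- π‖x‖², so that the integral over the plane becomes one over the half-line.
  have h1 : ∀ x : Plane, ∫⁻ η, ENNReal.ofReal (1 - Real.exp (-(s *
      (receivedPower α (x, η)).toReal))) ∂expMeasure 1 =
      ENNReal.ofReal (1 - 1 / (1 + s * Real.pi ^ (α / 2) * (Real.pi * ‖x‖ ^ 2) ^ (-(α / 2)))) := by
    intro x
    set c := s * Real.pi ^ (α / 2) * (Real.pi * ‖x‖ ^ 2) ^ (-(α / 2)) with hc
    have hc0 : 0 ≤ c := by positivity
    have h2 : ∀ᵐ η ∂expMeasure 1, ENNReal.ofReal (1 - Real.exp (-(s *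
        (receivedPower α (x, η)).toReal))) = 1 - ENNReal.ofReal (Real.exp (-(c * η))) := by
      filter_upwards [ae_expMeasure_pos] with η hη
      rw [ENNReal.ofReal_sub _ (Real.exp_pos _).le, ENNReal.ofReal_one]
      congr 4
      unfold receivedPower
      simp only [dist_zero_left]
      rw [ENNReal.toReal_ofReal (by positivity), hc, Real.mul_rpow hpi.le (by positivity),
        ← Real.rpow_natCast, ← Real.rpow_mul (norm_nonneg _), Real.rpow_neg hpi.le]
      have : Real.pi ^ (α / 2) ≠ 0 := by positivity
      rw [show ((2 : ℕ) : ℝ) * -(α / 2) = -α by push_cast; ring]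
      field_simp
    have h3 : ∀ᵐ η ∂expMeasure 1, ENNReal.ofReal (Real.exp (-(c * η))) ≤ 1 := by
      filter_upwards [ae_expMeasure_pos] with η hη
      rw [ENNReal.ofReal_le_one, Real.exp_le_one_iff]
      have : 0 ≤ c * η := by positivity
      linarith
    rw [lintegral_congr_ae h2, lintegral_sub' (by fun_prop) _ h3, lintegral_exp_expMeasure hc0,
      lintegral_one, measure_univ, ENNReal.ofReal_sub _ (by positivity), ENNReal.ofReal_one]
    rw [lintegral_exp_expMeasure hc0]; exact ENNReal.ofReal_ne_top
  simp_rw [h1]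
  rw [lintegral_comp_norm_sq (f := fun t =>
    ENNReal.ofReal (1 - 1 / (1 + s * Real.pi ^ (α / 2) * t ^ (-(α / 2))))) (by fun_prop),
    lintegral_rho hα (by positivity), Real.mul_rpow hs.le (by positivity), ← Real.rpow_mul hpi.le,
    show α / 2 * (2 / α) = 1 by field_simp, Real.rpow_one]
  congr 1; ring

end RealIntegrals

/-! ### The depth and the fading power of the nearest station. -/

section Nearest

open Set

/-- The intensity measure of the stations with their fading powers. -/
abbrev stationMeasure (lm : ℝ) : Measure (Plane × ℝ) :=
  (ENNReal.ofReal lm • (volume : Measure Plane)).prod (expMeasure 1)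

lemma lintegral_stationMeasure {lm : ℝ} {f : Plane × ℝ → ℝ≥0∞} (hf : Measurable f) :
    ∫⁻ b, f b ∂stationMeasure lm =
      ∫⁻ x : Plane, ∫⁻ η, ENNReal.ofReal lm * f (x, η) ∂expMeasure 1 := by
  rw [lintegral_prod _ hf.aemeasurable, lintegral_smul_measure, smul_eq_mul, ← lintegral_const_mul]
  · congr 1
    funext x
    rw [lintegral_const_mul]
    fun_prop
  · exact hf.lintegral_prod_right'

lemma stationMeasure_prod_univ (lm : ℝ) (B : Set Plane) :
    stationMeasure lm (B ×ˢ univ) = ENNReal.ofReal lm * volume B := by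
  simp [stationMeasure, Measure.prod_prod]

/-- The mean number of stations that are closer to the origin than `b`. -/
def depth (lm : ℝ) (b : Plane × ℝ) : ℝ := lm * (Real.pi * ‖b.1‖ ^ 2)

@[fun_prop]
lemma measurable_depth (lm : ℝ) : Measurable (depth lm) := by
  unfold depth; fun_prop

/-- In the variables depth and fading power the intensity becomes Lebesgue measure on the half-line
times the exponential law, independently of `lm`. -/
lemma lintegral_depth {lm : ℝ} (hlm : 0 < lm) {u : ℝ × ℝ → ℝ≥0∞} (hu : Measurable u) :
    ∫⁻ b, u (depth lm b, b.2) ∂stationMeasure lm =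
      ∫⁻ t in Ioi (0 : ℝ), ∫⁻ η, u (t, η) ∂expMeasure 1 := by
  rw [lintegral_stationMeasure (by fun_prop)]
  have hm : Measurable fun t => ∫⁻ η, u (t, η) ∂expMeasure 1 := hu.lintegral_prod_right'
  have h1 := lintegral_comp_norm_sq (f := fun t => ENNReal.ofReal lm *
    ∫⁻ η, u (lm * t, η) ∂expMeasure 1) ((hm.comp (by fun_prop)).const_mul _)
  rw [lintegral_Ioi_comp_mul hlm (fun t => ∫⁻ η, u (t, η) ∂expMeasure 1)] at h1
  rw [← h1]
  congr 1
  funext x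
  rw [lintegral_const_mul _ (by fun_prop)]
  rfl

/-- The stations of depth in `[k δ, (k + 1) δ)`. -/
def depthRing (lm δ : ℝ) (k : ℕ) : Set (Plane × ℝ) :=
  {b | k * δ ≤ depth lm b ∧ depth lm b < (k + 1) * δ}

/-- The stations of depth less than `k δ`. -/
def depthBall (lm δ : ℝ) (k : ℕ) : Set (Plane × ℝ) := {b | depth lm b < k * δ}

lemma measurableSet_depthRing (lm δ : ℝ) (k : ℕ) : MeasurableSet (depthRing lm δ k) :=
  (measurableSet_le measurable_const (measurable_depth lm)).inter
    (measurableSet_lt (measurable_depth lm) measurable_const)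

lemma measurableSet_depthBall (lm δ : ℝ) (k : ℕ) : MeasurableSet (depthBall lm δ k) :=
  measurableSet_lt (measurable_depth lm) measurable_const

lemma setLIntegral_depthRing {lm δ : ℝ} (hlm : 0 < lm) (k : ℕ)
    {u : ℝ × ℝ → ℝ≥0∞} (hu : Measurable u) :
    ∫⁻ b in depthRing lm δ k, u (depth lm b, b.2) ∂stationMeasure lm =
      ∫⁻ t in Ioi (0 : ℝ), (Ico (k * δ) ((k + 1) * δ)).indicator
        (fun t => ∫⁻ η, u (t, η) ∂expMeasure 1) t := by
  have h := lintegral_depth hlm (u := fun p => (Ico (k * δ) ((k + 1) * δ)).indicator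
    (fun _ => u p) p.1) (by
      have : (fun p : ℝ × ℝ => (Ico (k * δ) ((k + 1) * δ)).indicator (fun _ => u p) p.1) =
          (Prod.fst ⁻¹' Ico (k * δ) ((k + 1) * δ)).indicator u := by
        funext p; rfl
      rw [this]
      exact hu.indicator (measurable_fst measurableSet_Ico))
  rw [← lintegral_indicator (measurableSet_depthRing _ _ _)]
  refine Eq.trans ?_ (h.trans ?_)
  · congr 1
  · congr 1
    funext t
    by_cases ht : t ∈ Ico (k * δ) ((k + 1) * δ) <;> simp [ht]

lemma stationMeasure_depthRing {lm δ : ℝ} (hlm : 0 < lm) (hδ : 0 < δ) (k : ℕ) :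
    stationMeasure lm (depthRing lm δ k) = ENNReal.ofReal δ := by
  have h := setLIntegral_depthRing (δ := δ) hlm k (u := fun _ => 1) measurable_const
  simp only [lintegral_const, measure_univ, mul_one, Measure.restrict_apply_univ, one_mul] at h
  rw [h, lintegral_indicator measurableSet_Ico, lintegral_const, one_mul,
    Measure.restrict_restrict measurableSet_Ico, Measure.restrict_apply_univ]
  have hk : 0 ≤ k * δ := by positivity
  refine le_antisymm ?_ ?_
  · refine (measure_mono inter_subset_left).trans ?_
    rw [Real.volume_Ico]
    exact ENNReal.ofReal_le_ofReal (by linarith)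
  · refine le_trans ?_ (measure_mono (s := Ioo (k * δ) ((k + 1) * δ)) fun t ht =>
      ⟨⟨ht.1.le, ht.2⟩, hk.trans_lt ht.1⟩)
    rw [Real.volume_Ioo]
    exact ENNReal.ofReal_le_ofReal (by linarith)

lemma stationMeasure_depthBall {lm : ℝ} (hlm : 0 < lm) (δ : ℝ) (k : ℕ) :
    stationMeasure lm (depthBall lm δ k) = ENNReal.ofReal (k * δ) := by
  have h := lintegral_depth hlm (u := (Prod.fst ⁻¹' Iio (k * δ)).indicator 1)
    (measurable_one.indicator (measurable_fst measurableSet_Iio))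
  have h2 : (fun b => (Prod.fst ⁻¹' Iio (k * δ)).indicator (1 : ℝ × ℝ → ℝ≥0∞) (depth lm b, b.2)) =
      (depthBall lm δ k).indicator 1 := by
    funext b; rfl
  have h3 : ∀ t : ℝ, ∫⁻ η, (Prod.fst ⁻¹' Iio (k * δ)).indicator (1 : ℝ × ℝ → ℝ≥0∞) (t, η)
      ∂expMeasure 1 = (Iio (k * δ)).indicator 1 t := by
    intro t
    by_cases ht : t < k * δ <;> simp [ht]
  simp_rw [h3] at h
  rw [h2, lintegral_indicator_one (measurableSet_depthBall _ _ _),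
    lintegral_indicator_one measurableSet_Iio, Measure.restrict_apply measurableSet_Iio,
    Iio_inter_Ioi, Real.volume_Ioo, sub_zero] at h
  exact h

variable {Ω : Type*} {Φ : Ω → Set (Plane × ℝ)}

lemma measurable_indicator_one {Ω : Type*} {m : MeasurableSpace Ω} {s : Set Ω}
    (hs : MeasurableSet s) : Measurable (s.indicator (1 : Ω → ℝ≥0∞)) :=
  measurable_one.indicator hs

/-- Up to depth `k δ` there is no station, and in the next ring there is a single one. -/
def NearestIn (lm δ : ℝ) (ξ : Set (Plane × ℝ)) (k : ℕ) : Prop :=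
  count ξ (depthBall lm δ k) = 0 ∧ count ξ (depthRing lm δ k) = 1

/-- The value of `u` at the depth and fading power of the nearest station, if this station is
alone in one of the first `K` rings, and `0` otherwise. -/
def nearestValue (lm δ : ℝ) (K : ℕ) (u : ℝ × ℝ → ℝ≥0∞) (ξ : Set (Plane × ℝ)) : ℝ≥0∞ :=
  ∑ k ∈ Finset.range K, {ξ | NearestIn lm δ ξ k}.indicator 1 ξ *
    pointSum ξ ((depthRing lm δ k).indicator fun b => u (depth lm b, b.2))

lemma NearestIn.le {lm δ : ℝ} (hδ : 0 < δ) {ξ : Set (Plane × ℝ)} {j k : ℕ}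
    (hj : NearestIn lm δ ξ j) (hk : NearestIn lm δ ξ k) : k ≤ j := by
  by_contra! hjk
  obtain ⟨b, hb⟩ := Set.encard_eq_one.mp hj.2
  have hb' : b ∈ ξ ∩ depthRing lm δ j := by rw [hb]; rfl
  have h0 : ξ ∩ depthBall lm δ k = ∅ := Set.encard_eq_zero.mp hk.1
  have : b ∈ ξ ∩ depthBall lm δ k := by
    refine ⟨hb'.1, hb'.2.2.trans_le ?_⟩
    have : (j : ℝ) + 1 ≤ k := by exact_mod_cast hjk
    gcongr
  rw [h0] at this
  exact this

lemma NearestIn.unique {lm δ : ℝ} (hδ : 0 < δ) {ξ : Set (Plane × ℝ)} {j k : ℕ}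
    (hj : NearestIn lm δ ξ j) (hk : NearestIn lm δ ξ k) : j = k :=
  le_antisymm (hk.le hδ hj) (hj.le hδ hk)

lemma nearestValue_of_not {lm δ : ℝ} {K : ℕ} {ξ : Set (Plane × ℝ)} (u : ℝ × ℝ → ℝ≥0∞)
    (h : ¬ ∃ k < K, NearestIn lm δ ξ k) : nearestValue lm δ K u ξ = 0 := by
  refine Finset.sum_eq_zero fun k hk => ?_
  rw [indicator_of_notMem, zero_mul]
  exact fun hn => h ⟨k, Finset.mem_range.mp hk, hn⟩

/-- The nearest station, and the value of functions at it. -/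
lemma NearestIn.exists_nearest {lm δ : ℝ} (hδ : 0 < δ) {K k : ℕ} (hk : k < K)
    {ξ : Set (Plane × ℝ)} (h : NearestIn lm δ ξ k) :
    ∃ b ∈ ξ, depth lm b < K * δ ∧ (∀ b' ∈ ξ, b' ≠ b → depth lm b < depth lm b') ∧
      ∀ u, nearestValue lm δ K u ξ = u (depth lm b, b.2) := by
  obtain ⟨b, hb⟩ := Set.encard_eq_one.mp h.2
  have hb' : b ∈ ξ ∩ depthRing lm δ k := by rw [hb]; rfl
  have h0 : ξ ∩ depthBall lm δ k = ∅ := Set.encard_eq_zero.mp h.1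
  refine ⟨b, hb'.1, hb'.2.2.trans_le ?_, ?_, ?_⟩
  · have : (k : ℝ) + 1 ≤ K := by exact_mod_cast hk
    gcongr
  · intro b' hb1 hne
    refine hb'.2.2.trans_le ?_
    by_contra hlt
    rw [not_le] at hlt
    have h1 : b' ∉ depthRing lm δ k := fun h2 => hne (by
      have : b' ∈ ξ ∩ depthRing lm δ k := ⟨hb1, h2⟩
      rw [hb] at this
      exact this)
    have h2 : b' ∈ ξ ∩ depthBall lm δ k := by
      refine ⟨hb1, ?_⟩
      by_contra h3
      exact h1 ⟨_root_.not_lt.mp h3, hlt⟩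
    rw [h0] at h2
    exact h2
  · intro u
    unfold nearestValue
    rw [Finset.sum_eq_single k]
    · rw [indicator_of_mem (show ξ ∈ {ξ | NearestIn lm δ ξ k} from h), Pi.one_apply, one_mul]
      unfold pointSum
      rw [tsum_subtype ξ, Set.indicator_indicator, hb, ← tsum_subtype,
        tsum_singleton b fun b => u (depth lm b, b.2)]
    · intro j _ hjk
      rw [indicator_of_notMem, zero_mul]
      exact fun hj => hjk (NearestIn.unique hδ hj h)
    · intro hn
      exact absurd (Finset.mem_range.mpr hk) hn

lemma measurableSet_nearestIn_sigmaOf (lm δ : ℝ) (k : ℕ) :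
    MeasurableSet[sigmaOf Φ] {ω | NearestIn lm δ (Φ ω) k} :=
  MeasurableSet.inter
    (measurable_count_sigmaOf (measurableSet_depthBall lm δ k)
      (MeasurableSet.of_discrete (s := {(0 : ℕ∞)})))
    (measurable_count_sigmaOf (measurableSet_depthRing lm δ k)
      (MeasurableSet.of_discrete (s := {(1 : ℕ∞)})))

lemma measurable_nearestValue (lm δ : ℝ) (K : ℕ) {u : ℝ × ℝ → ℝ≥0∞} (hu : Measurable u) :
    Measurable[sigmaOf Φ] fun ω => nearestValue lm δ K u (Φ ω) := by
  unfold nearestValue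
  refine Finset.measurable_sum _ fun k _ => Measurable.mul ?_ ?_
  · have h1 : (fun ω => {ξ | NearestIn lm δ ξ k}.indicator (1 : Set (Plane × ℝ) → ℝ≥0∞) (Φ ω)) =
        {ω | NearestIn lm δ (Φ ω) k}.indicator 1 := by
      funext ω; rfl
    rw [h1]
    exact measurable_indicator_one (measurableSet_nearestIn_sigmaOf lm δ k)
  · exact measurable_pointSum ((by fun_prop : Measurable fun b : Plane × ℝ =>
      u (depth lm b, b.2)).indicator (measurableSet_depthRing _ _ _))

variable [mΩ : MeasurableSpace Ω] {P : Measure Ω} {lm : ℝ} (hΦ : IsPoissonProcess P Φ (stationMeasure lm))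
include hΦ

/-- The rings express the nearest station through counts in fixed sets, so that Campbell's formula
for a single point applies. The factor in ring `k` joins the void probability exp(-kδ) to exp(-δ)
from the ring itself. -/
lemma lintegral_nearestValue_eq {δ : ℝ} (hlm : 0 < lm) (hδ : 0 < δ) (K : ℕ)
    {u : ℝ × ℝ → ℝ≥0∞} (hu : Measurable u) :
    ∫⁻ ω, nearestValue lm δ K u (Φ ω) ∂P = ∫⁻ t in Ioi (0 : ℝ), ∑ k ∈ Finset.range K,
      (Ico (k * δ) ((k + 1) * δ)).indicator (fun t => ENNReal.ofReal (Real.exp (-((k + 1) * δ))) *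
        ∫⁻ η, u (t, η) ∂expMeasure 1) t := by
  have hm : Measurable fun t => ∫⁻ η, u (t, η) ∂expMeasure 1 := hu.lintegral_prod_right'
  have hu' : Measurable fun b : Plane × ℝ => u (depth lm b, b.2) := by fun_prop
  unfold nearestValue
  rw [lintegral_finsetSum, lintegral_finsetSum]
  · refine Finset.sum_congr rfl fun k _ => ?_
    have h1 := hΦ.lintegral_void_single_mul_pointSum (measurableSet_depthBall lm δ k)
      (measurableSet_depthRing lm δ k)
      (Set.disjoint_left.mpr fun b hb hb' => absurd hb (not_lt.mpr hb'.1))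
      (by rw [stationMeasure_depthBall hlm δ]; exact ENNReal.ofReal_ne_top)
      (by rw [stationMeasure_depthRing hlm hδ]; exact ENNReal.ofReal_ne_top) hu'
    refine h1.trans ?_
    rw [setLIntegral_depthRing hlm k hu, stationMeasure_depthBall hlm δ,
      stationMeasure_depthRing hlm hδ, ENNReal.toReal_ofReal (by positivity),
      ENNReal.toReal_ofReal hδ.le, ← ENNReal.ofReal_mul (Real.exp_pos _).le, ← Real.exp_add,
      ← lintegral_const_mul _ (hm.indicator measurableSet_Ico)]
    congr 1
    funext t
    by_cases ht : t ∈ Ico (k * δ) ((k + 1) * δ)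
    · rw [indicator_of_mem ht, indicator_of_mem ht]
      congr 3; ring
    · rw [indicator_of_notMem ht, indicator_of_notMem ht, mul_zero]
  · exact fun k _ => (hm.const_mul _).indicator measurableSet_Ico
  · intro k _
    refine Measurable.mul ?_ ?_
    · exact (measurable_indicator_one (measurableSet_nearestIn_sigmaOf lm δ k)).mono
        hΦ.sigmaOf_le le_rfl
    · exact (measurable_pointSum (hu'.indicator (measurableSet_depthRing _ _ _))).mono
        hΦ.sigmaOf_le le_rfl

omit hΦ mΩ in
lemma sum_indicator_ring {δ : ℝ} (hδ : 0 < δ) (K : ℕ) (t : ℝ) (ht : 0 < t) (f : ℕ → ℝ≥0∞) :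
    ∑ k ∈ Finset.range K, (Ico (k * δ) ((k + 1) * δ)).indicator (fun _ => f k) t =
      if t < K * δ then f ⌊t / δ⌋₊ else 0 := by
  have hmem : ∀ k : ℕ, t ∈ Ico (k * δ) ((k + 1) * δ) ↔ ⌊t / δ⌋₊ = k := by
    intro k
    rw [Nat.floor_eq_iff (by positivity), le_div_iff₀ hδ, div_lt_iff₀ hδ, mem_Ico]
  have hK : t < K * δ ↔ ⌊t / δ⌋₊ < K := by
    rw [Nat.floor_lt (by positivity), div_lt_iff₀ hδ]
  simp only [indicator_apply, hmem, Finset.sum_ite_eq, Finset.mem_range, hK]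

/-- On ring `k` the weight exp(-(k + 1)δ) is at most exp(-t), the exact density of the nearest
depth. -/
lemma lintegral_nearestValue_le {δ : ℝ} (hlm : 0 < lm) (hδ : 0 < δ) (K : ℕ)
    {u : ℝ × ℝ → ℝ≥0∞} (hu : Measurable u) :
    ∫⁻ ω, nearestValue lm δ K u (Φ ω) ∂P ≤
      ∫⁻ p, u p ∂(expMeasure 1).prod (expMeasure 1) := by
  have hm : Measurable fun t => ∫⁻ η, u (t, η) ∂expMeasure 1 := hu.lintegral_prod_right'
  rw [lintegral_nearestValue_eq hΦ hlm hδ K hu, lintegral_prod _ hu.aemeasurable,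
    lintegral_expMeasure hm]
  refine setLIntegral_mono' measurableSet_Ioi fun t ht => ?_
  have ht : 0 < t := ht
  have h := sum_indicator_ring hδ K t ht (fun k => ENNReal.ofReal (Real.exp (-((k + 1) * δ))) *
        ∫⁻ η, u (t, η) ∂expMeasure 1)
  refine (le_of_eq (Eq.trans ?_ h)).trans ?_
  · refine Finset.sum_congr rfl fun k _ => ?_
    simp only [indicator_apply]
  split_ifs
  · gcongr
    have := Nat.lt_floor_add_one (t / δ)
    rw [div_lt_iff₀ hδ] at this
    exact this.le
  · exact zero_le

/-- On ring `k` one has t ≥ kδ, so the weight loses at most a factor exp(-δ) against exp(-t). -/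
lemma le_lintegral_nearestValue {δ : ℝ} (hlm : 0 < lm) (hδ : 0 < δ) (K : ℕ)
    {u : ℝ × ℝ → ℝ≥0∞} (hu : Measurable u) :
    ENNReal.ofReal (Real.exp (-δ)) * ∫⁻ p in {p | p.1 < K * δ}, u p
      ∂(expMeasure 1).prod (expMeasure 1) ≤ ∫⁻ ω, nearestValue lm δ K u (Φ ω) ∂P := by
  have hs : MeasurableSet {p : ℝ × ℝ | p.1 < K * δ} :=
    measurableSet_lt measurable_fst measurable_const
  have hm : Measurable fun t => ∫⁻ η, {p : ℝ × ℝ | p.1 < K * δ}.indicator u (t, η)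
    ∂expMeasure 1 := (hu.indicator hs).lintegral_prod_right'
  rw [lintegral_nearestValue_eq hΦ hlm hδ K hu, ← lintegral_indicator hs,
    lintegral_prod _ (hu.indicator hs).aemeasurable,
    lintegral_expMeasure hm, ← lintegral_const_mul _ (by fun_prop)]
  refine setLIntegral_mono' measurableSet_Ioi fun t ht => ?_
  have ht : 0 < t := ht
  have h := sum_indicator_ring hδ K t ht (fun k => ENNReal.ofReal (Real.exp (-((k + 1) * δ))) *
        ∫⁻ η, u (t, η) ∂expMeasure 1)
  refine le_trans ?_ (le_of_eq (Eq.trans h.symm ?_))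
  · split_ifs with htK
    · have h1 : ∀ η, {p : ℝ × ℝ | p.1 < K * δ}.indicator u (t, η) = u (t, η) :=
        fun η => indicator_of_mem (by exact htK) _
      simp_rw [h1]
      rw [← mul_assoc, ← ENNReal.ofReal_mul (Real.exp_pos _).le, ← Real.exp_add]
      gcongr
      have := Nat.floor_le (show 0 ≤ t / δ by positivity)
      rw [le_div_iff₀ hδ] at this
      linarith
    · have h1 : ∀ η, {p : ℝ × ℝ | p.1 < K * δ}.indicator u (t, η) = 0 :=
        fun η => indicator_of_notMem (by exact htK) _
      simp_rw [h1]
      simp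
  · refine Finset.sum_congr rfl fun k _ => ?_
    simp only [indicator_apply]

/-- Taking `u = 1` in the lower bound gives probability at least exp(-δ)(1 - exp(-Kδ)) for the
complement. -/
lemma measure_not_nearestIn_le [IsProbabilityMeasure P] {δ : ℝ} (hlm : 0 < lm) (hδ : 0 < δ)
    (K : ℕ) :
    P {ω | ¬ ∃ k < K, NearestIn lm δ (Φ ω) k} ≤
      ENNReal.ofReal (δ + Real.exp (-(K * δ))) := by
  have hms : MeasurableSet {ω | ∃ k < K, NearestIn lm δ (Φ ω) k} := by
    have : {ω | ∃ k < K, NearestIn lm δ (Φ ω) k} =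
        ⋃ k ∈ Finset.range K, {ω | NearestIn lm δ (Φ ω) k} := by
      ext ω; simp
    rw [this]
    exact Finset.measurableSet_biUnion _ fun k _ =>
      hΦ.sigmaOf_le _ (measurableSet_nearestIn_sigmaOf lm δ k)
  have h1 := le_lintegral_nearestValue hΦ hlm hδ K (u := 1) measurable_one
  have h2 : ∀ ω, nearestValue lm δ K 1 (Φ ω) =
      {ω | ∃ k < K, NearestIn lm δ (Φ ω) k}.indicator 1 ω := by
    intro ω
    by_cases h : ∃ k < K, NearestIn lm δ (Φ ω) k
    · rw [indicator_of_mem (by exact h)]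
      obtain ⟨k, hk, hn⟩ := h
      obtain ⟨b, _, _, _, hb⟩ := hn.exists_nearest hδ hk
      rw [hb]; rfl
    · rw [nearestValue_of_not _ h, indicator_of_notMem (by exact h)]
  simp_rw [h2] at h1
  rw [lintegral_indicator_one hms] at h1
  have h3 : {p : ℝ × ℝ | p.1 < K * δ} = Iio (K * δ) ×ˢ univ := by
    ext p; simp
  have hK : 0 ≤ K * δ := by positivity
  have h4 : ENNReal.ofReal (1 - Real.exp (-(K * δ))) ≤ ∫⁻ p in {p : ℝ × ℝ | p.1 < K * δ},
      (1 : ℝ × ℝ → ℝ≥0∞) p ∂(expMeasure 1).prod (expMeasure 1) := by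
    simp only [Pi.one_apply, lintegral_one, Measure.restrict_apply_univ]
    rw [h3, Measure.prod_prod, measure_univ, mul_one, ← measure_expMeasure_le hK,
      ← Iio_union_right, ]
    refine (measure_union_le _ _).trans ?_
    have h5 : expMeasure 1 {K * δ} = 0 := by
      have hac : expMeasure 1 ≪ volume := withDensity_absolutelyContinuous _ _
      exact hac (by simp)
    rw [h5, add_zero]
  have h5 : ENNReal.ofReal (Real.exp (-δ) * (1 - Real.exp (-(K * δ)))) ≤
      P {ω | ∃ k < K, NearestIn lm δ (Φ ω) k} := by
    rw [ENNReal.ofReal_mul (Real.exp_pos _).le]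
    exact (mul_le_mul_right h4 _).trans h1
  have h6 : {ω | ¬ ∃ k < K, NearestIn lm δ (Φ ω) k} =
      {ω | ∃ k < K, NearestIn lm δ (Φ ω) k}ᶜ := rfl
  rw [h6, measure_compl hms (measure_ne_top _ _), measure_univ]
  refine (tsub_le_tsub_left h5 1).trans ?_
  rw [← ENNReal.ofReal_one, ← ENNReal.ofReal_sub]
  · refine ENNReal.ofReal_le_ofReal ?_
    have e1 := Real.add_one_le_exp (-δ)
    have e2 : Real.exp (-δ) ≤ 1 := by rw [Real.exp_le_one_iff]; linarith
    have e3 := Real.exp_pos (-(K * δ))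
    nlinarith
  · have : Real.exp (-(K * δ)) ≤ 1 := by rw [Real.exp_le_one_iff]; linarith
    have := Real.exp_pos (-δ)
    nlinarith

end Nearest

/-! ### Square grids that reduce geometric conditions to finitely many cells. -/

section Grid

open Set

/-- The points of the square grid of mesh `r`. -/
def gridPoint (r : ℝ) (i : ℤ × ℤ) : Plane := !₂[i.1 * r, i.2 * r]

/-- The cells of the square grid of mesh `r`. -/
def gridCell (r : ℝ) (i : ℤ × ℤ) : Set Plane := {y | ⌊y 0 / r⌋ = i.1 ∧ ⌊y 1 / r⌋ = i.2}

/-- The indices of the cells of the square grid of mesh `r` that may meet the disc of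
radius `A`. -/
def gridIndex (r A : ℝ) : Finset (ℤ × ℤ) :=
  Finset.Icc (-(⌈A / r⌉ + 1)) (⌈A / r⌉ + 1) ×ˢ Finset.Icc (-(⌈A / r⌉ + 1)) (⌈A / r⌉ + 1)

lemma measurableSet_gridCell (r : ℝ) (i : ℤ × ℤ) : MeasurableSet (gridCell r i) := by
  refine MeasurableSet.inter (s₁ := {y : Plane | ⌊y 0 / r⌋ = i.1})
    (s₂ := {y : Plane | ⌊y 1 / r⌋ = i.2}) ?_ ?_
  · exact (Int.measurable_floor.comp (by fun_prop : Measurable fun y : Plane => y 0 / r))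
      (measurableSet_singleton i.1)
  · exact (Int.measurable_floor.comp (by fun_prop : Measurable fun y : Plane => y 1 / r))
      (measurableSet_singleton i.2)

lemma pairwise_disjoint_gridCell (r : ℝ) :
    Pairwise fun i j => Disjoint (gridCell r i) (gridCell r j) := by
  intro i j hij
  refine Set.disjoint_left.mpr fun y hi hj => hij ?_
  exact Prod.ext (hi.1.symm.trans hj.1) (hi.2.symm.trans hj.2)

lemma dist_gridPoint_le {r : ℝ} (hr : 0 < r) {i : ℤ × ℤ} {y : Plane} (hy : y ∈ gridCell r i) :
    dist y (gridPoint r i) ≤ 2 * r := by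
  have key : ∀ (a : ℝ) (n : ℤ), ⌊a / r⌋ = n → (a - n * r) ^ 2 ≤ r ^ 2 := by
    intro a n h
    have h1 := Int.floor_le (a / r)
    have h2 := Int.lt_floor_add_one (a / r)
    rw [h] at h1 h2
    rw [le_div_iff₀ hr] at h1
    rw [div_lt_iff₀ hr] at h2
    exact pow_le_pow_left₀ (by linarith) (by linarith) 2
  rw [EuclideanSpace.dist_eq, Real.sqrt_le_left (by positivity), Fin.sum_univ_two]
  have h0 := key _ _ hy.1
  have h1 := key _ _ hy.2
  simp only [Real.dist_eq, sq_abs, gridPoint, PiLp.toLp_apply, Matrix.cons_val_zero,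
    Matrix.cons_val_one]
  nlinarith

lemma exists_mem_gridCell {r A : ℝ} (hr : 0 < r) {y : Plane} (hy : ‖y‖ ≤ A) :
    ∃ i ∈ gridIndex r A, y ∈ gridCell r i := by
  refine ⟨(⌊y 0 / r⌋, ⌊y 1 / r⌋), ?_, rfl, rfl⟩
  have key : ∀ j, ⌊y j / r⌋ ∈ Finset.Icc (-(⌈A / r⌉ + 1)) (⌈A / r⌉ + 1) := by
    intro j
    have h1 : |y j| ≤ A := (PiLp.norm_apply_le y j).trans hy
    rw [abs_le] at h1
    have h2 : y j / r ≤ A / r := by gcongr; exact h1.2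
    have h3 : -(A / r) ≤ y j / r := by rw [← neg_div]; gcongr; exact h1.1
    have h4 := Int.le_ceil (A / r)
    rw [Finset.mem_Icc]
    constructor
    · rw [Int.le_floor]; push_cast; linarith
    · have := Int.floor_le (y j / r)
      have h5 : ((⌊y j / r⌋ : ℤ) : ℝ) ≤ ((⌈A / r⌉ + 1 : ℤ) : ℝ) := by push_cast; linarith
      exact_mod_cast h5
  exact Finset.mem_product.mpr ⟨key 0, key 1⟩

lemma card_gridIndex_le {r A : ℝ} (hr : 0 < r) (hA : 0 ≤ A) :
    ((gridIndex r A).card : ℝ) ≤ (2 * A / r + 5) ^ 2 := by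
  have h0 : 0 ≤ A / r := by positivity
  have h1 : 0 ≤ ⌈A / r⌉ := Int.ceil_nonneg h0
  have h2 := Int.ceil_lt_add_one (A / r)
  have h3 : (((Finset.Icc (-(⌈A / r⌉ + 1)) (⌈A / r⌉ + 1)).card : ℕ) : ℝ) ≤ 2 * A / r + 5 := by
    rw [Int.card_Icc]
    have h4 : (((⌈A / r⌉ + 1 + 1 - -(⌈A / r⌉ + 1)).toNat : ℤ) : ℝ) =
        ((⌈A / r⌉ + 1 + 1 - -(⌈A / r⌉ + 1) : ℤ) : ℝ) := by
      rw [Int.toNat_of_nonneg (by omega)]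
    have h5 : (((⌈A / r⌉ + 1 + 1 - -(⌈A / r⌉ + 1)).toNat : ℕ) : ℝ) =
        ((⌈A / r⌉ + 1 + 1 - -(⌈A / r⌉ + 1) : ℤ) : ℝ) := by rw [← h4]; norm_cast
    rw [h5]
    push_cast
    rw [mul_div_assoc]
    linarith
  rw [gridIndex, Finset.card_product, Nat.cast_mul, sq]
  gcongr

lemma volume_gridCell_le {r : ℝ} (hr : 0 < r) (i : ℤ × ℤ) :
    volume (gridCell r i) ≤ ENNReal.ofReal (4 * Real.pi * r ^ 2) := by
  refine (measure_mono (t := Metric.closedBall (gridPoint r i) (2 * r))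
    fun y hy => dist_gridPoint_le hr hy).trans (le_of_eq ?_)
  rw [EuclideanSpace.volume_closedBall_fin_two, ← ENNReal.ofReal_pow (by positivity),
    ← ENNReal.ofReal_mul (by positivity)]
  congr 1; ring

end Grid

/-! ### The mean over stations of the power beamed at the origin, for users in a grid cell. -/

section Interference

open Set

variable {Ω : Type*} {Φ : Ω → Set (Plane × ℝ)}

/-- The stations at distance in `[k h, (k + 1) h)` from `z`. -/
def annulus (z : Plane) (h : ℝ) (k : ℕ) : Set (Plane × ℝ) :=
  {b | k * h ≤ dist b.1 z ∧ dist b.1 z < (k + 1) * h}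

/-- The stations whose main lobe may cover the origin when it is directed at a point near `z`. -/
def lobeSet (θ h : ℝ) (z : Plane) : Set (Plane × ℝ) :=
  {b | z - b.1 ∈ Metric.cthickening h (lobe θ (-b.1))}

/-- The sum of `g` over the stations that may serve a user near `z` with a main lobe that covers
the origin. -/
def cellSum (θ h : ℝ) (N : ℕ) (z : Plane) (g : Plane × ℝ → ℝ≥0∞) (ξ : Set (Plane × ℝ)) : ℝ≥0∞ :=
  ∑ k ∈ Finset.range N,
    {ξ | count ξ (Metric.ball z ((k - 2) * h) ×ˢ univ) = 0}.indicator 1 ξ *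
      pointSum ξ ((annulus z h k).indicator ((lobeSet θ h z).indicator g))

lemma measurableSet_annulus (z : Plane) (h : ℝ) (k : ℕ) : MeasurableSet (annulus z h k) :=
  (by fun_prop : Measurable fun b : Plane × ℝ => dist b.1 z)
    (measurableSet_Ico (a := k * h) (b := (k + 1) * h))

lemma measurableSet_lobeSet (θ : ℝ) {h : ℝ} (hh : 0 ≤ h) (z : Plane) :
    MeasurableSet (lobeSet θ h z) :=
  (by fun_prop : Measurable fun b : Plane × ℝ => (z - b.1, -b.1))
    (measurableSet_cthickening_lobe θ hh)

lemma measurable_cellSum (θ : ℝ) {h : ℝ} (hh : 0 ≤ h) (N : ℕ) (z : Plane)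
    {g : Plane × ℝ → ℝ≥0∞} (hg : Measurable g) :
    Measurable[sigmaOf Φ] fun ω => cellSum θ h N z g (Φ ω) := by
  refine Finset.measurable_sum _ fun k _ => Measurable.mul ?_ ?_
  · exact measurable_indicator_one (s := {ω | count (Φ ω) (Metric.ball z ((k - 2) * h) ×ˢ univ) = 0})
      (measurable_count_sigmaOf (Metric.isOpen_ball.measurableSet.prod MeasurableSet.univ)
        (MeasurableSet.of_discrete (s := {(0 : ℕ∞)})))
  · exact measurable_pointSum ((hg.indicator (measurableSet_lobeSet θ hh z)).indicator
      (measurableSet_annulus z h k))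

lemma stationMeasure_annulus_ne_top (lm : ℝ) (z : Plane) (h : ℝ) (k : ℕ) :
    stationMeasure lm (annulus z h k) ≠ ∞ := by
  refine ne_top_of_le_ne_top ?_ (measure_mono (t := Metric.ball z ((k + 1) * h) ×ˢ univ)
    fun b hb => ⟨hb.2, mem_univ _⟩)
  rw [stationMeasure_prod_univ]
  exact ENNReal.mul_ne_top ENNReal.ofReal_ne_top measure_ball_lt_top.ne

variable [mΩ : MeasurableSpace Ω] {P : Measure Ω}

/-- Campbell's formula applies because the void ball and the annulus are disjoint. On annulus `k`
the distance to `z` is less than (k + 1)h, so the void radius (k - 2)h exceeds this distance minus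
3h. -/
lemma lintegral_cellSum_le {lm : ℝ} (hΦ : IsPoissonProcess P Φ (stationMeasure lm)) (hlm : 0 < lm)
    (θ : ℝ) {h : ℝ} (hh : 0 < h) (N : ℕ) (z : Plane) {g : Plane × ℝ → ℝ≥0∞} (hg : Measurable g) :
    ∫⁻ ω, cellSum θ h N z g (Φ ω) ∂P ≤ ∫⁻ b, (lobeSet θ h z).indicator (fun b =>
      ENNReal.ofReal (Real.exp (-(lm * (Real.pi * (max (dist b.1 z - 3 * h) 0) ^ 2)))) * g b) b
      ∂stationMeasure lm := by
  have hgl := hg.indicator (measurableSet_lobeSet θ hh.le z)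
  unfold cellSum
  rw [lintegral_finsetSum]
  · have h1 : ∀ k ∈ Finset.range N, ∫⁻ ω,
        {ξ | count ξ (Metric.ball z ((k - 2) * h) ×ˢ univ) = 0}.indicator 1 (Φ ω) *
        pointSum (Φ ω) ((annulus z h k).indicator ((lobeSet θ h z).indicator g)) ∂P ≤
        ∫⁻ b in annulus z h k, (lobeSet θ h z).indicator (fun b =>
          ENNReal.ofReal (Real.exp (-(lm * (Real.pi * (max (dist b.1 z - 3 * h) 0) ^ 2)))) * g b) b
          ∂stationMeasure lm := by
      intro k _
      have hfin : stationMeasure lm (Metric.ball z ((k - 2) * h) ×ˢ univ) ≠ ∞ := by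
        rw [stationMeasure_prod_univ]
        exact ENNReal.mul_ne_top ENNReal.ofReal_ne_top measure_ball_lt_top.ne
      have h2 := hΦ.lintegral_void_mul_pointSum
        (Metric.isOpen_ball.measurableSet.prod MeasurableSet.univ)
        (measurableSet_annulus z h k)
        (Set.disjoint_left.mpr fun b hb hb' => by
          have e1 : dist b.1 z < (k - 2) * h := hb.1
          have e2 := hb'.1
          linarith) hfin
        (stationMeasure_annulus_ne_top lm z h k) hgl
      refine (le_of_eq h2).trans ?_
      rw [← lintegral_const_mul _ hgl]
      refine setLIntegral_mono' (measurableSet_annulus z h k) fun b hb => ?_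
      by_cases hbl : b ∈ lobeSet θ h z
      · rw [indicator_of_mem hbl, indicator_of_mem hbl]
        gcongr
        rw [stationMeasure_prod_univ, EuclideanSpace.volume_ball_fin_two, ENNReal.toReal_mul,
          ENNReal.toReal_ofReal hlm.le, ENNReal.toReal_mul, ENNReal.toReal_pow,
          ENNReal.toReal_ofReal', ENNReal.toReal_ofReal Real.pi_pos.le, mul_comm _ Real.pi]
        gcongr
        have := hb.2
        linarith
      · rw [indicator_of_notMem hbl, indicator_of_notMem hbl, mul_zero]
    refine (Finset.sum_le_sum h1).trans ?_
    rw [← lintegral_biUnion_finset]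
    · exact setLIntegral_le_lintegral _ _
    · intro i _ j _ hij
      refine Set.disjoint_left.mpr fun b hi hj => hij ?_
      have h3 : (i : ℝ) < j + 1 := by
        have := hi.1.trans_lt hj.2
        exact lt_of_mul_lt_mul_right this hh.le
      have h4 : (j : ℝ) < i + 1 := by
        have := hj.1.trans_lt hi.2
        exact lt_of_mul_lt_mul_right this hh.le
      have h5 : i < j + 1 := by exact_mod_cast h3
      have h6 : j < i + 1 := by exact_mod_cast h4
      omega
    · exact fun k _ => measurableSet_annulus z h k
  · intro k _
    refine Measurable.mul ?_ ?_
    · exact (measurable_indicator_one (s := {ω | count (Φ ω) (Metric.ball z ((k - 2) * h) ×ˢ univ) = 0})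
        (measurable_count_sigmaOf (Metric.isOpen_ball.measurableSet.prod MeasurableSet.univ)
          (MeasurableSet.of_discrete (s := {(0 : ℕ∞)})))).mono hΦ.sigmaOf_le le_rfl
    · exact (measurable_pointSum (hgl.indicator (measurableSet_annulus z h k))).mono
        hΦ.sigmaOf_le le_rfl

/-- The mean of the sum over all cells. -/
lemma sum_lintegral_cellSum_le {lm : ℝ} (hΦ : IsPoissonProcess P Φ (stationMeasure lm))
    (hlm : 0 < lm) (θ : ℝ) {h : ℝ} (hh : 0 < h) (N : ℕ) (I : Finset (ℤ × ℤ))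
    {g : Plane × ℝ → ℝ≥0∞} (hg : Measurable g) {C : ℝ≥0∞}
    (hC : ∀ e : Plane, e ≠ 0 → lobeMass lm θ h e ≤ C) :
    ∑ i ∈ I, volume (gridCell (h / 2) i) *
      ∫⁻ ω, cellSum θ h N (gridPoint (h / 2) i) g (Φ ω) ∂P ≤
      C * ∫⁻ b, g b ∂(volume : Measure Plane).prod (expMeasure 1) := by
  -- Replacing the grid point by an arbitrary user position `y` of the cell moves it by at most `h`:
  -- the thickening grows from h to 2h and the loss of radius from 3h to 4h.
  let w : Plane × (Plane × ℝ) → ℝ≥0∞ := fun q =>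
    {q : Plane × (Plane × ℝ) | q.1 - q.2.1 ∈ Metric.cthickening (2 * h) (lobe θ (-q.2.1))}.indicator
      (fun q => ENNReal.ofReal
        (Real.exp (-(lm * (Real.pi * (max (‖q.1 - q.2.1‖ - 4 * h) 0) ^ 2)))) * g q.2) q
  have hw : Measurable w := Measurable.indicator (by fun_prop)
    ((by fun_prop : Measurable fun q : Plane × (Plane × ℝ) => (q.1 - q.2.1, -q.2.1))
      (measurableSet_cthickening_lobe θ (by positivity)))
  have h1 : ∀ i ∈ I, volume (gridCell (h / 2) i) *
      ∫⁻ ω, cellSum θ h N (gridPoint (h / 2) i) g (Φ ω) ∂P ≤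
      ∫⁻ y in gridCell (h / 2) i, ∫⁻ b, w (y, b) ∂stationMeasure lm := by
    intro i _
    rw [mul_comm, ← setLIntegral_const]
    refine setLIntegral_mono' (measurableSet_gridCell _ i) fun y hy => ?_
    refine (lintegral_cellSum_le hΦ hlm θ hh N _ hg).trans (lintegral_mono fun b => ?_)
    have hd := dist_gridPoint_le (by positivity) hy
    rw [show 2 * (h / 2) = h by ring] at hd
    by_cases hb : b ∈ lobeSet θ h (gridPoint (h / 2) i)
    · have hb' : y - b.1 ∈ Metric.cthickening (2 * h) (lobe θ (-b.1)) := by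
        have hb1 : gridPoint (h / 2) i - b.1 ∈ Metric.cthickening h (lobe θ (-b.1)) := hb
        have := Metric.mem_cthickening_of_dist_le (y - b.1) (gridPoint (h / 2) i - b.1) h _ hb1
          (by rwa [dist_sub_right])
        have h2 := Metric.cthickening_cthickening_subset hh.le hh.le (lobe θ (-b.1)) this
        rwa [← two_mul] at h2
      simp only [w]
      rw [indicator_of_mem hb, indicator_of_mem (by exact hb')]
      have htri := dist_triangle y (gridPoint (h / 2) i) b.1
      rw [dist_comm (gridPoint (h / 2) i), dist_eq_norm y b.1] at htri
      have hmax : max (‖y - b.1‖ - 4 * h) 0 ≤ max (dist b.1 (gridPoint (h / 2) i) - 3 * h) 0 :=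
        max_le_max (by linarith) le_rfl
      refine mul_le_mul_left (ENNReal.ofReal_le_ofReal (Real.exp_le_exp.mpr (neg_le_neg ?_))) _
      gcongr
    · rw [indicator_of_notMem hb]
      exact zero_le
  refine (Finset.sum_le_sum h1).trans ?_
  rw [← lintegral_biUnion_finset (fun i _ j _ hij => pairwise_disjoint_gridCell _ hij)
    (fun i _ => measurableSet_gridCell _ i)]
  refine (setLIntegral_le_lintegral _ _).trans ?_
  -- Integrating over the user first, with the station fixed, is what makes the lobe mass appear as
  -- a factor independent of the station.
  rw [lintegral_lintegral_swap hw.aemeasurable]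
  have hinner : ∀ b : Plane × ℝ, ∫⁻ y, w (y, b) =
      (∫⁻ v in Metric.cthickening (2 * h) (lobe θ (-b.1)),
        ENNReal.ofReal (Real.exp (-(lm * (Real.pi * (max (‖v‖ - 4 * h) 0) ^ 2))))) * g b := by
    intro b
    rw [← lintegral_mul_const _ (by fun_prop),
      ← lintegral_indicator Metric.isClosed_cthickening.measurableSet]
    exact lintegral_sub_right_eq_self (fun v => (Metric.cthickening (2 * h)
      (lobe θ (-b.1))).indicator (fun a => ENNReal.ofReal
        (Real.exp (-(lm * (Real.pi * max (‖a‖ - 4 * h) 0 ^ 2)))) * g b) v) b.1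
  simp_rw [hinner]
  have hwm : Measurable fun b => (∫⁻ v in Metric.cthickening (2 * h) (lobe θ (-b.1)),
      ENNReal.ofReal (Real.exp (-(lm * (Real.pi * (max (‖v‖ - 4 * h) 0) ^ 2))))) * g b := by
    simp_rw [← hinner]
    exact hw.lintegral_prod_left'
  rw [lintegral_stationMeasure hwm, lintegral_prod _ hg.aemeasurable, ← lintegral_const_mul _ hg.lintegral_prod_right']
  -- A station at the origin has no direction towards it; such stations form a null set.
  have h0 : ∀ᵐ x : Plane, x ≠ 0 := by
    rw [ae_iff]; simp
  refine lintegral_mono_ae ?_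
  filter_upwards [h0] with x hx
  rw [← lintegral_const_mul _ (by fun_prop)]
  refine lintegral_mono fun η => ?_
  simp only
  rw [← mul_assoc, ← lintegral_const_mul _ (by fun_prop)]
  refine mul_le_mul_left (le_trans (le_of_eq ?_) (hC (-x) (neg_ne_zero.mpr hx))) _
  unfold lobeMass
  congr 1
  funext v
  rw [ENNReal.ofReal_mul hlm.le]

end Interference

/-! ### Subadditivity of Laplace deficits and Jensen's inequality. -/

section Laplace

open Set

/-- The deficit of the Laplace transform, a bounded concave function. -/
def lapl (s : ℝ) (x : ℝ≥0∞) : ℝ≥0∞ := ENNReal.ofReal (1 - Real.exp (-(s * x.toReal)))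

@[fun_prop]
lemma measurable_lapl (s : ℝ) : Measurable (lapl s) := by
  unfold lapl; fun_prop

lemma lapl_zero (s : ℝ) : lapl s 0 = 0 := by simp [lapl]

/-- Since `toReal` sends ⊤ to 0, the deficit vanishes at infinity. Subadditivity survives this
convention but monotonicity does not, so finiteness is needed wherever powers are compared. -/
lemma lapl_top (s : ℝ) : lapl s ⊤ = 0 := by simp [lapl]

/-- For a, b in [0, 1] one has 1 - ab ≤ (1 - a) + (1 - b). -/
lemma lapl_add_le {s : ℝ} (hs : 0 ≤ s) (x y : ℝ≥0∞) : lapl s (x + y) ≤ lapl s x + lapl s y := by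
  by_cases hx : x = ⊤
  · simp [hx, lapl_top]
  by_cases hy : y = ⊤
  · simp [hy, lapl_top]
  unfold lapl
  have e : ∀ z : ℝ≥0∞, 0 < Real.exp (-(s * z.toReal)) ∧ Real.exp (-(s * z.toReal)) ≤ 1 :=
    fun z => ⟨Real.exp_pos _, by
      rw [Real.exp_le_one_iff, neg_nonpos]; exact mul_nonneg hs ENNReal.toReal_nonneg⟩
  rw [← ENNReal.ofReal_add (by linarith [(e x).2]) (by linarith [(e y).2]),
    ENNReal.toReal_add hx hy, mul_add, neg_add, Real.exp_add]
  refine ENNReal.ofReal_le_ofReal ?_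
  nlinarith [(e x).1, (e x).2, (e y).1, (e y).2]

lemma lapl_sum_le {s : ℝ} (hs : 0 ≤ s) {ι : Type*} (t : Finset ι) (f : ι → ℝ≥0∞) :
    lapl s (∑ i ∈ t, f i) ≤ ∑ i ∈ t, lapl s (f i) := by
  classical
  induction t using Finset.induction_on with
  | empty => simp [lapl_zero]
  | insert a t ha ih =>
    rw [Finset.sum_insert ha, Finset.sum_insert ha]
    exact (lapl_add_le hs _ _).trans (add_le_add le_rfl ih)

lemma lapl_tsum_le {s : ℝ} (hs : 0 ≤ s) {ι : Type*} (f : ι → ℝ≥0∞) :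
    lapl s (∑' i, f i) ≤ ∑' i, lapl s (f i) := by
  by_cases htop : ∑' i, f i = ⊤
  · simp [htop, lapl_top]
  have h1 : Filter.Tendsto (fun t : Finset ι => lapl s (∑ i ∈ t, f i)) Filter.atTop
      (nhds (lapl s (∑' i, f i))) := by
    unfold lapl
    refine ENNReal.tendsto_ofReal (Filter.Tendsto.const_sub _ ?_)
    refine (Real.continuous_exp.tendsto _).comp (Filter.Tendsto.neg (Filter.Tendsto.const_mul _ ?_))
    exact (ENNReal.tendsto_toReal htop).comp ENNReal.summable.hasSum
  exact le_of_tendsto' h1 fun t => (lapl_sum_le hs t f).trans (ENNReal.sum_le_tsum t)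

lemma lapl_cellSum_le {s : ℝ} (hs : 0 ≤ s) (θ h : ℝ) (N : ℕ) (z : Plane)
    (g : Plane × ℝ → ℝ≥0∞) (ξ : Set (Plane × ℝ)) :
    lapl s (cellSum θ h N z g ξ) ≤ cellSum θ h N z (fun b => lapl s (g b)) ξ := by
  unfold cellSum
  refine (lapl_sum_le hs _ _).trans (Finset.sum_le_sum fun k _ => ?_)
  by_cases hv : ξ ∈ {ξ | count ξ (Metric.ball z ((k - 2) * h) ×ˢ univ) = 0}
  · rw [indicator_of_mem hv, Pi.one_apply, one_mul, one_mul]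
    refine (lapl_tsum_le hs _).trans (ENNReal.tsum_le_tsum fun b => le_of_eq ?_)
    by_cases h1 : (b : Plane × ℝ) ∈ annulus z h k
    · by_cases h2 : (b : Plane × ℝ) ∈ lobeSet θ h z <;> simp [h1, h2, lapl_zero]
    · simp [h1, lapl_zero]
  · rw [indicator_of_notMem hv, zero_mul, zero_mul, lapl_zero]

variable {Ω : Type*} [mΩ : MeasurableSpace Ω] {P : Measure Ω} [IsProbabilityMeasure P]

/-- Jensen's inequality for exp(-y), with the tangent at `c` so that an upper bound for the mean
suffices. -/
lemma le_lintegral_exp_neg {Y : Ω → ℝ} (hY : Measurable Y) (h0 : ∀ ω, 0 ≤ Y ω) {c : ℝ}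
    (hc : 0 ≤ c) (h : ∫⁻ ω, ENNReal.ofReal (Y ω) ∂P ≤ ENNReal.ofReal c) :
    ENNReal.ofReal (Real.exp (-c)) ≤ ∫⁻ ω, ENNReal.ofReal (Real.exp (-Y ω)) ∂P := by
  have hint : Integrable Y P := by
    refine ⟨hY.aestronglyMeasurable, ?_⟩
    rw [hasFiniteIntegral_iff_ofReal (Filter.Eventually.of_forall h0)]
    exact h.trans_lt ENNReal.ofReal_lt_top
  have hle : ∫ ω, Y ω ∂P ≤ c := by
    rw [integral_eq_lintegral_of_nonneg_ae (Filter.Eventually.of_forall h0) hY.aestronglyMeasurable]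
    exact ENNReal.toReal_le_of_le_ofReal hc h
  have hexp : Integrable (fun ω => Real.exp (-Y ω)) P := by
    refine Integrable.of_bound (by fun_prop) 1 (Filter.Eventually.of_forall fun ω => ?_)
    rw [Real.norm_of_nonneg (Real.exp_pos _).le, Real.exp_le_one_iff]
    linarith [h0 ω]
  rw [← ofReal_integral_eq_lintegral_ofReal hexp
    (Filter.Eventually.of_forall fun ω => (Real.exp_pos _).le)]
  refine ENNReal.ofReal_le_ofReal ?_
  have h1 : ∫ ω, (Real.exp (-c) * (1 + c) - Real.exp (-c) * Y ω) ∂P ≤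
      ∫ ω, Real.exp (-Y ω) ∂P := by
    refine integral_mono ((integrable_const _).sub (hint.const_mul _)) hexp fun ω => ?_
    have h2 := Real.add_one_le_exp (c - Y ω)
    have h3 : Real.exp (-Y ω) = Real.exp (-c) * Real.exp (c - Y ω) := by
      rw [← Real.exp_add]; congr 1; ring
    simp only [h3]
    nlinarith [Real.exp_pos (-c)]
  have h4 : ∫ ω, Real.exp (-c) * Y ω ∂P = Real.exp (-c) * ∫ ω, Y ω ∂P := integral_const_mul _ _
  rw [integral_sub (integrable_const _) (hint.const_mul _), h4, integral_const] at h1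
  simp only [probReal_univ, smul_eq_mul, one_mul] at h1
  nlinarith [Real.exp_pos (-c)]

/-- A bound for `E log (1 + X)` from a bound for the Laplace transform of `X`. -/
lemma lintegral_log_le {X : Ω → ℝ} (hX : Measurable X) (h0 : ∀ ω, 0 ≤ X ω) {c : ℝ → ℝ}
    (h : ∀ s, 0 < s → ENNReal.ofReal (Real.exp (-c s)) ≤
      ∫⁻ ω, ENNReal.ofReal (Real.exp (-(s * X ω))) ∂P) :
    ∫⁻ ω, ENNReal.ofReal (Real.log (1 + X ω)) ∂P ≤
      ∫⁻ s in Ioi (0 : ℝ), ENNReal.ofReal ((1 - Real.exp (-c s)) * Real.exp (-s) / s) := by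
  simp_rw [← lintegral_one_sub_exp (h0 _)]
  rw [lintegral_lintegral_swap (by fun_prop)]
  refine setLIntegral_mono' measurableSet_Ioi fun s hs => ?_
  have hs : 0 < s := hs
  have hf : 0 ≤ Real.exp (-s) / s := by positivity
  have h1 : ∀ x : ℝ, ENNReal.ofReal (x * Real.exp (-s) / s) =
      ENNReal.ofReal (Real.exp (-s) / s) * ENNReal.ofReal x := by
    intro x
    rw [← ENNReal.ofReal_mul hf]
    congr 1; ring
  simp_rw [h1]
  rw [lintegral_const_mul _ (by fun_prop)]
  refine mul_le_mul_right ?_ _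
  have h2 : ∀ ω, ENNReal.ofReal (1 - Real.exp (-(s * X ω))) =
      1 - ENNReal.ofReal (Real.exp (-(s * X ω))) := by
    intro ω
    rw [ENNReal.ofReal_sub _ (Real.exp_pos _).le, ENNReal.ofReal_one]
  simp_rw [h2]
  have h3 : ∀ ω, ENNReal.ofReal (Real.exp (-(s * X ω))) ≤ 1 := by
    intro ω
    rw [ENNReal.ofReal_le_one, Real.exp_le_one_iff, neg_nonpos]
    exact mul_nonneg hs.le (h0 ω)
  rw [lintegral_sub' (by fun_prop) _ (Filter.Eventually.of_forall h3), lintegral_one, measure_univ,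
    ENNReal.ofReal_sub _ (Real.exp_pos _).le, ENNReal.ofReal_one]
  · exact tsub_le_tsub_left (h s hs) 1
  · refine ne_top_of_le_ne_top ?_ (lintegral_mono h3)
    simp

end Laplace

/-! ### The total over a Poisson crowd of users: its mean, Laplace transform and logarithmic moment.
-/

section Crowd

open Set

/-- The joint law of the counts and the coefficients is a product, so the Laplace formula for the
counts may be applied with the coefficients frozen. -/
lemma lintegral_exp_compound {Ω : Type*} {m₁ m₂ : MeasurableSpace Ω} [mΩ : MeasurableSpace Ω]
    {P : Measure Ω} [IsFiniteMeasure P] {ι : Type*} [Fintype ι]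
    (hm₁ : m₁ ≤ mΩ) (hm₂ : m₂ ≤ mΩ) (hind : Indep m₁ m₂ P) {n : ι → Ω → ℕ∞} {F : ι → Ω → ℝ}
    (hn : ∀ i, Measurable[m₁] (n i)) (hF : ∀ i, Measurable[m₂] (F i)) {v : ι → ℝ}
    (hlap : ∀ x : ι → ℝ, ∫⁻ ω, ENNReal.ofReal (Real.exp (-∑ i, x i * (n i ω).toNat)) ∂P =
      ENNReal.ofReal (Real.exp (-∑ i, v i * (1 - Real.exp (-x i))))) :
    ∫⁻ ω, ENNReal.ofReal (Real.exp (-∑ i, F i ω * (n i ω).toNat)) ∂P =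
      ∫⁻ ω, ENNReal.ofReal (Real.exp (-∑ i, v i * (1 - Real.exp (-F i ω)))) ∂P := by
  let f₁ : Ω → ι → ℕ∞ := fun ω i => n i ω
  let f₂ : Ω → ι → ℝ := fun ω i => F i ω
  have hf₁ : Measurable[m₁] f₁ := @measurable_pi_lambda _ _ _ m₁ _ _ hn
  have hf₂ : Measurable[m₂] f₂ := @measurable_pi_lambda _ _ _ m₂ _ _ hF
  have hf₁' : Measurable f₁ := hf₁.mono hm₁ le_rfl
  have hf₂' : Measurable f₂ := hf₂.mono hm₂ le_rfl
  have hindf : IndepFun f₂ f₁ P := by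
    rw [IndepFun_iff_Indep]
    exact indep_of_indep_of_le hind.symm hf₂.comap_le hf₁.comap_le
  have hmap := (indepFun_iff_map_prod_eq_prod_map_map hf₂'.aemeasurable hf₁'.aemeasurable).mp hindf
  have hG : Measurable fun q : (ι → ℝ) × (ι → ℕ∞) =>
      ENNReal.ofReal (Real.exp (-∑ i, q.1 i * ((q.2 i).toNat : ℝ))) := by
    have h1 : ∀ i, Measurable fun q : (ι → ℝ) × (ι → ℕ∞) => ((q.2 i).toNat : ℝ) := fun i =>
      (measurable_from_top (f := fun k : ℕ∞ => (k.toNat : ℝ))).comp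
        ((measurable_pi_apply i).comp measurable_snd)
    fun_prop
  have h2 : ∫⁻ ω, ENNReal.ofReal (Real.exp (-∑ i, F i ω * (n i ω).toNat)) ∂P =
      ∫⁻ q, ENNReal.ofReal (Real.exp (-∑ i, q.1 i * ((q.2 i).toNat : ℝ)))
        ∂(P.map fun ω => (f₂ ω, f₁ ω)) := by
    rw [lintegral_map hG (hf₂'.prodMk hf₁')]
  rw [h2, hmap, lintegral_prod _ hG.aemeasurable, lintegral_map hG.lintegral_prod_right' hf₂']
  congr 1
  funext ω
  rw [← hlap, lintegral_map _ hf₁']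
  exact hG.comp measurable_prodMk_left

/-- The sum of the cell sums over all users in the cells. -/
def crowdSum (θ h : ℝ) (N : ℕ) (I : Finset (ℤ × ℤ)) (g : Plane × ℝ → ℝ≥0∞)
    (ξ : Set (Plane × ℝ)) (U : Set Plane) : ℝ≥0∞ :=
  ∑ i ∈ I, (count U (gridCell (h / 2) i) : ℝ≥0∞) * cellSum θ h N (gridPoint (h / 2) i) g ξ

variable {Ω : Type*} [mΩ : MeasurableSpace Ω] {P : Measure Ω} [IsProbabilityMeasure P]
  {Φm : Ω → Set (Plane × ℝ)} {Φu : Ω → Set Plane} {lm lu : ℝ}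

lemma intensity_ne_top (l : ℝ) {r : ℝ} (hr : 0 < r) (i : ℤ × ℤ) :
    (ENNReal.ofReal l • (volume : Measure Plane)) (gridCell r i) ≠ ∞ := by
  rw [Measure.smul_apply, smul_eq_mul]
  exact ENNReal.mul_ne_top ENNReal.ofReal_ne_top
    (ne_top_of_le_ne_top ENNReal.ofReal_ne_top (volume_gridCell_le hr i))

omit mΩ in
lemma measurable_crowdSum (θ : ℝ) {h : ℝ} (hh : 0 ≤ h) (N : ℕ) (I : Finset (ℤ × ℤ))
    {g : Plane × ℝ → ℝ≥0∞} (hg : Measurable g) :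
    Measurable[sigmaOf Φm ⊔ sigmaOf Φu] fun ω => crowdSum θ h N I g (Φm ω) (Φu ω) := by
  refine Finset.measurable_sum _ fun i _ => Measurable.mul ?_ ?_
  · exact (measurable_from_top.comp
      (measurable_count_sigmaOf (measurableSet_gridCell (h / 2) i))).mono le_sup_right le_rfl
  · exact (measurable_cellSum θ hh N _ hg).mono le_sup_left le_rfl

variable (hm : IsPoissonProcess P Φm (stationMeasure lm))
  (hu : IsPoissonProcess P Φu (ENNReal.ofReal lu • (volume : Measure Plane)))
  (hind : Indep (sigmaOf Φu) (sigmaOf Φm) P)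
include hm

omit [IsProbabilityMeasure P] in
lemma ae_cellSum_ne_top (θ h : ℝ) (N : ℕ) (z : Plane) {g : Plane × ℝ → ℝ≥0∞}
    (hg : ∀ b, g b ≠ ∞) : ∀ᵐ ω ∂P, cellSum θ h N z g (Φm ω) ≠ ∞ := by
  have h1 : ∀ᵐ ω ∂P, ∀ k : ℕ, count (Φm ω) (annulus z h k) ≠ ⊤ :=
    ae_all_iff.mpr fun k => hm.ae_count_ne_top (measurableSet_annulus z h k)
      (stationMeasure_annulus_ne_top lm z h k)
  filter_upwards [h1] with ω hω
  refine ENNReal.sum_ne_top.mpr fun k _ => ENNReal.mul_ne_top ?_ ?_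
  · simp only [indicator_apply]
    split_ifs <;> simp
  · unfold pointSum
    rw [tsum_subtype, indicator_indicator, ← tsum_subtype]
    have hfin : (Φm ω ∩ annulus z h k).Finite := Set.encard_ne_top_iff.mp (hω k)
    have := hfin.to_subtype
    have := Fintype.ofFinite ↑(Φm ω ∩ annulus z h k)
    rw [tsum_fintype]
    refine ENNReal.sum_ne_top.mpr fun b _ => ?_
    by_cases hb : (b : Plane × ℝ) ∈ lobeSet θ h z <;> simp [hb, hg]

include hu

omit [IsProbabilityMeasure P] in
lemma ae_crowdSum_ne_top (θ : ℝ) {h : ℝ} (hh : 0 < h) (N : ℕ) (I : Finset (ℤ × ℤ))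
    {g : Plane × ℝ → ℝ≥0∞} (hg : ∀ b, g b ≠ ∞) :
    ∀ᵐ ω ∂P, (∀ i ∈ I, (count (Φu ω) (gridCell (h / 2) i) : ℝ≥0∞) *
      cellSum θ h N (gridPoint (h / 2) i) g (Φm ω) ≠ ∞) ∧
      crowdSum θ h N I g (Φm ω) (Φu ω) ≠ ∞ := by
  have h1 : ∀ᵐ ω ∂P, ∀ i, cellSum θ h N (gridPoint (h / 2) i) g (Φm ω) ≠ ∞ :=
    ae_all_iff.mpr fun i => ae_cellSum_ne_top hm θ h N _ hg
  have h2 : ∀ᵐ ω ∂P, ∀ i, count (Φu ω) (gridCell (h / 2) i) ≠ ⊤ :=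
    ae_all_iff.mpr fun i => hu.ae_count_ne_top (measurableSet_gridCell _ i)
      (intensity_ne_top lu (by positivity) i)
  filter_upwards [h1, h2] with ω h1 h2
  have h3 : ∀ i ∈ I, (count (Φu ω) (gridCell (h / 2) i) : ℝ≥0∞) *
      cellSum θ h N (gridPoint (h / 2) i) g (Φm ω) ≠ ∞ := fun i _ =>
    ENNReal.mul_ne_top (ENat.toENNReal_ne_top.mpr (h2 i)) (h1 i)
  exact ⟨h3, ENNReal.sum_ne_top.mpr h3⟩

include hind

-- This mean controls the far indoor interference, for which a first moment is enough.
omit [IsProbabilityMeasure P] in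
lemma lintegral_crowdSum_le (hlm : 0 < lm) (θ : ℝ) {h : ℝ} (hh : 0 < h) (N : ℕ)
    (I : Finset (ℤ × ℤ)) {g : Plane × ℝ → ℝ≥0∞} (hg : Measurable g) {C : ℝ≥0∞}
    (hC : ∀ e : Plane, e ≠ 0 → lobeMass lm θ h e ≤ C) :
    ∫⁻ ω, crowdSum θ h N I g (Φm ω) (Φu ω) ∂P ≤
      ENNReal.ofReal lu * (C * ∫⁻ b, g b ∂(volume : Measure Plane).prod (expMeasure 1)) := by
  unfold crowdSum
  have hc : ∀ i, Measurable[sigmaOf Φu] fun ω => (count (Φu ω) (gridCell (h / 2) i) : ℝ≥0∞) :=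
    fun i => measurable_from_top.comp (measurable_count_sigmaOf (measurableSet_gridCell _ i))
  rw [lintegral_finsetSum]
  · refine le_trans (le_of_eq ?_)
      (mul_le_mul_right (sum_lintegral_cellSum_le hm hlm θ hh N I hg hC) _)
    rw [Finset.mul_sum]
    refine Finset.sum_congr rfl fun i _ => ?_
    rw [lintegral_mul_eq_lintegral_mul_lintegral_of_independent_measurableSpace hu.sigmaOf_le
      hm.sigmaOf_le hind (hc i) (measurable_cellSum θ hh.le N _ hg),
      hu.lintegral_count (measurableSet_gridCell _ i) (intensity_ne_top lu (by positivity) i),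
      Measure.smul_apply, smul_eq_mul, mul_assoc]
  · exact fun i _ => ((hc i).mono hu.sigmaOf_le le_rfl).mul
      ((measurable_cellSum θ hh.le N _ hg).mono hm.sigmaOf_le le_rfl)

/-- A lower bound for the Laplace transform of the sum over all users. -/
lemma le_lintegral_exp_crowdSum (hlm : 0 < lm) (hlu : 0 < lu) (θ : ℝ) {h : ℝ} (hh : 0 < h) (N : ℕ)
    (I : Finset (ℤ × ℤ)) {g : Plane × ℝ → ℝ≥0∞} (hg : Measurable g) (hg' : ∀ b, g b ≠ ∞)
    {ψ : ℝ} (hψ : 0 ≤ ψ) (hC : ∀ e : Plane, e ≠ 0 → lobeMass lm θ h e ≤ ENNReal.ofReal ψ)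
    {s κ : ℝ} (hs : 0 ≤ s) (hκ0 : 0 ≤ κ) (hκ : ∫⁻ b, lapl s (g b)
      ∂(volume : Measure Plane).prod (expMeasure 1) ≤ ENNReal.ofReal κ) :
    ENNReal.ofReal (Real.exp (-(lu * (ψ * κ)))) ≤
      ∫⁻ ω, ENNReal.ofReal (Real.exp (-(s * (crowdSum θ h N I g (Φm ω) (Φu ω)).toReal))) ∂P := by
  let F : I → Ω → ℝ := fun i ω => s * (cellSum θ h N (gridPoint (h / 2) i) g (Φm ω)).toReal
  let n : I → Ω → ℕ∞ := fun i ω => count (Φu ω) (gridCell (h / 2) i)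
  let v : I → ℝ := fun i =>
    ((ENNReal.ofReal lu • (volume : Measure Plane)) (gridCell (h / 2) i)).toReal
  have hF : ∀ i, Measurable[sigmaOf Φm] (F i) := fun i =>
    ((measurable_cellSum θ hh.le N _ hg).ennreal_toReal).const_mul s
  have hF0 : ∀ i ω, 0 ≤ F i ω := fun i ω => mul_nonneg hs ENNReal.toReal_nonneg
  have h1 : ∫⁻ ω, ENNReal.ofReal (Real.exp (-(s * (crowdSum θ h N I g (Φm ω) (Φu ω)).toReal))) ∂P =
      ∫⁻ ω, ENNReal.ofReal (Real.exp (-∑ i, F i ω * (n i ω).toNat)) ∂P := by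
    refine lintegral_congr_ae ?_
    filter_upwards [ae_crowdSum_ne_top hm hu θ hh N I hg'] with ω hω
    congr 3
    unfold crowdSum
    rw [ENNReal.toReal_sum hω.1, Finset.mul_sum, ← Finset.sum_coe_sort]
    refine Finset.sum_congr rfl fun i _ => ?_
    rw [ENNReal.toReal_mul]
    simp only [F, n]
    have : ∀ m : ℕ∞, (m : ℝ≥0∞).toReal = (m.toNat : ℝ) := by
      intro m
      induction m using ENat.recTopCoe <;> simp
    rw [this]
    ring
  -- Given the stations, the cell counts of users are independent Poisson variables; averaging over
  -- them leaves the exponential of a random variable that depends on the stations alone, to which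
  -- Jensen's inequality applies.
  rw [h1, lintegral_exp_compound (m₁ := sigmaOf Φu) (m₂ := sigmaOf Φm) hu.sigmaOf_le hm.sigmaOf_le
    hind (v := v) (fun i => measurable_count_sigmaOf (measurableSet_gridCell _ _)) hF
    (fun x => hu.lintegral_exp_sum_count (fun i => measurableSet_gridCell _ _)
      (fun i j hij => pairwise_disjoint_gridCell _ (Subtype.coe_injective.ne hij))
      (fun i => intensity_ne_top lu (by positivity) i) x)]
  have hv0 : ∀ i, 0 ≤ v i := fun i => ENNReal.toReal_nonneg
  have he : ∀ i ω, 0 ≤ 1 - Real.exp (-F i ω) := fun i ω => by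
    rw [sub_nonneg, Real.exp_le_one_iff]; linarith [hF0 i ω]
  have hF' : ∀ i, Measurable (F i) := fun i => (hF i).mono hm.sigmaOf_le le_rfl
  refine le_lintegral_exp_neg (by fun_prop)
    (fun ω => Finset.sum_nonneg fun i _ => mul_nonneg (hv0 i) (he i ω)) (by positivity) ?_
  have h2 : ∀ ω, ENNReal.ofReal (∑ i, v i * (1 - Real.exp (-F i ω))) =
      ∑ i, ENNReal.ofReal (v i) * ENNReal.ofReal (1 - Real.exp (-F i ω)) := by
    intro ω
    rw [ENNReal.ofReal_sum_of_nonneg fun i _ => mul_nonneg (hv0 i) (he i ω)]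
    exact Finset.sum_congr rfl fun i _ => ENNReal.ofReal_mul (hv0 i)
  simp_rw [h2]
  rw [lintegral_finsetSum _ (fun i _ => by fun_prop)]
  -- Subadditivity moves the deficit inside the sum over stations, so that the first-moment bound
  -- for cell sums can be used with `lapl s ∘ g` in place of `g`.
  have h3 : ∀ i ∈ (Finset.univ : Finset I),
      ∫⁻ ω, ENNReal.ofReal (v i) * ENNReal.ofReal (1 - Real.exp (-F i ω)) ∂P ≤
      ENNReal.ofReal lu * (volume (gridCell (h / 2) i) *
        ∫⁻ ω, cellSum θ h N (gridPoint (h / 2) i) (fun b => lapl s (g b)) (Φm ω) ∂P) := by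
    intro i _
    rw [lintegral_const_mul _ (by fun_prop),
      ENNReal.ofReal_toReal (intensity_ne_top lu (by positivity) i), Measure.smul_apply,
      smul_eq_mul, mul_assoc]
    gcongr
    exact lapl_cellSum_le hs θ h N _ g _
  refine (Finset.sum_le_sum h3).trans ?_
  rw [← Finset.mul_sum, ENNReal.ofReal_mul hlu.le, ENNReal.ofReal_mul hψ]
  refine mul_le_mul_right ?_ _
  have h4 := sum_lintegral_cellSum_le hm hlm θ hh N I (g := fun b => lapl s (g b))
    (by fun_prop) hC
  rw [← Finset.sum_coe_sort] at h4
  exact h4.trans (mul_le_mul_right hκ _)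

/-- The logarithmic moment of the interference is at most that of a stable law. -/
lemma lintegral_log_crowdSum_le {α σ : ℝ} (hα : 2 < α) (hσ : 0 < σ) (hlm : 0 < lm) (hlu : 0 < lu)
    (θ : ℝ) {h : ℝ} (hh : 0 < h) (N : ℕ) (I : Finset (ℤ × ℤ)) {g : Plane × ℝ → ℝ≥0∞}
    (hg : Measurable g) (hg' : ∀ b, g b ≤ receivedPower α b) {ψ : ℝ} (hψ : 0 < ψ)
    (hC : ∀ e : Plane, e ≠ 0 → lobeMass lm θ h e ≤ ENNReal.ofReal ψ) {τ : ℝ}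
    (hτ : τ = σ ^ 2 / (lu * (ψ * (Real.pi * rho α))) ^ (α / 2)) :
    ∫⁻ ω, ENNReal.ofReal
      (Real.log (1 + (crowdSum θ h N I g (Φm ω) (Φu ω)).toReal / σ ^ 2)) ∂P ≤
      ENNReal.ofReal ((1 - α / 2) * meanLogExp - Real.log τ +
        τ ^ (1 / 2 : ℝ) * lossConst (α / 2)) := by
  have hfin : ∀ b : Plane × ℝ, receivedPower α b ≠ ∞ := fun b => ENNReal.ofReal_ne_top
  have hρ := rho_pos hα
  have hpi := Real.pi_pos
  have hτ0 : 0 < τ := by rw [hτ]; positivity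
  refine le_trans (lintegral_log_le (P := P) (c := fun s => (s / τ) ^ (1 / (α / 2))) ?_ ?_ ?_)
    (lintegral_stable_le (by linarith) hτ0)
  · exact (((measurable_crowdSum θ hh.le N I hg).mono (sup_le hm.sigmaOf_le hu.sigmaOf_le)
      le_rfl).ennreal_toReal).div_const _
  · exact fun ω => div_nonneg ENNReal.toReal_nonneg (by positivity)
  · intro s hs
    have hs' : 0 < s / σ ^ 2 := by positivity
    have hκ : ∫⁻ b, lapl (s / σ ^ 2) (g b) ∂(volume : Measure Plane).prod (expMeasure 1) ≤
        ENNReal.ofReal ((s / σ ^ 2) ^ (2 / α) * (Real.pi * rho α)) := by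
      rw [← lintegral_one_sub_exp_power hα hs']
      refine lintegral_mono fun b => ENNReal.ofReal_le_ofReal ?_
      have := ENNReal.toReal_mono (hfin b) (hg' b)
      gcongr
    have h1 := le_lintegral_exp_crowdSum hm hu hind hlm hlu θ hh N I hg
      (fun b => ne_top_of_le_ne_top (hfin b) (hg' b)) hψ.le hC hs'.le (by positivity) hκ
    -- The scale τ is defined so that the exponent of the bound is exactly (s/τ)^(2/α).
    have h2 : (s / τ) ^ (1 / (α / 2)) =
        lu * (ψ * ((s / σ ^ 2) ^ (2 / α) * (Real.pi * rho α))) := by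
      have hd : 0 < lu * (ψ * (Real.pi * rho α)) := by positivity
      rw [hτ, div_div_eq_mul_div, mul_div_right_comm, Real.mul_rpow hs'.le (by positivity),
        ← Real.rpow_mul hd.le, show α / 2 * (1 / (α / 2)) = 1 by field_simp, Real.rpow_one,
        one_div_div]
      ring
    rw [h2]
    refine h1.trans (le_of_eq ?_)
    congr 1
    funext ω
    congr 3
    ring

end Crowd

/-! ### Walls and lines of sight. -/

section Blockage

open Set

lemma mem_indoor {G : Set Plane} {R : ℝ} {x : Plane} : x ∈ indoor G R ↔ ∃ c ∈ G, dist x c ≤ R := by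
  simp [indoor]

lemma zero_mem_indoor {G : Set Plane} {R : ℝ} :
    (0 : Plane) ∈ indoor G R ↔ count G (Metric.closedBall 0 R) ≠ 0 := by
  rw [mem_indoor, count, Ne, encard_eq_zero, ← Ne, ← nonempty_iff_ne_empty]
  simp only [dist_comm (0 : Plane)]
  rfl

lemma Visible.notMem {W : Set Plane} {y x z : Plane} (h : Visible W y x) (hz : z ∈ segment ℝ y x) :
    z ∉ W := by
  intro hzW
  rw [segment_eq_image'] at hz
  obtain ⟨s, hs, rfl⟩ := hz
  have hmem : s * ‖x - y‖ ∈ {t : ℝ | 0 ≤ t ∧ y + t • direction y x ∈ W} := by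
    refine ⟨mul_nonneg hs.1 (norm_nonneg _), ?_⟩
    have : (s * ‖x - y‖) • direction y x = s • (x - y) := by
      rcases eq_or_ne x y with rfl | hxy
      · simp
      · have h0 : ‖x - y‖ ≠ 0 := norm_ne_zero_iff.mpr (sub_ne_zero.mpr hxy)
        rw [direction, smul_smul, mul_assoc, mul_inv_cancel₀ h0, mul_one]
    rwa [this]
  have h1 : nonBlockageDist W y (direction y x) ≤ ENNReal.ofReal (s * ‖x - y‖) :=
    iInf₂_le_of_le _ hmem le_rfl
  have h2 : ENNReal.ofReal (s * ‖x - y‖) ≤ ENNReal.ofReal (dist y x) := by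
    rw [dist_comm, dist_eq_norm]
    exact ENNReal.ofReal_le_ofReal (mul_le_of_le_one_left (norm_nonneg _) hs.2)
  exact absurd h (not_lt.mpr (h1.trans h2))

lemma visible_of_disjoint {W : Set Plane} {y x : Plane} {w : ℝ} (hW : Disjoint (Metric.ball y w) W)
    (hx : dist y x < w) : Visible W y x := by
  have hw : 0 < w := dist_nonneg.trans_lt hx
  refine ((ENNReal.ofReal_lt_ofReal_iff hw).mpr hx).trans_le (le_iInf₂ fun t ht => ?_)
  refine ENNReal.ofReal_le_ofReal ?_
  by_contra! htw
  refine Set.disjoint_left.mp hW ?_ ht.2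
  have hd : ‖direction y x‖ ≤ 1 := by
    rw [direction, norm_smul, norm_inv, norm_norm]
    exact inv_mul_le_one
  rw [Metric.mem_ball, dist_eq_norm, add_sub_cancel_left, norm_smul, Real.norm_of_nonneg ht.1]
  exact (mul_le_of_le_one_right ht.1 hd).trans_lt htw

/-- If the centre is well inside one disc, the whole open ball is interior to the indoor region.
Otherwise the ball meets no disc, and being open it misses the closure of their union as well; no
local finiteness is needed. -/
lemma disjoint_ball_walls {G : Set Plane} {R w : ℝ} {y : Plane}
    (h : ∀ c ∈ G, w < |dist y c - R|) : Disjoint (Metric.ball y w) (walls G R) := by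
  rw [walls]
  by_cases hin : ∃ c ∈ G, dist y c < R - w
  · obtain ⟨c, hc, hyc⟩ := hin
    refine (disjoint_interior_frontier (s := indoor G R)).mono_left
      (Metric.isOpen_ball.subset_interior_iff.mpr fun z hz => mem_indoor.mpr ⟨c, hc, ?_⟩)
    have := dist_triangle z y c
    have := Metric.mem_ball.mp hz
    linarith
  · push Not at hin
    refine (Disjoint.closure_right ?_ Metric.isOpen_ball).mono_right frontier_subset_closure
    refine Set.disjoint_left.mpr fun z hz hzG => ?_
    obtain ⟨c, hc, hzc⟩ := mem_indoor.mp hzG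
    have h1 := dist_triangle_left y c z
    have h2 := Metric.mem_ball.mp hz
    rcases lt_abs.mp (h c hc) with h3 | h3
    · linarith
    · linarith [hin c hc]

/-- Off the frontier, the interior of a set and the complement of its closure would separate the
connected segment. -/
lemma segment_subset_or_disjoint {s : Set Plane} {p q : Plane}
    (h : ∀ z ∈ segment ℝ p q, z ∉ frontier s) :
    (∀ z ∈ segment ℝ p q, z ∈ s) ∨ ∀ z ∈ segment ℝ p q, z ∉ s := by
  by_contra! hc
  obtain ⟨⟨a, ha, has⟩, b, hb, hbs⟩ := hc
  have key : ∀ z ∈ segment ℝ p q, (z ∈ s → z ∈ interior s) ∧ (z ∉ s → z ∈ (closure s)ᶜ) :=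
    fun z hz => ⟨fun hs => by_contra fun hi => h z hz ⟨subset_closure hs, hi⟩,
      fun hs hc => h z hz ⟨hc, fun hi => hs (interior_subset hi)⟩⟩
  obtain ⟨z, -, hz⟩ := (convex_segment p q).isPreconnected _ _ isOpen_interior
    isClosed_closure.isOpen_compl (fun z hz => by
      by_cases hs : z ∈ s
      · exact Or.inl ((key z hz).1 hs)
      · exact Or.inr ((key z hz).2 hs)) ⟨b, hb, (key b hb).1 hbs⟩ ⟨a, ha, (key a ha).2 has⟩
  exact hz.2 (subset_closure (interior_subset hz.1))

/-- A point at distance at most `L` on a segment of length at least `L`. -/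
lemma exists_segment_dist_eq {p q : Plane} {L : ℝ} (hL : 0 ≤ L) (h : L ≤ dist p q) :
    ∃ x, dist p x = L ∧ segment ℝ p x ⊆ segment ℝ p q := by
  rcases hL.eq_or_lt with rfl | hL
  · exact ⟨p, dist_self p, by simpa using left_mem_segment ℝ p q⟩
  have hd : 0 < dist p q := hL.trans_le h
  refine ⟨AffineMap.lineMap p q (L / dist p q), ?_, ?_⟩
  · rw [dist_left_lineMap, Real.norm_of_nonneg (by positivity)]
    field_simp
  · refine (convex_segment p q).segment_subset (left_mem_segment ℝ p q) ?_
    rw [segment_eq_image_lineMap]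
    exact ⟨_, ⟨by positivity, (div_le_one hd).mpr h⟩, rfl⟩

end Blockage

/-! ### Long lines of sight are exponentially unlikely. -/

section Net

open Set

/-- The points that divide the segment between two grid points into `n` equal parts. -/
def chainPoint (R : ℝ) (n : ℕ) (i j : ℤ × ℤ) (m : ℕ) : Plane :=
  AffineMap.lineMap (gridPoint (R / 4) i) (gridPoint (R / 4) j) ((m : ℝ) / n)

/-- For two grid points in the disc of radius `A` whose distance exceeds `3 R n`, the numbers of
points of `G` in the discs of radius `r` around the chain points lie in `s`. -/
def NetEvent (R A r : ℝ) (n : ℕ) (s : Set ℕ∞) (G : Set Plane) : Prop :=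
  ∃ i ∈ gridIndex (R / 4) A, ∃ j ∈ gridIndex (R / 4) A,
    3 * R * n < dist (gridPoint (R / 4) i) (gridPoint (R / 4) j) ∧
    ∀ m ∈ Finset.range n, count G (Metric.closedBall (chainPoint R n i j m) r) ∈ s

/-- Moving both endpoints to grid points displaces every point of the segment by at most R/2. Thus
finitely many chains stand for all segments, at the cost of R in the length. -/
lemma exists_grid_chain {R A : ℝ} (hR : 0 < R) {n : ℕ} {p q : Plane} (hp : ‖p‖ ≤ A) (hq : ‖q‖ ≤ A)
    (hn : (3 * n + 1) * R < dist p q) :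
    ∃ i ∈ gridIndex (R / 4) A, ∃ j ∈ gridIndex (R / 4) A,
      3 * R * n < dist (gridPoint (R / 4) i) (gridPoint (R / 4) j) ∧
      ∀ m ∈ Finset.range n, ∃ z ∈ segment ℝ p q, dist z (chainPoint R n i j m) ≤ R / 2 := by
  obtain ⟨i, hi, hpi⟩ := exists_mem_gridCell (r := R / 4) (by positivity) hp
  obtain ⟨j, hj, hqj⟩ := exists_mem_gridCell (r := R / 4) (by positivity) hq
  have h1 := dist_gridPoint_le (by positivity) hpi
  have h2 := dist_gridPoint_le (by positivity) hqj
  refine ⟨i, hi, j, hj, ?_, fun m hm => ⟨AffineMap.lineMap p q ((m : ℝ) / n), ?_, ?_⟩⟩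
  · have := dist_triangle4 p (gridPoint (R / 4) i) (gridPoint (R / 4) j) q
    rw [dist_comm (gridPoint (R / 4) j) q] at this
    linarith
  · rw [segment_eq_image_lineMap]
    have hmn : (m : ℝ) ≤ n := by exact_mod_cast (Finset.mem_range.mp hm).le
    exact ⟨_, ⟨by positivity, div_le_one_of_le₀ hmn (by positivity)⟩, rfl⟩
  · have hmn : (m : ℝ) ≤ n := by exact_mod_cast (Finset.mem_range.mp hm).le
    set a : ℝ := (m : ℝ) / n
    have ha0 : 0 ≤ a := by positivity
    have ha1 : a ≤ 1 := div_le_one_of_le₀ hmn (by positivity)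
    rw [chainPoint, dist_eq_norm]
    have e : AffineMap.lineMap p q a - AffineMap.lineMap (gridPoint (R / 4) i)
        (gridPoint (R / 4) j) a =
        (1 - a) • (p - gridPoint (R / 4) i) + a • (q - gridPoint (R / 4) j) := by
      simp only [AffineMap.lineMap_apply_module]
      module
    rw [e]
    refine (norm_add_le _ _).trans ?_
    rw [norm_smul, norm_smul, Real.norm_of_nonneg ha0, Real.norm_of_nonneg (by linarith),
      ← dist_eq_norm, ← dist_eq_norm]
    nlinarith

/-- A covered point has a disc centre within R, and the chain point is within R/2 of it: hence the
radius 3R/2. -/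
lemma netEvent_of_inside {R A : ℝ} (hR : 0 < R) {n : ℕ} {G : Set Plane} {p q : Plane}
    (hp : ‖p‖ ≤ A) (hq : ‖q‖ ≤ A) (hn : (3 * n + 1) * R < dist p q)
    (h : ∀ z ∈ segment ℝ p q, z ∈ indoor G R) : NetEvent R A (3 * R / 2) n {0}ᶜ G := by
  obtain ⟨i, hi, j, hj, hd, hz⟩ := exists_grid_chain hR hp hq hn
  refine ⟨i, hi, j, hj, hd, fun m hm => ?_⟩
  obtain ⟨z, hzs, hzd⟩ := hz m hm
  obtain ⟨c, hc, hzc⟩ := mem_indoor.mp (h z hzs)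
  have : c ∈ G ∩ Metric.closedBall (chainPoint R n i j m) (3 * R / 2) := by
    refine ⟨hc, ?_⟩
    have := dist_triangle_left c (chainPoint R n i j m) z
    rw [Metric.mem_closedBall]
    linarith
  exact fun h0 => Set.notMem_empty c (Set.encard_eq_zero.mp h0 ▸ this)

/-- A centre within R/2 of a chain point would cover the nearby point of the segment. -/
lemma netEvent_of_outside {R A : ℝ} (hR : 0 < R) {n : ℕ} {G : Set Plane} {p q : Plane}
    (hp : ‖p‖ ≤ A) (hq : ‖q‖ ≤ A) (hn : (3 * n + 1) * R < dist p q)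
    (h : ∀ z ∈ segment ℝ p q, z ∉ indoor G R) : NetEvent R A (R / 2) n {0} G := by
  obtain ⟨i, hi, j, hj, hd, hz⟩ := exists_grid_chain hR hp hq hn
  refine ⟨i, hi, j, hj, hd, fun m hm => ?_⟩
  obtain ⟨z, hzs, hzd⟩ := hz m hm
  refine Set.encard_eq_zero.mpr (Set.eq_empty_of_forall_notMem fun c hc => ?_)
  refine h z hzs (mem_indoor.mpr ⟨c, hc.1, ?_⟩)
  have h1 := dist_triangle z (chainPoint R n i j m) c
  have h2 := Metric.mem_closedBall'.mp hc.2
  linarith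

variable {Ω : Type*} {Φ : Ω → Set Plane}

lemma measurableSet_netEvent (R A r : ℝ) (n : ℕ) (s : Set ℕ∞) :
    MeasurableSet[sigmaOf Φ] {ω | NetEvent R A r n s (Φ ω)} := by
  have : {ω | NetEvent R A r n s (Φ ω)} = ⋃ i ∈ gridIndex (R / 4) A, ⋃ j ∈ gridIndex (R / 4) A,
      {ω | 3 * R * n < dist (gridPoint (R / 4) i) (gridPoint (R / 4) j)} ∩
      ⋂ m ∈ Finset.range n, {ω | count (Φ ω) (Metric.closedBall (chainPoint R n i j m) r) ∈ s} := by
    ext ω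
    simp only [NetEvent, mem_iUnion, mem_inter_iff, mem_iInter, Set.mem_ofPred_eq, exists_prop]
  rw [this]
  refine Finset.measurableSet_biUnion _ fun i _ => Finset.measurableSet_biUnion _ fun j _ => ?_
  refine MeasurableSet.inter (MeasurableSet.const _) (Finset.measurableSet_biInter _ fun m _ => ?_)
  exact measurable_count_sigmaOf Metric.isClosed_closedBall.measurableSet (MeasurableSet.of_discrete)

variable [mΩ : MeasurableSpace Ω] {P : Measure Ω} [IsProbabilityMeasure P] {lg : ℝ}
  (hg : IsPoissonProcess P Φ (ENNReal.ofReal lg • (volume : Measure Plane)))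
include hg

-- Chain points are more than 3R ≥ 2r apart, so the discs around them are disjoint and the counts
-- independent. This gives κ^n for each pair of grid points, and the union bound counts the pairs.
omit [IsProbabilityMeasure P] in
lemma measure_netEvent_le {R A r : ℝ} (hR : 0 < R) (hA : 0 ≤ A) (hr : r ≤ 3 * R / 2) {n : ℕ}
    {s : Set ℕ∞} {κ : ℝ} (hκ : 0 ≤ κ)
    (hs : ∀ x, P {ω | count (Φ ω) (Metric.closedBall x r) ∈ s} ≤ ENNReal.ofReal κ) :
    P {ω | NetEvent R A r n s (Φ ω)} ≤ ENNReal.ofReal ((8 * A / R + 5) ^ 4 * κ ^ n) := by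
  let I := (gridIndex (R / 4) A ×ˢ gridIndex (R / 4) A).filter fun ij =>
    3 * R * n < dist (gridPoint (R / 4) ij.1) (gridPoint (R / 4) ij.2)
  have h1 : {ω | NetEvent R A r n s (Φ ω)} ⊆ ⋃ ij ∈ I, ⋂ m ∈ (Finset.univ : Finset (Fin n)),
      (fun ω => count (Φ ω) (Metric.closedBall (chainPoint R n ij.1 ij.2 m) r)) ⁻¹' s := by
    rintro ω ⟨i, hi, j, hj, hd, hm⟩
    refine mem_biUnion (x := (i, j)) (Finset.mem_filter.mpr
      ⟨Finset.mem_product.mpr ⟨hi, hj⟩, hd⟩) (mem_iInter₂.mpr fun m _ => ?_)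
    exact hm m (Finset.mem_range.mpr m.2)
  refine (measure_mono h1).trans ((measure_biUnion_finset_le _ _).trans ?_)
  have h2 : ∀ ij ∈ I, P (⋂ m ∈ (Finset.univ : Finset (Fin n)),
      (fun ω => count (Φ ω) (Metric.closedBall (chainPoint R n ij.1 ij.2 m) r)) ⁻¹' s) ≤
      ENNReal.ofReal (κ ^ n) := by
    intro ij hij
    have hd := (Finset.mem_filter.mp hij).2
    have hind := hg.iIndepFun_count (ι := Fin n)
      (B := fun m => Metric.closedBall (chainPoint R n ij.1 ij.2 m) r)
      (fun m => Metric.isClosed_closedBall.measurableSet) (by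
        intro m m' hmm
        refine Metric.closedBall_disjoint_closedBall ?_
        have hn : (0 : ℝ) < n := by exact_mod_cast m.pos
        rw [chainPoint, chainPoint, dist_lineMap_lineMap, Real.dist_eq, ← sub_div, abs_div,
          abs_of_pos hn]
        have h3 : (1 : ℝ) ≤ |((m : ℕ) : ℝ) - (m' : ℕ)| := by
          have : (1 : ℤ) ≤ |((m : ℕ) : ℤ) - (m' : ℕ)| := by
            refine Int.one_le_abs (sub_ne_zero.mpr fun h => hmm (Fin.ext (by exact_mod_cast h)))
          exact_mod_cast this
        calc r + r ≤ 3 * R := by linarith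
          _ < 1 / n * dist (gridPoint (R / 4) ij.1) (gridPoint (R / 4) ij.2) := by
            rw [one_div, inv_mul_eq_div, lt_div_iff₀ hn]; exact hd
          _ ≤ _ := by gcongr)
    rw [hind.measure_inter_preimage_eq_mul Finset.univ (fun _ _ => MeasurableSet.of_discrete)]
    refine (Finset.prod_le_prod' fun m _ => hs _).trans (le_of_eq ?_)
    rw [Finset.prod_const, Finset.card_univ, Fintype.card_fin, ENNReal.ofReal_pow hκ]
  refine (Finset.sum_le_sum h2).trans ?_
  rw [Finset.sum_const, nsmul_eq_mul, ← ENNReal.ofReal_natCast,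
    ← ENNReal.ofReal_mul (by positivity)]
  refine ENNReal.ofReal_le_ofReal (mul_le_mul_of_nonneg_right ?_ (by positivity))
  have h4 : (I.card : ℝ) ≤ ((gridIndex (R / 4) A).card : ℝ) * ((gridIndex (R / 4) A).card : ℝ) := by
    rw [← Nat.cast_mul, ← Finset.card_product]
    exact_mod_cast Finset.card_filter_le _ _
  have h5 := card_gridIndex_le (r := R / 4) (by positivity) hA
  have h6 : 2 * A / (R / 4) = 8 * A / R := by field_simp; ring
  rw [h6] at h5
  refine h4.trans ?_
  calc _ ≤ (8 * A / R + 5) ^ 2 * (8 * A / R + 5) ^ 2 := by gcongr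
    _ = _ := by ring

omit [IsProbabilityMeasure P] in
lemma measure_closedBall_void (hlg : 0 < lg) (x : Plane) {r : ℝ} (hr : 0 ≤ r) :
    P {ω | count (Φ ω) (Metric.closedBall x r) = 0} =
      ENNReal.ofReal (Real.exp (-(lg * (Real.pi * r ^ 2)))) := by
  have hv : (ENNReal.ofReal lg • (volume : Measure Plane)) (Metric.closedBall x r) =
      ENNReal.ofReal (lg * (Real.pi * r ^ 2)) := by
    rw [Measure.smul_apply, smul_eq_mul, EuclideanSpace.volume_closedBall_fin_two,
      ← ENNReal.ofReal_pow hr, ← ENNReal.ofReal_mul (by positivity), ← ENNReal.ofReal_mul hlg.le]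
    congr 1
    ring
  rw [hg.measure_void Metric.isClosed_closedBall.measurableSet (by rw [hv]; exact ENNReal.ofReal_ne_top),
    hv, ENNReal.toReal_ofReal (by positivity)]

lemma measure_closedBall_nonvoid (hlg : 0 < lg) (x : Plane) {r : ℝ} (hr : 0 ≤ r) :
    P {ω | count (Φ ω) (Metric.closedBall x r) ≠ 0} =
      ENNReal.ofReal (1 - Real.exp (-(lg * (Real.pi * r ^ 2)))) := by
  have h0 : MeasurableSet {ω | count (Φ ω) (Metric.closedBall x r) = 0} :=
    hg.measurable_count _ Metric.isClosed_closedBall.measurableSet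
      (MeasurableSet.of_discrete (s := {(0 : ℕ∞)}))
  have h1 : {ω | count (Φ ω) (Metric.closedBall x r) ≠ 0} =
      {ω | count (Φ ω) (Metric.closedBall x r) = 0}ᶜ := rfl
  rw [h1, prob_compl_eq_one_sub h0, measure_closedBall_void hg hlg x hr,
    ENNReal.ofReal_sub _ (Real.exp_pos _).le, ENNReal.ofReal_one]

lemma measure_netEvent_inside_le (hlg : 0 < lg) {R A : ℝ} (hR : 0 < R) (hA : 0 ≤ A) (n : ℕ) :
    P {ω | NetEvent R A (3 * R / 2) n {0}ᶜ (Φ ω)} ≤ ENNReal.ofReal ((8 * A / R + 5) ^ 4 *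
      (1 - Real.exp (-(lg * (Real.pi * (3 * R / 2) ^ 2)))) ^ n) := by
  refine measure_netEvent_le hg hR hA le_rfl ?_
    fun x => (measure_closedBall_nonvoid hg hlg x (by positivity)).le
  rw [sub_nonneg, Real.exp_le_one_iff, neg_nonpos]
  positivity

omit [IsProbabilityMeasure P] in
lemma measure_netEvent_outside_le (hlg : 0 < lg) {R A : ℝ} (hR : 0 < R) (hA : 0 ≤ A) (n : ℕ) :
    P {ω | NetEvent R A (R / 2) n {0} (Φ ω)} ≤ ENNReal.ofReal ((8 * A / R + 5) ^ 4 *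
      Real.exp (-(lg * (Real.pi * (R / 2) ^ 2))) ^ n) :=
  measure_netEvent_le hg hR hA (by linarith) (Real.exp_pos _).le
    fun x => (measure_closedBall_void hg hlg x (by positivity)).le

end Net

/-! ### Regular configurations and the bound of their interference by crowd sums. -/

section Regular

open Set

/-- A configuration in which, up to distance `2 M`, every point has a station within distance `w`
and no user is within distance `w` of the boundary of a disc, and no line of sight that starts at
distance at most `M` has length `M`. -/
structure Regular (w M R : ℝ) (B : Set (Plane × ℝ)) (U G : Set Plane) : Prop where
  origin : ∀ c ∈ G, w < |dist 0 c - R|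
  users : ∀ y ∈ U, ‖y‖ < 2 * M → ∀ c ∈ G, w < |dist y c - R|
  near : ∀ y : Plane, ‖y‖ < 2 * M → ∃ b ∈ B, dist y b.1 < w
  short : ∀ p q : Plane, ‖p‖ ≤ M → dist p q = M → ∃ z ∈ segment ℝ p q, z ∈ walls G R

variable {w M R : ℝ} {B : Set (Plane × ℝ)} {U G : Set Plane}

lemma Regular.dist_lt (h : Regular w M R B U G) (hM : 0 ≤ M) {p q : Plane} (hp : ‖p‖ ≤ M)
    (hpq : ∀ z ∈ segment ℝ p q, z ∉ walls G R) : dist p q < M := by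
  by_contra! hd
  obtain ⟨x, hx, hs⟩ := exists_segment_dist_eq hM hd
  obtain ⟨z, hz, hzw⟩ := h.short p x hp hx
  exact hpq z (hs hz) hzw

lemma Regular.norm_lt (h : Regular w M R B U G) (hM : 0 ≤ M) {x : Plane}
    (hx : Visible (walls G R) 0 x) : ‖x‖ < M := by
  have := h.dist_lt hM (p := 0) (q := x) (by simpa using hM) fun z hz => hx.notMem hz
  rwa [dist_zero_left] at this

lemma Regular.norm_user_lt (h : Regular w M R B U G) (hM : 0 ≤ M) {x y : Plane}
    (hx : Visible (walls G R) 0 x) (hy : Visible (walls G R) y x) : ‖y‖ < 2 * M := by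
  have h1 := h.norm_lt hM hx
  have h2 := h.dist_lt hM (p := x) (q := y) h1.le fun z hz => hy.notMem (segment_symm ℝ x y ▸ hz)
  have h3 := dist_triangle 0 x y
  rw [dist_zero_left, dist_zero_left] at h3
  linarith

/-- No wall is within `w` of the user and some station is, so this station is non-blocked. The
serving station is then within `w` and nearest among all stations, blocked ones included. -/
lemma Regular.serves (h : Regular w M R B U G) {y : Plane} (hyU : y ∈ U) (hy : ‖y‖ < 2 * M)
    {b : Plane × ℝ} (hb : Serves (walls G R) B y b) :
    dist y b.1 < w ∧ ∀ b' ∈ B, dist y b.1 ≤ dist y b'.1 := by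
  have hW := disjoint_ball_walls (h.users y hyU hy)
  obtain ⟨b₀, hb₀, hd⟩ := h.near y hy
  have h1 : dist y b.1 < w := (hb.2.2 b₀ hb₀ (visible_of_disjoint hW hd)).trans_lt hd
  refine ⟨h1, fun b' hb' => ?_⟩
  by_cases hw : dist y b'.1 < w
  · exact hb.2.2 b' hb' (visible_of_disjoint hW hw)
  · linarith

/-- The origin is served by the nearest station only. -/
lemma Regular.serves_zero_iff (h : Regular w M R B U G) {b₀ : Plane × ℝ} (hb₀ : b₀ ∈ B)
    (hw : ‖b₀.1‖ < w) (hmin : ∀ b ∈ B, b ≠ b₀ → ‖b₀.1‖ < ‖b.1‖) (b : Plane × ℝ) :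
    Serves (walls G R) B 0 b ↔ b = b₀ := by
  have hv : Visible (walls G R) 0 b₀.1 :=
    visible_of_disjoint (disjoint_ball_walls h.origin) (by rwa [dist_zero_left])
  constructor
  · intro hb
    by_contra hne
    have h1 := hb.2.2 b₀ hb₀ hv
    rw [dist_zero_left, dist_zero_left] at h1
    exact absurd (hmin b hb.1 hne) (not_lt.mpr h1)
  · rintro rfl
    refine ⟨hb₀, hv, fun b' hb' _ => ?_⟩
    rw [dist_zero_left, dist_zero_left]
    by_cases hbb : b' = b
    · rw [hbb]
    · exact (hmin b' hb' hbb).le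

lemma encard_biUnion_le {ι X : Type*} (I : Finset ι) (s : ι → Set X) :
    (⋃ i ∈ I, s i).encard ≤ ∑ i ∈ I, (s i).encard := by
  classical
  induction I using Finset.induction_on with
  | empty => simp
  | insert a t ha ih =>
    rw [Finset.sum_insert ha, Finset.set_biUnion_insert]
    exact (Set.encard_union_le _ _).trans (add_le_add le_rfl ih)

/-- The summand of `crowdSum` for a single station. -/
def crowdGain (θ h : ℝ) (N : ℕ) (I : Finset (ℤ × ℤ)) (B : Set (Plane × ℝ)) (U : Set Plane)
    (b : Plane × ℝ) : ℝ≥0∞ :=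
  ∑ i ∈ I, (count U (gridCell (h / 2) i) : ℝ≥0∞) * ∑ k ∈ Finset.range N,
    {ξ | count ξ (Metric.ball (gridPoint (h / 2) i) ((k - 2) * h) ×ˢ univ) = 0}.indicator 1 B *
      (annulus (gridPoint (h / 2) i) h k).indicator
        ((lobeSet θ h (gridPoint (h / 2) i)).indicator 1) b

lemma crowdSum_eq (θ h : ℝ) (N : ℕ) (I : Finset (ℤ × ℤ)) (g : Plane × ℝ → ℝ≥0∞)
    (B : Set (Plane × ℝ)) (U : Set Plane) :
    crowdSum θ h N I g B U = pointSum B fun b => crowdGain θ h N I B U b * g b := by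
  have e : ∀ b : Plane × ℝ, ∀ i : ℤ × ℤ, ∀ k : ℕ, (annulus (gridPoint (h / 2) i) h k).indicator
      ((lobeSet θ h (gridPoint (h / 2) i)).indicator g) b =
      (annulus (gridPoint (h / 2) i) h k).indicator
        ((lobeSet θ h (gridPoint (h / 2) i)).indicator 1) b * g b := by
    intro b i k
    by_cases h1 : b ∈ annulus (gridPoint (h / 2) i) h k <;>
      by_cases h2 : b ∈ lobeSet θ h (gridPoint (h / 2) i) <;> simp [h1, h2]
  simp only [crowdSum, cellSum, pointSum, crowdGain, e, Finset.sum_mul, Finset.mul_sum, mul_assoc]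
  rw [Summable.tsum_finsetSum fun i _ => ENNReal.summable]
  refine Finset.sum_congr rfl fun i _ => ?_
  rw [Summable.tsum_finsetSum fun i _ => ENNReal.summable]
  refine Finset.sum_congr rfl fun k _ => ?_
  rw [ENNReal.tsum_mul_left, ENNReal.tsum_mul_left]

lemma crowdSum_add (θ h : ℝ) (N : ℕ) (I : Finset (ℤ × ℤ)) (f g : Plane × ℝ → ℝ≥0∞)
    (B : Set (Plane × ℝ)) (U : Set Plane) :
    crowdSum θ h N I (fun b => f b + g b) B U =
      crowdSum θ h N I f B U + crowdSum θ h N I g B U := by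
  simp only [crowdSum_eq, mul_add, pointSum_add]

lemma crowdSum_sum_mul (θ h : ℝ) (N : ℕ) (I : Finset (ℤ × ℤ)) {ι : Type*} (t : Finset ι)
    (a : ι → ℝ≥0∞) (g : ι → Plane × ℝ → ℝ≥0∞) (B : Set (Plane × ℝ)) (U : Set Plane) :
    crowdSum θ h N I (fun b => ∑ j ∈ t, a j * g j b) B U =
      ∑ j ∈ t, a j * crowdSum θ h N I (g j) B U := by
  simp only [crowdSum_eq, pointSum, Finset.mul_sum]
  rw [Summable.tsum_finsetSum fun i _ => ENNReal.summable]
  refine Finset.sum_congr rfl fun j _ => ?_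
  rw [← ENNReal.tsum_mul_left]
  exact tsum_congr fun b => by ring

/-- The gain of an interferer counts users in the grid cells. -/
lemma Regular.gain_le {θ h : ℝ} {N : ℕ} (H : Regular w M R B U G) (hM : 0 ≤ M)
    (hθ : θ < 2 * Real.pi) (hh : 0 < h) (hN : w + h ≤ N * h)
    {b : Plane × ℝ} (hb : b ∈ interferers (walls G R) B (insert 0 U)) :
    (gain θ (walls G R) B (insert 0 U) b : ℝ≥0∞) ≤
      crowdGain θ h N (gridIndex (h / 2) (2 * M)) B U b := by
  obtain ⟨hbB, -, hvis, hns⟩ := hb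
  set S : Set Plane := {y ∈ servedUsers (walls G R) B (insert 0 U) b |
    InnerProductGeometry.angle (y - b.1) (0 - b.1) ≤ θ / 2} with hS
  -- The origin is excluded because an interferer does not serve it. Any other user is joined to the
  -- origin by two lines of sight, each shorter than `M`.
  have key : ∀ y ∈ S, y ∈ U ∧ ‖y‖ < 2 * M ∧ dist y b.1 < w ∧ ∀ b' ∈ B, dist y b.1 ≤ dist y b'.1 := by
    rintro y ⟨⟨hy, hserves⟩, -⟩
    have hyU : y ∈ U := by
      rcases hy with rfl | hy
      · exact absurd hserves hns
      · exact hy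
    have hyM := H.norm_user_lt hM hvis hserves.2.1
    exact ⟨hyU, hyM, H.serves hyU hyM hserves⟩
  have h1 : S ⊆ ⋃ i ∈ gridIndex (h / 2) (2 * M), S ∩ gridCell (h / 2) i := by
    intro y hy
    obtain ⟨i, hi, hyi⟩ := exists_mem_gridCell (r := h / 2) (by positivity) (key y hy).2.1.le
    exact mem_biUnion hi ⟨hy, hyi⟩
  have h2 := (encard_le_encard h1).trans (encard_biUnion_le _ _)
  have h3 : (gain θ (walls G R) B (insert 0 U) b : ℝ≥0∞) ≤
      ∑ i ∈ gridIndex (h / 2) (2 * M), ((S ∩ gridCell (h / 2) i).encard : ℝ≥0∞) := by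
    have := ENat.toENNReal_le.mpr h2
    refine this.trans (le_of_eq ?_)
    exact map_sum ENat.toENNRealRingHom _ _
  refine h3.trans (Finset.sum_le_sum fun i _ => ?_)
  rcases (S ∩ gridCell (h / 2) i).eq_empty_or_nonempty with he | ⟨y, hyS, hyi⟩
  · simp [he]
  have hsub : (S ∩ gridCell (h / 2) i).encard ≤ count U (gridCell (h / 2) i) :=
    encard_le_encard (inter_subset_inter_left _ fun y hy => (key y hy).1)
  refine (ENat.toENNReal_le.mpr hsub).trans (le_mul_of_one_le_right' ?_)
  set z := gridPoint (h / 2) i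
  have hyz : dist y z ≤ h := (dist_gridPoint_le (by positivity) hyi).trans (by linarith)
  obtain ⟨-, -, hyw, hmin⟩ := key y hyS
  set k := ⌊dist b.1 z / h⌋₊
  have hk1 : k * h ≤ dist b.1 z := by
    rw [← le_div_iff₀ hh]; exact Nat.floor_le (by positivity)
  have hk2 : dist b.1 z < (k + 1) * h := by
    rw [← div_lt_iff₀ hh]; exact Nat.lt_floor_add_one _
  have htri := dist_triangle_left b.1 z y
  have hkN : k ∈ Finset.range N := by
    rw [Finset.mem_range]
    have : (k : ℝ) * h < N * h := by linarith
    exact_mod_cast lt_of_mul_lt_mul_right this hh.le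
  refine le_trans (le_of_eq ?_) (Finset.single_le_sum (fun _ _ => zero_le) hkN)
  -- No station is closer to `y` than `b`, and `y` is within `h` of `z`; two triangle inequalities
  -- cost 2h, which explains the radius (k - 2)h.
  have hvoid : B ∈ {ξ | count ξ (Metric.ball z ((k - 2) * h) ×ˢ univ) = 0} := by
    refine encard_eq_zero.mpr (eq_empty_of_forall_notMem fun b' hb' => ?_)
    have e1 := hmin b' hb'.1
    have e2 : dist b'.1 z < (k - 2) * h := hb'.2.1
    have e3 := dist_triangle_right y b'.1 z
    linarith
  have hann : b ∈ annulus z h k := ⟨hk1, hk2⟩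
  have hlobe : b ∈ lobeSet θ h z := by
    have hang : y - b.1 ∈ lobe θ (-b.1) := by
      have := mem_lobe_of_angle_le hθ hyS.2
      rwa [zero_sub] at this
    refine Metric.mem_cthickening_of_dist_le (z - b.1) (y - b.1) h _ hang ?_
    rw [dist_sub_right, dist_comm]
    exact hyz
  rw [indicator_of_mem hvoid, indicator_of_mem hann, indicator_of_mem hlobe]
  simp

/-- A bound for the interference. -/
lemma Regular.interference_le {θ β h : ℝ} {N : ℕ} (H : Regular w M R B U G) (hM : 0 ≤ M)
    (hθ : θ < 2 * Real.pi) (hh : 0 < h) (hN : w + h ≤ N * h) {g : Plane × ℝ → ℝ≥0∞}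
    (hg : ∀ b ∈ B, Visible (walls G R) 0 b.1 → receivedPower β b ≤ g b) :
    interference θ β (walls G R) B (insert 0 U) ≤
      crowdSum θ h N (gridIndex (h / 2) (2 * M)) g B U := by
  rw [crowdSum_eq, interference, pointSum]
  refine le_trans (ENNReal.tsum_le_tsum fun b => mul_le_mul' (H.gain_le hM hθ hh hN b.2)
    (hg b b.2.1 b.2.2.2.1)) ?_
  exact ENNReal.tsum_mono_subtype (fun b => crowdGain θ h N (gridIndex (h / 2) (2 * M)) B U b * g b)
    fun b hb => hb.1

end Regular

/-! ### Pointwise lower bounds for log(1 + SINR). -/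

section Sinr

open Set

/-- The logarithm of the power received from a station, as a function of its depth and its fading
power, up to an additive constant. -/
def logPower (β : ℝ) (p : ℝ × ℝ) : ℝ := Real.log p.2 - β / 2 * Real.log p.1

@[fun_prop]
lemma measurable_logPower (β : ℝ) : Measurable (logPower β) := by
  unfold logPower; fun_prop

/-- The positive part of the logarithmic power, truncated at `L`. -/
def logGain (β L : ℝ) (p : ℝ × ℝ) : ℝ≥0∞ := ENNReal.ofReal (min (logPower β p) L)

/-- The negative part of the logarithmic power. -/
def logLoss (β : ℝ) (p : ℝ × ℝ) : ℝ≥0∞ := ENNReal.ofReal (-logPower β p)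

@[fun_prop]
lemma measurable_logGain (β L : ℝ) : Measurable (logGain β L) := by
  unfold logGain; fun_prop

@[fun_prop]
lemma measurable_logLoss (β : ℝ) : Measurable (logLoss β) := by
  unfold logLoss
  exact (measurable_logPower β).fun_neg.ennreal_ofReal

/-- The constant part of the logarithmic power-to-noise ratio. -/
def logRatio (β σ lm : ℝ) : ℝ := β / 2 * Real.log (Real.pi * lm) - Real.log (σ ^ 2)

/-- The logarithm of the SINR splits exactly into these terms; the only loss is log s ≤ log(1 + s).
-/
lemma logRatio_add_logPower_le {β σ lm x η s I : ℝ} (hσ : 0 < σ) (hlm : 0 < lm) (hx : 0 < x)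
    (hη : 0 < η) (hI : 0 ≤ I) (hs : s = η * x ^ (-β) / (I + σ ^ 2)) :
    logRatio β σ lm + logPower β (lm * (Real.pi * x ^ 2), η) ≤
      Real.log (1 + s) + Real.log (1 + I / σ ^ 2) := by
  have hpi := Real.pi_pos
  have hσ2 : 0 < σ ^ 2 := by positivity
  have hxb : 0 < x ^ (-β) := Real.rpow_pos_of_pos hx _
  have hs0 : 0 < s := by rw [hs]; positivity
  have h1 : Real.log s ≤ Real.log (1 + s) := Real.log_le_log hs0 (by linarith)
  have h2 : Real.log s = Real.log η - β * Real.log x - Real.log (I + σ ^ 2) := by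
    rw [hs, Real.log_div (by positivity) (by positivity), Real.log_mul (by positivity) (by positivity),
      Real.log_rpow hx]
    ring
  have h3 : Real.log (I + σ ^ 2) = Real.log (σ ^ 2) + Real.log (1 + I / σ ^ 2) := by
    rw [← Real.log_mul (by positivity) (by positivity)]
    congr 1
    field_simp
    ring
  have h4 : Real.log (lm * (Real.pi * x ^ 2)) = Real.log (Real.pi * lm) + 2 * Real.log x := by
    rw [← mul_assoc, mul_comm lm, Real.log_mul (by positivity) (by positivity), Real.log_pow]
    norm_num
  simp only [logRatio, logPower, h4]
  linarith

variable {w M R : ℝ} {B : Set (Plane × ℝ)} {U G : Set Plane}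

/-- All fading powers are positive and no station is at the origin. -/
def Proper (B : Set (Plane × ℝ)) : Prop := ∀ b ∈ B, b.1 ≠ 0 ∧ 0 < b.2

/-- A lower bound for the spectral efficiency in a regular configuration. -/
lemma Regular.logRatio_add_le {θ β σ lm δ : ℝ} {K k : ℕ} (H : Regular w M R B U G) (hσ : 0 < σ)
    (hlm : 0 < lm) (hw : 0 < w) (hδ : 0 < δ) (hT : K * δ ≤ lm * (Real.pi * w ^ 2)) (hk : k < K)
    (hn : NearestIn lm δ B k) (hB : Proper B) (hc : 0 ≤ logRatio β σ lm) {X : ℝ≥0∞}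
    (hX : X ≠ ∞) (hI : interference θ β (walls G R) B (insert 0 U) ≤ X) (L : ℝ) :
    ENNReal.ofReal (logRatio β σ lm) + nearestValue lm δ K (logGain β L) B ≤
      ENNReal.ofReal (Real.log (1 + (sinrWith θ β σ (walls G R) B (insert 0 U)).toReal)) +
        nearestValue lm δ K (logLoss β) B +
        ENNReal.ofReal (Real.log (1 + X.toReal / σ ^ 2)) := by
  obtain ⟨b, hbB, hbT, hmin, hval⟩ := hn.exists_nearest hδ hk
  rw [hval, hval]
  have hpi := Real.pi_pos
  obtain ⟨hb0, hη⟩ := hB b hbB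
  have hx : 0 < ‖b.1‖ := norm_pos_iff.mpr hb0
  have hlt : ∀ {r s : ℝ}, 0 ≤ s → lm * (Real.pi * r ^ 2) < lm * (Real.pi * s ^ 2) → r < s := by
    intro r s hs h
    have h1 := lt_of_mul_lt_mul_left (lt_of_mul_lt_mul_left h hlm.le) hpi.le
    exact lt_of_pow_lt_pow_left₀ 2 hs h1
  have hserv := H.serves_zero_iff hbB (hlt hw.le (hbT.trans_le hT))
    (fun b' hb' hne => hlt (norm_nonneg _) (hmin b' hb' hne))
  have hsig : signal β (walls G R) B = receivedPower β b := by
    have : {b : Plane × ℝ | Serves (walls G R) B 0 b} = {b} := by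
      ext b'
      exact hserv b'
    rw [signal, this, tsum_singleton b (receivedPower β)]
  have hIfin := ne_top_of_le_ne_top hX hI
  have hs : (sinrWith θ β σ (walls G R) B (insert 0 U)).toReal = b.2 * ‖b.1‖ ^ (-β) /
      ((interference θ β (walls G R) B (insert 0 U)).toReal + σ ^ 2) := by
    rw [sinrWith, hsig, ENNReal.toReal_div, ENNReal.toReal_add hIfin ENNReal.ofReal_ne_top,
      ENNReal.toReal_ofReal (by positivity), receivedPower, dist_zero_left,
      ENNReal.toReal_ofReal (by positivity)]
  have h1 := logRatio_add_logPower_le (lm := lm) hσ hlm hx hη ENNReal.toReal_nonneg hs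
  have h2 : Real.log (1 + (interference θ β (walls G R) B (insert 0 U)).toReal / σ ^ 2) ≤
      Real.log (1 + X.toReal / σ ^ 2) := by
    have := ENNReal.toReal_mono hX hI
    gcongr
  change ENNReal.ofReal (logRatio β σ lm) + ENNReal.ofReal (min (logPower β (depth lm b, b.2)) L) ≤ _
  change logRatio β σ lm + logPower β (depth lm b, b.2) ≤ _ at h1
  refine le_trans (add_le_add le_rfl (ENNReal.ofReal_le_ofReal (min_le_left _ _))) ?_
  -- In `ℝ≥0∞` the logarithmic power must enter as a gain on the left or as a loss on the right,
  -- according to its sign.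
  rcases le_total 0 (logPower β (depth lm b, b.2)) with h3 | h3
  · rw [← ENNReal.ofReal_add hc h3, add_right_comm]
    refine le_trans (ENNReal.ofReal_le_ofReal (h1.trans (add_le_add le_rfl h2))) ?_
    exact ENNReal.ofReal_add_le.trans le_self_add
  · rw [ENNReal.ofReal_eq_zero.mpr h3, add_zero, logLoss]
    refine le_trans (ENNReal.ofReal_le_ofReal (q := Real.log
      (1 + (sinrWith θ β σ (walls G R) B (insert 0 U)).toReal) + -logPower β (depth lm b, b.2) +
      Real.log (1 + X.toReal / σ ^ 2)) (by linarith)) ?_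
    exact ENNReal.ofReal_add_le.trans (add_le_add ENNReal.ofReal_add_le le_rfl)

/-- From 1 + x + y ≤ (1 + x) exp(y): the second part of the interference enters only through its
mean. -/
lemma ofReal_log_add_le {σ : ℝ} (hσ : 0 < σ) {X Y : ℝ≥0∞} (hX : X ≠ ∞) (hY : Y ≠ ∞) :
    ENNReal.ofReal (Real.log (1 + (X + Y).toReal / σ ^ 2)) ≤
      ENNReal.ofReal (Real.log (1 + X.toReal / σ ^ 2)) + Y / ENNReal.ofReal (σ ^ 2) := by
  have hσ2 : 0 < σ ^ 2 := by positivity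
  have hx := ENNReal.toReal_nonneg (a := X)
  have hy := ENNReal.toReal_nonneg (a := Y)
  have h1 : Y / ENNReal.ofReal (σ ^ 2) = ENNReal.ofReal (Y.toReal / σ ^ 2) := by
    rw [ENNReal.ofReal_div_of_pos hσ2, ENNReal.ofReal_toReal hY]
  rw [h1, ENNReal.toReal_add hX hY]
  refine le_trans (ENNReal.ofReal_le_ofReal ?_) ENNReal.ofReal_add_le
  have hxs : 0 ≤ X.toReal / σ ^ 2 := by positivity
  have hys : 0 ≤ Y.toReal / σ ^ 2 := by positivity
  have h2 : 1 + (X.toReal + Y.toReal) / σ ^ 2 ≤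
      (1 + X.toReal / σ ^ 2) * Real.exp (Y.toReal / σ ^ 2) := by
    have := Real.add_one_le_exp (Y.toReal / σ ^ 2)
    rw [add_div]
    nlinarith
  calc Real.log _ ≤ Real.log _ := Real.log_le_log (by positivity) h2
    _ = _ := by rw [Real.log_mul (by positivity) (by positivity), Real.log_exp]

/-- The fading power of the stations at distance in `[j + 1, j + 2)` from the origin. -/
def ringPower (j : ℕ) : Plane × ℝ → ℝ≥0∞ :=
  {b | (j : ℝ) + 1 ≤ ‖b.1‖ ∧ ‖b.1‖ < j + 2}.indicator fun b => ENNReal.ofReal b.2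

lemma measurableSet_ring (j : ℕ) :
    MeasurableSet {b : Plane × ℝ | (j : ℝ) + 1 ≤ ‖b.1‖ ∧ ‖b.1‖ < j + 2} :=
  (by fun_prop : Measurable fun b : Plane × ℝ => ‖b.1‖) (measurableSet_Ico (a := (j : ℝ) + 1))

@[fun_prop]
lemma measurable_ringPower (j : ℕ) : Measurable (ringPower j) :=
  Measurable.indicator (by fun_prop) (measurableSet_ring j)

lemma ringPower_ne_top (j : ℕ) (b : Plane × ℝ) : ringPower j b ≠ ∞ := by
  by_cases h : b ∈ {b : Plane × ℝ | (j : ℝ) + 1 ≤ ‖b.1‖ ∧ ‖b.1‖ < j + 2} <;> simp [ringPower, h]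

lemma lintegral_ofReal_expMeasure : ∫⁻ x, ENNReal.ofReal x ∂expMeasure 1 = 1 := by
  rw [lintegral_expMeasure (by fun_prop)]
  have h := Real.GammaIntegral_convergent (s := 2) (by norm_num)
  have h1 : ∀ x ∈ Ioi (0 : ℝ), ENNReal.ofReal (Real.exp (-x)) * ENNReal.ofReal x =
      ENNReal.ofReal (Real.exp (-x) * x ^ ((2 : ℝ) - 1)) := by
    intro x _
    rw [← ENNReal.ofReal_mul (Real.exp_pos _).le]
    norm_num
  rw [setLIntegral_congr_fun measurableSet_Ioi h1, ← ofReal_integral_eq_lintegral_ofReal h,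
    ← Real.Gamma_eq_integral (by norm_num), Real.Gamma_two, ENNReal.ofReal_one]
  filter_upwards [self_mem_ae_restrict measurableSet_Ioi] with x hx
  have : (0 : ℝ) < x := hx
  positivity

lemma lintegral_ringPower_le (j : ℕ) :
    ∫⁻ b, ringPower j b ∂(volume : Measure Plane).prod (expMeasure 1) ≤
      ENNReal.ofReal (Real.pi * (j + 2) ^ 2) := by
  have h1 : ∀ b : Plane × ℝ, ringPower j b ≤
      (Metric.ball (0 : Plane) (j + 2)).indicator 1 b.1 * ENNReal.ofReal b.2 := by
    intro b
    by_cases hb : b ∈ {b : Plane × ℝ | (j : ℝ) + 1 ≤ ‖b.1‖ ∧ ‖b.1‖ < j + 2}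
    · rw [ringPower, indicator_of_mem hb, indicator_of_mem (by simpa using hb.2), Pi.one_apply,
        one_mul]
    · rw [ringPower, indicator_of_notMem hb]
      exact zero_le
  refine (lintegral_mono h1).trans ?_
  rw [lintegral_prod_mul (measurable_indicator_one Metric.isOpen_ball.measurableSet).aemeasurable
    (by fun_prop), lintegral_ofReal_expMeasure, mul_one,
    lintegral_indicator_one Metric.isOpen_ball.measurableSet, EuclideanSpace.volume_ball_fin_two,
    ← ENNReal.ofReal_pow (by positivity), ← ENNReal.ofReal_mul (by positivity), mul_comm]

/-- The origin sees from inside a room to distance `j + 1`, on the net. -/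
def SeesInside (R : ℝ) (j : ℕ) (G : Set Plane) : Prop :=
  NetEvent R (j + 1) (3 * R / 2) (5 * (j + 1)) {0}ᶜ G

/-- The line of sight stays in the indoor region. A chain of 5(j + 1) points fits into length j + 1
because 16(j + 1)R < j + 1. -/
lemma seesInside_of_visible (hR : 0 < R) (hR' : R < 1 / 16) (h0 : (0 : Plane) ∈ indoor G R)
    {x : Plane} (hx : Visible (walls G R) 0 x) {j : ℕ} (hj : (j : ℝ) + 1 ≤ ‖x‖) :
    SeesInside R j G := by
  have hin : ∀ z ∈ segment ℝ 0 x, z ∈ indoor G R :=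
    (segment_subset_or_disjoint fun z hz => hx.notMem hz).resolve_right
      fun h => h 0 (left_mem_segment ℝ 0 x) h0
  obtain ⟨q, hq, hs⟩ := exists_segment_dist_eq (p := 0) (q := x) (L := (j : ℝ) + 1)
    (by positivity) (by rwa [dist_zero_left])
  refine netEvent_of_inside hR (p := 0) (q := q) (by simp; positivity) ?_ ?_
    fun z hz => hin z (hs hz)
  · rw [dist_zero_left] at hq; exact hq.le
  · rw [hq]
    push_cast
    have hj0 : (0 : ℝ) ≤ j := by positivity
    nlinarith

/-- A bound for the interference indoors. -/
lemma Regular.interference_two_le {α θ h : ℝ} {N J : ℕ} (H : Regular w M R B U G) (hM : 0 ≤ M)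
    (hα : 2 < α) (hθ : θ < 2 * Real.pi) (hh : 0 < h) (hN : w + h ≤ N * h) (hR : 0 < R)
    (hR' : R < 1 / 16) (hJ : M ≤ J) (h0 : (0 : Plane) ∈ indoor G R) :
    interference θ 2 (walls G R) B (insert 0 U) ≤
      crowdSum θ h N (gridIndex (h / 2) (2 * M)) (receivedPower α) B U +
      ∑ j ∈ Finset.range J, {G | SeesInside R j G}.indicator 1 G *
        crowdSum θ h N (gridIndex (h / 2) (2 * M)) (ringPower j) B U := by
  rw [← crowdSum_sum_mul, ← crowdSum_add]
  refine H.interference_le hM hθ hh hN fun b hb hv => ?_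
  -- Within distance 1 the exponent 2 gives less power than α, so the outdoor bound covers it.
  -- Beyond it the path loss is at most 1 and only the fading power is kept, ring by ring.
  rcases lt_or_ge ‖b.1‖ 1 with h1 | h1
  · refine le_trans ?_ le_self_add
    rw [receivedPower, receivedPower, dist_zero_left]
    rcases (norm_nonneg b.1).eq_or_lt with h2 | h2
    -- At distance 0 both powers are 0 by the convention for a negative exponent.
    · rw [← h2, Real.zero_rpow (by norm_num), Real.zero_rpow (by linarith)]
    · have h3 : ‖b.1‖ ^ (-2 : ℝ) ≤ ‖b.1‖ ^ (-α) :=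
        Real.rpow_le_rpow_of_exponent_ge h2 h1.le (by linarith)
      rcases le_total 0 b.2 with h4 | h4
      · exact ENNReal.ofReal_le_ofReal (mul_le_mul_of_nonneg_left h3 h4)
      · rw [ENNReal.ofReal_eq_zero.mpr (mul_nonpos_of_nonpos_of_nonneg h4 (by positivity))]
        exact zero_le
  · refine le_trans ?_ le_add_self
    have hf1 : 1 ≤ ⌊‖b.1‖⌋₊ := by rwa [Nat.one_le_floor_iff]
    obtain ⟨j, hj⟩ := Nat.exists_eq_add_of_le' hf1
    have hj1 : (j : ℝ) + 1 ≤ ‖b.1‖ := by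
      have := Nat.floor_le (norm_nonneg b.1)
      rw [hj] at this
      exact_mod_cast this
    have hj2 : ‖b.1‖ < j + 2 := by
      have := Nat.lt_floor_add_one ‖b.1‖
      rw [hj] at this
      push_cast at this
      linarith
    have hjJ : j ∈ Finset.range J := by
      rw [Finset.mem_range]
      have := H.norm_lt hM hv
      have : (j : ℝ) < J := by linarith
      exact_mod_cast this
    refine le_trans ?_ (Finset.single_le_sum (fun _ _ => zero_le) hjJ)
    rw [indicator_of_mem (show G ∈ {G | SeesInside R j G} from
      seesInside_of_visible hR hR' h0 hv hj1), Pi.one_apply, one_mul, ringPower,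
      indicator_of_mem (show b ∈ {b : Plane × ℝ | (j : ℝ) + 1 ≤ ‖b.1‖ ∧ ‖b.1‖ < j + 2} from
        ⟨hj1, hj2⟩), receivedPower, dist_zero_left]
    have h3 : ‖b.1‖ ^ (-2 : ℝ) ≤ 1 := Real.rpow_le_one_of_one_le_of_nonpos h1 (by norm_num)
    rcases le_total 0 b.2 with h4 | h4
    · exact ENNReal.ofReal_le_ofReal (mul_le_of_le_one_right h4 h3)
    · rw [ENNReal.ofReal_eq_zero.mpr (mul_nonpos_of_nonpos_of_nonneg h4 (by positivity))]
      exact zero_le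

end Sinr

/-! ### Truncating the logarithmic gain. -/

section Truncation

open Set

lemma integrable_logPower (β : ℝ) :
    Integrable (logPower β) ((expMeasure 1).prod (expMeasure 1)) :=
  (integrable_log_expMeasure.comp_snd _).sub ((integrable_log_expMeasure.comp_fst _).const_mul _)

lemma integral_logPower (β : ℝ) :
    ∫ p, logPower β p ∂(expMeasure 1).prod (expMeasure 1) = (1 - β / 2) * meanLogExp := by
  have h1 : ∫ p : ℝ × ℝ, Real.log p.2 ∂(expMeasure 1).prod (expMeasure 1) = meanLogExp := by
    rw [integral_fun_snd]; simp [meanLogExp]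
  have h2 : ∫ p : ℝ × ℝ, β / 2 * Real.log p.1 ∂(expMeasure 1).prod (expMeasure 1) =
      β / 2 * meanLogExp := by
    rw [integral_const_mul, integral_fun_fst]; simp [meanLogExp]
  unfold logPower
  rw [integral_sub (integrable_log_expMeasure.comp_snd _)
    ((integrable_log_expMeasure.comp_fst _).const_mul _), h1, h2]
  ring

/-- The mean of the negative part of the logarithmic power of the nearest station. -/
def meanLoss (β : ℝ) : ℝ := (∫⁻ p, logLoss β p ∂(expMeasure 1).prod (expMeasure 1)).toReal

lemma lintegral_logLoss (β : ℝ) :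
    ∫⁻ p, logLoss β p ∂(expMeasure 1).prod (expMeasure 1) = ENNReal.ofReal (meanLoss β) := by
  rw [meanLoss, ENNReal.ofReal_toReal]
  exact (integrable_logPower β).neg.lintegral_lt_top.ne

lemma meanLoss_nonneg (β : ℝ) : 0 ≤ meanLoss β := ENNReal.toReal_nonneg

/-- The mean of the positive part is `meanLoss β` plus the mean, and monotone convergence removes
the truncations in depth and size. The cap makes the gain bounded on irregular configurations. -/
lemma exists_truncation (β : ℝ) {ε : ℝ} (hε : 0 < ε) : ∃ L : ℝ, 0 < L ∧ ∀ T L', L ≤ T → L ≤ L' →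
    ENNReal.ofReal (meanLoss β + (1 - β / 2) * meanLogExp - ε) ≤
      ∫⁻ p in {p | p.1 < T}, logGain β L' p ∂(expMeasure 1).prod (expMeasure 1) := by
  let f : ℕ → ℝ × ℝ → ℝ≥0∞ := fun n => {p : ℝ × ℝ | p.1 < n}.indicator (logGain β n)
  have hs : ∀ n : ℝ, MeasurableSet {p : ℝ × ℝ | p.1 < n} := fun n =>
    measurableSet_lt measurable_fst measurable_const
  have hmono : ∀ p, Monotone fun n => f n p := by
    intro p m n hmn
    have hmn' : (m : ℝ) ≤ n := by exact_mod_cast hmn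
    by_cases hp : p.1 < m
    · have hp' : p.1 < n := hp.trans_le hmn'
      simp only [f]
      rw [indicator_of_mem (by exact hp), indicator_of_mem (by exact hp')]
      exact ENNReal.ofReal_le_ofReal (min_le_min le_rfl hmn')
    · simp only [f]
      rw [indicator_of_notMem (by exact hp)]
      exact zero_le
  have hlim : ∀ p, Filter.Tendsto (fun n => f n p) Filter.atTop
      (nhds (ENNReal.ofReal (logPower β p))) := by
    intro p
    refine tendsto_const_nhds.congr' ?_
    filter_upwards [Filter.eventually_gt_atTop (⌈p.1⌉₊), Filter.eventually_gt_atTop (⌈logPower β p⌉₊)]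
      with n h1 h2
    have e1 : p.1 < n := (Nat.le_ceil _).trans_lt (by exact_mod_cast h1)
    have e2 : logPower β p < n := (Nat.le_ceil _).trans_lt (by exact_mod_cast h2)
    simp only [f]
    rw [indicator_of_mem (by exact e1), logGain, min_eq_left e2.le]
  have hconv := lintegral_tendsto_of_tendsto_of_monotone
    (μ := (expMeasure 1).prod (expMeasure 1)) (f := f)
    (fun n => ((measurable_logGain β n).indicator (hs n)).aemeasurable)
    (Filter.Eventually.of_forall hmono) (Filter.Eventually.of_forall hlim)
  have hI := integral_eq_lintegral_pos_part_sub_lintegral_neg_part (integrable_logPower β)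
  rw [integral_logPower] at hI
  have hfin : ∫⁻ p, ENNReal.ofReal (logPower β p) ∂(expMeasure 1).prod (expMeasure 1) ≠ ∞ :=
    (integrable_logPower β).lintegral_lt_top.ne
  have hkey : ENNReal.ofReal (meanLoss β + (1 - β / 2) * meanLogExp) =
      ∫⁻ p, ENNReal.ofReal (logPower β p) ∂(expMeasure 1).prod (expMeasure 1) := by
    rw [← ENNReal.ofReal_toReal hfin]
    congr 1
    rw [hI]
    simp only [meanLoss, logLoss]
    ring
  have hex : ∃ n : ℕ, 1 ≤ n ∧ ENNReal.ofReal (meanLoss β + (1 - β / 2) * meanLogExp - ε) ≤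
      ∫⁻ p, f n p ∂(expMeasure 1).prod (expMeasure 1) := by
    rcases le_or_gt (meanLoss β + (1 - β / 2) * meanLogExp) 0 with h0 | h0
    · exact ⟨1, le_rfl, by rw [ENNReal.ofReal_eq_zero.mpr (by linarith)]; exact zero_le⟩
    · have hlt : ENNReal.ofReal (meanLoss β + (1 - β / 2) * meanLogExp - ε) <
          ∫⁻ p, ENNReal.ofReal (logPower β p) ∂(expMeasure 1).prod (expMeasure 1) := by
        rw [← hkey]
        exact (ENNReal.ofReal_lt_ofReal_iff h0).mpr (by linarith)
      obtain ⟨n, h1, h2⟩ := ((hconv.eventually (lt_mem_nhds hlt)).and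
        (Filter.eventually_ge_atTop 1)).exists
      exact ⟨n, h2, h1.le⟩
  obtain ⟨n, hn1, hn⟩ := hex
  refine ⟨n, by exact_mod_cast hn1, fun T L' hT hL' => hn.trans ?_⟩
  rw [← lintegral_indicator (hs T)]
  refine lintegral_mono fun p => ?_
  by_cases hp : p.1 < n
  · simp only [f]
    rw [indicator_of_mem (by exact hp), indicator_of_mem (show p ∈ {p : ℝ × ℝ | p.1 < T} from
      hp.trans_le hT)]
    exact ENNReal.ofReal_le_ofReal (min_le_min le_rfl hL')
  · simp only [f]
    rw [indicator_of_notMem (by exact hp)]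
    exact zero_le

lemma nearestValue_logGain_le {lm δ β L : ℝ} (hδ : 0 < δ) (K : ℕ) (ξ : Set (Plane × ℝ)) :
    nearestValue lm δ K (logGain β L) ξ ≤ ENNReal.ofReal L := by
  by_cases h : ∃ k < K, NearestIn lm δ ξ k
  · obtain ⟨k, hk, hn⟩ := h
    obtain ⟨b, _, _, _, hb⟩ := hn.exists_nearest hδ hk
    rw [hb]
    exact ENNReal.ofReal_le_ofReal (min_le_right _ _)
  · rw [nearestValue_of_not _ h]
    exact zero_le

variable {Ω : Type*} {Φ : Ω → Set (Plane × ℝ)} [MeasurableSpace Ω] {P : Measure Ω}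
  {lm : ℝ}

/-- The discretisation costs a factor exp(-δ) ≥ 1 - δ, and `a ≤ L` bounds the loss by Lδ. -/
lemma ofReal_le_lintegral_logGain (hΦ : IsPoissonProcess P Φ (stationMeasure lm)) (hlm : 0 < lm)
    {β L δ a : ℝ} (hL : 0 ≤ L) (hδ : 0 < δ) (K : ℕ)
    (h : ENNReal.ofReal a ≤ ∫⁻ p in {p | p.1 < K * δ}, logGain β L p
      ∂(expMeasure 1).prod (expMeasure 1)) :
    ENNReal.ofReal (a - L * δ) ≤ ∫⁻ ω, nearestValue lm δ K (logGain β L) (Φ ω) ∂P := by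
  refine le_trans ?_ (le_lintegral_nearestValue hΦ hlm hδ K (measurable_logGain β L))
  have haL : ENNReal.ofReal a ≤ ENNReal.ofReal L := by
    refine h.trans ((lintegral_mono (g := fun _ => ENNReal.ofReal L) fun p =>
      ENNReal.ofReal_le_ofReal (min_le_right _ _)).trans ?_)
    rw [lintegral_const, Measure.restrict_apply_univ]
    exact mul_le_of_le_one_right' prob_le_one
  have haL' : a ≤ L := by
    by_contra! hlt
    exact absurd haL (not_le.mpr ((ENNReal.ofReal_lt_ofReal_iff (hL.trans_lt hlt)).mpr hlt))
  rcases le_or_gt a 0 with ha | ha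
  · rw [ENNReal.ofReal_eq_zero.mpr (by nlinarith)]
    exact zero_le
  refine le_trans ?_ (mul_le_mul_right h _)
  rw [← ENNReal.ofReal_mul (Real.exp_pos _).le]
  refine ENNReal.ofReal_le_ofReal ?_
  have := Real.add_one_le_exp (-δ)
  nlinarith

lemma IsPoissonProcess.ae_proper (hΦ : IsPoissonProcess P Φ (stationMeasure lm)) :
    ∀ᵐ ω ∂P, Proper (Φ ω) := by
  have hs : MeasurableSet ({0} ×ˢ univ ∪ univ ×ˢ Iic 0 : Set (Plane × ℝ)) :=
    ((measurableSet_singleton _).prod MeasurableSet.univ).union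
      (MeasurableSet.univ.prod measurableSet_Iic)
  have h0 : expMeasure 1 (Iic 0) = 0 := by
    rw [measure_eq_zero_iff_ae_notMem]
    filter_upwards [ae_expMeasure_pos] with x hx
    exact fun h => absurd hx (_root_.not_lt.mpr h)
  have hz : stationMeasure lm ({0} ×ˢ univ ∪ univ ×ˢ Iic 0) = 0 := by
    refine measure_union_null ?_ ?_
    · rw [stationMeasure_prod_univ]; simp
    · rw [stationMeasure, Measure.prod_prod, h0, mul_zero]
  filter_upwards [hΦ.ae_count_eq_zero hs hz] with ω hω b hb
  have hω' := encard_eq_zero.mp hω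
  constructor
  · intro h
    exact notMem_empty b (hω' ▸ ⟨hb, Or.inl ⟨h, mem_univ _⟩⟩)
  · by_contra! h
    exact notMem_empty b (hω' ▸ ⟨hb, Or.inr ⟨mem_univ _, h⟩⟩)

end Truncation

/-! ### Integrating the pointwise bounds over the network. -/

section Assembly

open Set

lemma lintegral_indicator_mul_of_indep {Ω : Type*} {m₁ m₂ : MeasurableSpace Ω} [mΩ : MeasurableSpace Ω]
    {P : Measure Ω} (h₁ : m₁ ≤ mΩ) (h₂ : m₂ ≤ mΩ) (hind : Indep m₁ m₂ P) {s : Set Ω}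
    (hs : MeasurableSet[m₁] s) {f : Ω → ℝ≥0∞} (hf : Measurable[m₂] f) :
    ∫⁻ ω, s.indicator 1 ω * f ω ∂P = P s * ∫⁻ ω, f ω ∂P := by
  rw [lintegral_mul_eq_lintegral_mul_lintegral_of_independent_measurableSpace h₁ h₂ hind
    (@measurable_indicator_one _ m₁ _ hs) hf, lintegral_indicator_one (h₁ _ hs)]

variable {Ω : Type*} [mΩ : MeasurableSpace Ω] {P : Measure Ω}
  {Φm : Ω → Set (Plane × ℝ)} {Φu Φg : Ω → Set Plane} {lm lu lg : ℝ}

lemma IsNetwork.indep_rooms (hN : IsNetwork P lm lu lg Φm Φu Φg) :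
    Indep (sigmaOf Φg) (sigmaOf Φm ⊔ sigmaOf Φu) P := by
  have hle : ∀ i, ![sigmaOf Φm, sigmaOf Φu, sigmaOf Φg] i ≤ mΩ := by
    intro i
    fin_cases i
    · exact hN.stations.sigmaOf_le
    · exact hN.users.sigmaOf_le
    · exact hN.rooms.sigmaOf_le
  have h := indep_iSup_of_disjoint hle hN.indep (S := {2}) (T := {0, 1}) (by simp)
  simpa [iSup_insert] using h

lemma IsNetwork.indep_users (hN : IsNetwork P lm lu lg Φm Φu Φg) :
    Indep (sigmaOf Φu) (sigmaOf Φm) P :=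
  hN.indep.indep (i := 1) (j := 0) (by decide)

/-- The configurations that are not regular. -/
def irregular (Φm : Ω → Set (Plane × ℝ)) (Φu Φg : Ω → Set Plane) (w M R lm δ : ℝ) (K : ℕ) : Set Ω :=
  {ω | ¬ (Regular w M R (Φm ω) (Φu ω) (Φg ω) ∧ ∃ k < K, NearestIn lm δ (Φm ω) k)}

/-- The logarithmic loss due to the outdoor interference. -/
def interferenceLoss (α θ σ h : ℝ) (N : ℕ) (I : Finset (ℤ × ℤ)) (B : Set (Plane × ℝ))
    (U : Set Plane) : ℝ≥0∞ :=
  ENNReal.ofReal (Real.log (1 + (crowdSum θ h N I (receivedPower α) B U).toReal / σ ^ 2))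

/-- The interference from far stations in the room of the origin. -/
def roomInterference (θ h R : ℝ) (N J : ℕ) (I : Finset (ℤ × ℤ)) (B : Set (Plane × ℝ))
    (U G : Set Plane) : ℝ≥0∞ :=
  ∑ j ∈ Finset.range J, {G | SeesInside R j G}.indicator 1 G * crowdSum θ h N I (ringPower j) B U

/-- The lower bound in a regular configuration, for an origin that is outdoors or indoors. -/
lemma Regular.indicator_logRatio_add_le {α θ σ δ w M R h L : ℝ} {K N J : ℕ} {B : Set (Plane × ℝ)} {U G : Set Plane}
    (hα : 2 < α) (hθ : θ < 2 * Real.pi) (hσ : 0 < σ) (hlm : 0 < lm) (hw : 0 < w) (hM : 0 ≤ M)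
    (hδ : 0 < δ) (hT : K * δ ≤ lm * (Real.pi * w ^ 2)) (hh : 0 < h) (hNh : w + h ≤ N * h)
    (hR : 0 < R) (hR' : R < 1 / 16) (hJ : M ≤ J) (hc : 0 ≤ logRatio 2 σ lm)
    (hlm' : 1 ≤ Real.pi * lm) (H : Regular w M R B U G) {k : ℕ} (hk : k < K)
    (hn : NearestIn lm δ B k) (hB : Proper B)
    (hX : crowdSum θ h N (gridIndex (h / 2) (2 * M)) (receivedPower α) B U ≠ ∞)
    (hY : roomInterference θ h R N J (gridIndex (h / 2) (2 * M)) B U G ≠ ∞) :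
    {G | count G (Metric.closedBall 0 R) = 0}.indicator 1 G *
        (ENNReal.ofReal (logRatio α σ lm) + nearestValue lm δ K (logGain α L) B) +
      {G | count G (Metric.closedBall 0 R) ≠ 0}.indicator 1 G *
        (ENNReal.ofReal (logRatio 2 σ lm) + nearestValue lm δ K (logGain 2 L) B) ≤
      ENNReal.ofReal (Real.log (1 + (sinr α θ σ R B U G).toReal)) +
      ({G | count G (Metric.closedBall 0 R) = 0}.indicator 1 G * nearestValue lm δ K (logLoss α) B +
        {G | count G (Metric.closedBall 0 R) ≠ 0}.indicator 1 G *
          nearestValue lm δ K (logLoss 2) B +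
        (interferenceLoss α θ σ h N (gridIndex (h / 2) (2 * M)) B U +
        roomInterference θ h R N J (gridIndex (h / 2) (2 * M)) B U G / ENNReal.ofReal (σ ^ 2))) := by
  have hcα : 0 ≤ logRatio α σ lm := by
    refine hc.trans ?_
    have := Real.log_nonneg hlm'
    simp only [logRatio]
    nlinarith
  by_cases h0 : count G (Metric.closedBall 0 R) = 0
  · have hout : (0 : Plane) ∉ indoor G R := fun h => zero_mem_indoor.mp h h0
    rw [indicator_of_mem (by exact h0), indicator_of_notMem (by simpa using h0), Pi.one_apply,
      one_mul, one_mul, zero_mul, zero_mul, add_zero, add_zero, sinr, if_neg hout]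
    have h1 := H.logRatio_add_le hσ hlm hw hδ hT hk hn hB hcα hX
      (H.interference_le hM hθ hh hNh fun b _ _ => le_rfl) L
    refine h1.trans ?_
    rw [add_assoc]
    gcongr
    exact le_self_add
  · have hin : (0 : Plane) ∈ indoor G R := zero_mem_indoor.mpr h0
    rw [indicator_of_notMem (by exact h0), indicator_of_mem (by exact h0), Pi.one_apply,
      one_mul, one_mul, zero_mul, zero_mul, zero_add, zero_add, sinr, if_pos hin]
    have h1 := H.logRatio_add_le hσ hlm hw hδ hT hk hn hB hc (ENNReal.add_ne_top.mpr ⟨hX, hY⟩)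
      (H.interference_two_le hM hα hθ hh hNh hR hR' hJ hin) L
    refine h1.trans ?_
    rw [add_assoc]
    gcongr
    exact ofReal_log_add_le hσ hX hY

variable [IsProbabilityMeasure P]

/-- A lower bound for the spectral efficiency, as a sum of the contributions of the outdoor and
the indoor case and of the irregular configurations. -/
lemma IsNetwork.le_spectralEfficiency (hN : IsNetwork P lm lu lg Φm Φu Φg)
    {α θ σ δ w M R h L ψ τ : ℝ} {K N J : ℕ}
    (hα : 2 < α) (hθ : θ < 2 * Real.pi) (hσ : 0 < σ) (hlm : 0 < lm) (hlu : 0 < lu) (hlg : 0 < lg)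
    (hw : 0 < w) (hM : 0 ≤ M)
    (hδ : 0 < δ) (hT : K * δ ≤ lm * (Real.pi * w ^ 2)) (hh : 0 < h) (hNh : w + h ≤ N * h)
    (hR : 0 < R) (hR' : R < 1 / 16) (hJ : M ≤ J) (hc : 0 ≤ logRatio 2 σ lm)
    (hlm' : 1 ≤ Real.pi * lm) (hψ : 0 < ψ)
    (hC : ∀ e : Plane, e ≠ 0 → lobeMass lm θ h e ≤ ENNReal.ofReal ψ)
    (hτ : τ = σ ^ 2 / (lu * (ψ * (Real.pi * rho α))) ^ (α / 2)) :
    ENNReal.ofReal (Real.exp (-(lg * (Real.pi * R ^ 2)))) * (ENNReal.ofReal (logRatio α σ lm) +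
        ∫⁻ ω, nearestValue lm δ K (logGain α L) (Φm ω) ∂P) +
      ENNReal.ofReal (1 - Real.exp (-(lg * (Real.pi * R ^ 2)))) * (ENNReal.ofReal (logRatio 2 σ lm) +
        ∫⁻ ω, nearestValue lm δ K (logGain 2 L) (Φm ω) ∂P) ≤
      spectralEfficiency P α θ σ R Φm Φu Φg +
      (ENNReal.ofReal (Real.exp (-(lg * (Real.pi * R ^ 2)))) * ENNReal.ofReal (meanLoss α) +
        ENNReal.ofReal (1 - Real.exp (-(lg * (Real.pi * R ^ 2)))) * ENNReal.ofReal (meanLoss 2) +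
        (ENNReal.ofReal ((1 - α / 2) * meanLogExp - Real.log τ + τ ^ (1 / 2 : ℝ) * lossConst (α / 2)) +
        (∑ j ∈ Finset.range J, P {ω | SeesInside R j (Φg ω)} *
          (ENNReal.ofReal lu * (ENNReal.ofReal ψ * ENNReal.ofReal (Real.pi * (j + 2) ^ 2)))) /
            ENNReal.ofReal (σ ^ 2)) +
        P (irregular Φm Φu Φg w M R lm δ K) *
          (ENNReal.ofReal (logRatio α σ lm) + ENNReal.ofReal L)) := by
  set I := gridIndex (h / 2) (2 * M)
  -- Irregular configurations are not shown to be measurable; a measurable hull has the same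
  -- probability.
  set A := toMeasurable P (irregular Φm Φu Φg w M R lm δ K) with hA
  set C := ENNReal.ofReal (logRatio α σ lm) + ENNReal.ofReal L
  have hm := hN.stations
  have hu := hN.users
  have hg := hN.rooms
  have hmu : sigmaOf Φm ⊔ sigmaOf Φu ≤ mΩ := sup_le hm.sigmaOf_le hu.sigmaOf_le
  let out : Set Ω := {ω | count (Φg ω) (Metric.closedBall 0 R) = 0}
  let inn : Set Ω := {ω | count (Φg ω) (Metric.closedBall 0 R) ≠ 0}
  have hout : MeasurableSet[sigmaOf Φg] out :=
    measurable_count_sigmaOf Metric.isClosed_closedBall.measurableSet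
      (MeasurableSet.of_discrete (s := {(0 : ℕ∞)}))
  have hinn : MeasurableSet[sigmaOf Φg] inn := hout.compl
  have hout' := hg.sigmaOf_le _ hout
  have hinn' := hg.sigmaOf_le _ hinn
  have hPout : P out = ENNReal.ofReal (Real.exp (-(lg * (Real.pi * R ^ 2)))) :=
    measure_closedBall_void hg hlg 0 hR.le
  have hPinn : P inn = ENNReal.ofReal (1 - Real.exp (-(lg * (Real.pi * R ^ 2)))) :=
    measure_closedBall_nonvoid hg hlg 0 hR.le
  have hZ : ∀ u : ℝ × ℝ → ℝ≥0∞, Measurable u →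
      Measurable[sigmaOf Φm ⊔ sigmaOf Φu] fun ω => nearestValue lm δ K u (Φm ω) := fun u hu =>
    (measurable_nearestValue lm δ K hu).mono le_sup_left le_rfl
  have hZ' : ∀ u : ℝ × ℝ → ℝ≥0∞, Measurable u →
      Measurable fun ω => nearestValue lm δ K u (Φm ω) := fun u hu => (hZ u hu).mono hmu le_rfl
  have hGm : ∀ β, Measurable fun ω => nearestValue lm δ K (logGain β L) (Φm ω) :=
    fun β => hZ' _ (measurable_logGain β L)
  have hLm : ∀ β, Measurable fun ω => nearestValue lm δ K (logLoss β) (Φm ω) :=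
    fun β => hZ' _ (measurable_logLoss β)
  have hrp : Measurable (receivedPower α) := by unfold receivedPower; fun_prop
  have hcs : ∀ g, Measurable g → Measurable fun ω => crowdSum θ h N I g (Φm ω) (Φu ω) := fun g hg =>
    (measurable_crowdSum θ hh.le N I hg).mono hmu le_rfl
  have hsee : ∀ j, MeasurableSet[sigmaOf Φg] {ω | SeesInside R j (Φg ω)} := fun j =>
    measurableSet_netEvent _ _ _ _ _
  have hAm : MeasurableSet A := measurableSet_toMeasurable _ _
  have hsum : ∀ ω, roomInterference θ h R N J I (Φm ω) (Φu ω) (Φg ω) = ∑ j ∈ Finset.range J,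
      {ω | SeesInside R j (Φg ω)}.indicator 1 ω * crowdSum θ h N I (ringPower j) (Φm ω) (Φu ω) :=
    fun ω => rfl
  have hroom : Measurable fun ω => roomInterference θ h R N J I (Φm ω) (Φu ω) (Φg ω) := by
    simp_rw [hsum]
    exact Finset.measurable_fun_sum _ fun j _ =>
      (measurable_indicator_one (hg.sigmaOf_le _ (hsee j))).fun_mul (hcs _ (measurable_ringPower j))
  have hloss : Measurable fun ω => interferenceLoss α θ σ h N I (Φm ω) (Φu ω) := by
    unfold interferenceLoss
    have := hcs _ hrp
    fun_prop
  -- On irregular configurations the left side is at most C, since the truncated gain is at most `L`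
  -- and `logRatio 2` at most `logRatio α`; no information on the SINR is needed there.
  have hpt : ∀ᵐ ω ∂P, out.indicator 1 ω * (ENNReal.ofReal (logRatio α σ lm) +
        nearestValue lm δ K (logGain α L) (Φm ω)) +
      inn.indicator 1 ω * (ENNReal.ofReal (logRatio 2 σ lm) +
        nearestValue lm δ K (logGain 2 L) (Φm ω)) ≤
      ENNReal.ofReal (Real.log (1 + (sinr α θ σ R (Φm ω) (Φu ω) (Φg ω)).toReal)) +
      (out.indicator 1 ω * nearestValue lm δ K (logLoss α) (Φm ω) +
        inn.indicator 1 ω * nearestValue lm δ K (logLoss 2) (Φm ω) +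
        (interferenceLoss α θ σ h N I (Φm ω) (Φu ω) +
        roomInterference θ h R N J I (Φm ω) (Φu ω) (Φg ω) / ENNReal.ofReal (σ ^ 2)) +
        A.indicator 1 ω * C) := by
    have hfin : ∀ᵐ ω ∂P, ∀ j, crowdSum θ h N I (ringPower j) (Φm ω) (Φu ω) ≠ ∞ :=
      ae_all_iff.mpr fun j => (ae_crowdSum_ne_top hm hu θ hh N I (ringPower_ne_top j)).mono
        fun ω hω => hω.2
    filter_upwards [hm.ae_proper, ae_crowdSum_ne_top hm hu θ hh N I
      (g := receivedPower α) (fun b => ENNReal.ofReal_ne_top), hfin] with ω h1 h2 h3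
    by_cases hbad : ω ∈ irregular Φm Φu Φg w M R lm δ K
    · have hωA : ω ∈ A := subset_toMeasurable _ _ hbad
      refine le_trans ?_ (le_add_self.trans le_add_self)
      rw [indicator_of_mem hωA, Pi.one_apply, one_mul]
      have hc2 : logRatio 2 σ lm ≤ logRatio α σ lm := by
        have := Real.log_nonneg hlm'
        simp only [logRatio]
        nlinarith
      have hL1 := fun β => nearestValue_logGain_le (lm := lm) (β := β) (L := L) hδ K (Φm ω)
      by_cases h0 : ω ∈ out
      · rw [indicator_of_mem h0, indicator_of_notMem (by exact fun h => h h0), zero_mul, add_zero,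
          Pi.one_apply, one_mul]
        exact add_le_add le_rfl (hL1 α)
      · rw [indicator_of_notMem h0, indicator_of_mem (by exact h0), zero_mul, zero_add,
          Pi.one_apply, one_mul]
        exact add_le_add (ENNReal.ofReal_le_ofReal hc2) (hL1 2)
    · rw [irregular, Set.mem_ofPred_eq, not_not] at hbad
      obtain ⟨H, k, hk, hn⟩ := hbad
      have hY : roomInterference θ h R N J I (Φm ω) (Φu ω) (Φg ω) ≠ ∞ := by
        rw [hsum]
        refine ENNReal.sum_ne_top.mpr fun j _ => ENNReal.mul_ne_top ?_ (h3 j)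
        by_cases hj : SeesInside R j (Φg ω) <;> simp [hj]
      have := H.indicator_logRatio_add_le (L := L) hα hθ hσ hlm hw hM hδ hT hh hNh hR hR' hJ hc
        hlm' hk hn h1 h2.2 hY
      exact this.trans (add_le_add le_rfl le_self_add)
  have hint := lintegral_mono_ae hpt
  have ho := fun (u : Ω → ℝ≥0∞) hu => lintegral_indicator_mul_of_indep hg.sigmaOf_le hmu hN.indep_rooms hout
    (f := u) hu
  have hi := fun (u : Ω → ℝ≥0∞) hu => lintegral_indicator_mul_of_indep hg.sigmaOf_le hmu hN.indep_rooms hinn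
    (f := u) hu
  have mo := measurable_indicator_one hout'
  have mi := measurable_indicator_one hinn'
  have mA := measurable_indicator_one hAm
  -- Only the error terms are split off as measurable summands, so measurability of the SINR is
  -- never used. Indicators depending on the rooms factor out by independence from stations and
  -- users.
  rw [lintegral_add_left (mo.fun_mul ((hGm α).const_add _)),
    ho _ ((hZ _ (measurable_logGain α L)).const_add _),
    hi _ ((hZ _ (measurable_logGain 2 L)).const_add _),
    lintegral_add_left measurable_const, lintegral_add_left measurable_const, lintegral_const,
    lintegral_const, measure_univ, mul_one, mul_one, hPout, hPinn,
    lintegral_add_right _ (by fun_prop), lintegral_add_right _ (by fun_prop),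
    lintegral_add_right _ (by fun_prop), lintegral_add_right _ (by fun_prop),
    ho _ (hZ _ (measurable_logLoss α)), hi _ (hZ _ (measurable_logLoss 2)),
    lintegral_mul_const _ mA, lintegral_indicator_one hAm, hA, measure_toMeasurable,
    hPout, hPinn, lintegral_add_right _ (by fun_prop)] at hint
  refine hint.trans (add_le_add le_rfl (add_le_add (add_le_add (add_le_add ?_ ?_)
    (add_le_add ?_ ?_)) le_rfl))
  · rw [← lintegral_logLoss]
    exact mul_le_mul_right (lintegral_nearestValue_le hm hlm hδ K (measurable_logLoss α)) _
  · rw [← lintegral_logLoss]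
    exact mul_le_mul_right (lintegral_nearestValue_le hm hlm hδ K (measurable_logLoss 2)) _
  · exact lintegral_log_crowdSum_le hm hu hN.indep_users hα hσ hlm hlu θ hh N I hrp
      (fun b => le_rfl) hψ hC hτ
  · simp_rw [div_eq_mul_inv]
    rw [lintegral_mul_const _ hroom]
    refine mul_le_mul_left ?_ _
    simp_rw [hsum]
    rw [lintegral_finsetSum _ fun j _ =>
      (measurable_indicator_one (hg.sigmaOf_le _ (hsee j))).fun_mul (hcs _ (measurable_ringPower j))]
    refine Finset.sum_le_sum fun j _ => ?_
    rw [lintegral_indicator_mul_of_indep hg.sigmaOf_le hmu hN.indep_rooms (hsee j)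
      (measurable_crowdSum θ hh.le N I (measurable_ringPower j))]
    refine mul_le_mul_right ?_ _
    refine (lintegral_crowdSum_le hm hu hN.indep_users hlm θ hh N I (measurable_ringPower j)
      hC).trans ?_
    gcongr
    exact lintegral_ringPower_le j

end Assembly

/-! ### The probability of irregular configurations. -/

section Irregular

open Set

/-- The points within distance `s` of the boundary of the disc of radius `R` around `z`. -/
def shell (R s : ℝ) (z : Plane) : Set Plane := {c | |dist z c - R| ≤ s}

lemma measurableSet_shell (R s : ℝ) (z : Plane) : MeasurableSet (shell R s z) :=
  measurableSet_le (by fun_prop) measurable_const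

lemma volume_shell_le {R s : ℝ} (hs : 0 ≤ s) (hsR : s ≤ R) (z : Plane) :
    volume (shell R s z) ≤ ENNReal.ofReal (4 * Real.pi * R * s) := by
  have h1 : shell R s z ⊆ Metric.closedBall z (R + s) \ Metric.ball z (R - s) := by
    intro c hc
    have hc' := abs_le.mp (show |dist z c - R| ≤ s from hc)
    rw [dist_comm] at hc'
    refine ⟨?_, ?_⟩
    · rw [Metric.mem_closedBall]; linarith
    · rw [Metric.mem_ball]; linarith
  refine (measure_mono h1).trans ?_
  rw [measure_sdiff (Metric.ball_subset_closedBall.trans (Metric.closedBall_subset_closedBall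
      (by linarith))) Metric.isOpen_ball.measurableSet.nullMeasurableSet measure_ball_lt_top.ne,
    EuclideanSpace.volume_closedBall_fin_two, EuclideanSpace.volume_ball_fin_two,
    ← ENNReal.ofReal_pow (by linarith), ← ENNReal.ofReal_pow (by linarith),
    ← ENNReal.ofReal_mul (by positivity), ← ENNReal.ofReal_mul (by positivity),
    ← ENNReal.ofReal_sub _ (by positivity)]
  refine ENNReal.ofReal_le_ofReal (le_of_eq ?_)
  ring

variable {w M R : ℝ} {B : Set (Plane × ℝ)} {U G : Set Plane}

/-- The conditions on all points of a disc reduce to finitely many counts on grids; the coarser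
constants absorb the distance to the nearest grid point. -/
lemma regular_of_grid {n : ℕ} (hw : 0 < w) (hM : 0 < M) (hR : 0 < R) (hn : (3 * n + 1) * R < M)
    (h0 : count G (shell R w 0) = 0)
    (h1 : ∀ i ∈ gridIndex w (2 * M), count U (gridCell w i) = 0 ∨
      count G (shell R (3 * w) (gridPoint w i)) = 0)
    (h2 : ∀ i ∈ gridIndex (w / 4) (2 * M),
      count B (Metric.ball (gridPoint (w / 4) i) (w / 2) ×ˢ univ) ≠ 0)
    (h3 : ¬ NetEvent R (2 * M) (3 * R / 2) n {0}ᶜ G) (h4 : ¬ NetEvent R (2 * M) (R / 2) n {0} G) :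
    Regular w M R B U G where
  origin c hc := by
    by_contra! h
    exact notMem_empty c ((encard_eq_zero.mp h0) ▸ ⟨hc, h⟩)
  users y hy hyM c hc := by
    by_contra! h
    obtain ⟨i, hi, hyi⟩ := exists_mem_gridCell hw hyM.le
    rcases h1 i hi with h | h'
    · exact notMem_empty y ((encard_eq_zero.mp h) ▸ ⟨hy, hyi⟩)
    · refine notMem_empty c ((encard_eq_zero.mp h') ▸ ⟨hc, ?_⟩)
      -- The grid point is within 2w of the user, which widens the shell from w to 3w.
      have e1 := dist_gridPoint_le hw hyi
      have e2 := abs_dist_sub_le y (gridPoint w i) c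
      have e3 := abs_le.mp h
      have e4 := abs_le.mp e2
      change |dist (gridPoint w i) c - R| ≤ 3 * w
      exact abs_le.mpr ⟨by linarith [e3.1, e4.2], by linarith [e3.2, e4.1]⟩
  near y hy := by
    -- Mesh w/4 puts the user within w/2 of a grid point, which has a station within w/2.
    obtain ⟨i, hi, hyi⟩ := exists_mem_gridCell (r := w / 4) (by positivity) hy.le
    have h := h2 i hi
    rw [count, Ne, encard_eq_zero, ← Ne, ← nonempty_iff_ne_empty] at h
    obtain ⟨b, hb, hbz, -⟩ := h
    refine ⟨b, hb, ?_⟩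
    have e1 := dist_gridPoint_le (by positivity) hyi
    have e2 : dist b.1 (gridPoint (w / 4) i) < w / 2 := hbz
    have e3 := dist_triangle_right y b.1 (gridPoint (w / 4) i)
    linarith
  short p q hp hpq := by
    by_contra! h
    have hq : ‖q‖ ≤ 2 * M := by
      have := dist_triangle 0 p q
      rw [dist_zero_left, dist_zero_left] at this
      linarith
    rcases segment_subset_or_disjoint h with h | h
    · exact h3 (netEvent_of_inside hR (by linarith) hq (by rwa [hpq]) h)
    · exact h4 (netEvent_of_outside hR (by linarith) hq (by rwa [hpq]) h)

variable {Ω : Type*} [mΩ : MeasurableSpace Ω] {P : Measure Ω} [IsProbabilityMeasure P]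
  {Φm : Ω → Set (Plane × ℝ)} {Φu Φg : Ω → Set Plane} {lm lu lg : ℝ}

/-- A bound for the probability of irregular configurations. -/
def irregularBound (w M R lm lu lg δ : ℝ) (n K : ℕ) : ℝ :=
  lg * (4 * Real.pi * R * w) +
    (4 * M / w + 5) ^ 2 * ((lu * (4 * Real.pi * w ^ 2)) * (lg * (4 * Real.pi * R * (3 * w)))) +
    (16 * M / w + 5) ^ 2 * Real.exp (-(lm * (Real.pi * (w / 2) ^ 2))) +
    (8 * (2 * M) / R + 5) ^ 4 * (1 - Real.exp (-(lg * (Real.pi * (3 * R / 2) ^ 2)))) ^ n +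
    (8 * (2 * M) / R + 5) ^ 4 * Real.exp (-(lg * (Real.pi * (R / 2) ^ 2))) ^ n +
    (δ + Real.exp (-(K * δ)))

lemma irregularBound_nonneg {δ : ℝ} (hw : 0 < w) (hM : 0 < M) (hR : 0 < R) (hlu : 0 < lu)
    (hlg : 0 < lg) (hδ : 0 < δ) (n K : ℕ) : 0 ≤ irregularBound w M R lm lu lg δ n K := by
  have hpi := Real.pi_pos
  have : 0 ≤ 1 - Real.exp (-(lg * (Real.pi * (3 * R / 2) ^ 2))) := by
    rw [sub_nonneg, Real.exp_le_one_iff, neg_nonpos]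
    positivity
  unfold irregularBound
  positivity

lemma IsNetwork.measure_irregular_le (hN : IsNetwork P lm lu lg Φm Φu Φg) (hlm : 0 < lm)
    (hlu : 0 < lu) (hlg : 0 < lg) {δ : ℝ} (hδ : 0 < δ) {n : ℕ} (K : ℕ) (hw : 0 < w)
    (hwR : 3 * w ≤ R) (hM : 0 < M) (hn : (3 * n + 1) * R < M) :
    P (irregular Φm Φu Φg w M R lm δ K) ≤
      ENNReal.ofReal (irregularBound w M R lm lu lg δ n K) := by
  have hR : 0 < R := by linarith
  have hpi := Real.pi_pos
  have hm := hN.stations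
  have hu := hN.users
  have hg := hN.rooms
  let A0 : Set Ω := {ω | count (Φg ω) (shell R w 0) ≠ 0}
  let A1 : Set Ω := ⋃ i ∈ gridIndex w (2 * M), {ω | count (Φu ω) (gridCell w i) ≠ 0} ∩
    {ω | count (Φg ω) (shell R (3 * w) (gridPoint w i)) ≠ 0}
  let A2 : Set Ω := ⋃ i ∈ gridIndex (w / 4) (2 * M),
    {ω | count (Φm ω) (Metric.ball (gridPoint (w / 4) i) (w / 2) ×ˢ univ) = 0}
  let A3 : Set Ω := {ω | NetEvent R (2 * M) (3 * R / 2) n {0}ᶜ (Φg ω)}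
  let A4 : Set Ω := {ω | NetEvent R (2 * M) (R / 2) n {0} (Φg ω)}
  let A5 : Set Ω := {ω | ¬ ∃ k < K, NearestIn lm δ (Φm ω) k}
  have hsub : irregular Φm Φu Φg w M R lm δ K ⊆ A0 ∪ A1 ∪ A2 ∪ A3 ∪ A4 ∪ A5 := by
    intro ω hω
    by_contra hc
    simp only [A0, A1, A2, A3, A4, A5, mem_union, mem_iUnion, mem_inter_iff, Set.mem_ofPred_eq,
      not_or, not_exists, not_not] at hc
    obtain ⟨⟨⟨⟨⟨h0, h1⟩, h2⟩, h3⟩, h4⟩, h5⟩ := hc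
    refine hω ⟨regular_of_grid hw hM hR hn h0 (fun i hi => ?_) (fun i hi => h2 i hi) h3 h4, ?_⟩
    · have := h1 i hi
      tauto
    · by_contra hne
      exact h5 fun k hk => hne ⟨k, hk⟩
  have hshell : ∀ s z, 0 ≤ s → s ≤ R →
      P {ω | count (Φg ω) (shell R s z) ≠ 0} ≤ ENNReal.ofReal (lg * (4 * Real.pi * R * s)) := by
    intro s z hs hsR
    refine (hg.measure_count_ne_zero_le (measurableSet_shell R s z)).trans ?_
    rw [Measure.smul_apply, smul_eq_mul, ENNReal.ofReal_mul hlg.le]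
    exact mul_le_mul_right (volume_shell_le hs hsR z) _
  have e0 : P A0 ≤ ENNReal.ofReal (lg * (4 * Real.pi * R * w)) := hshell w 0 hw.le (by linarith)
  -- A user in the cell and a wall nearby are independent events with probabilities O(w²) and O(w);
  -- the product outweighs the O((M/w)²) cells once M²w is small.
  have e1 : P A1 ≤ ENNReal.ofReal ((4 * M / w + 5) ^ 2 *
      ((lu * (4 * Real.pi * w ^ 2)) * (lg * (4 * Real.pi * R * (3 * w))))) := by
    refine (measure_biUnion_finset_le _ _).trans ?_
    have h1 : ∀ i ∈ gridIndex w (2 * M), P ({ω | count (Φu ω) (gridCell w i) ≠ 0} ∩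
        {ω | count (Φg ω) (shell R (3 * w) (gridPoint w i)) ≠ 0}) ≤
        ENNReal.ofReal ((lu * (4 * Real.pi * w ^ 2)) * (lg * (4 * Real.pi * R * (3 * w)))) := by
      intro i _
      have hind : Indep (sigmaOf Φu) (sigmaOf Φg) P := hN.indep.indep (i := 1) (j := 2) (by decide)
      have := (Indep_iff _ _ _).mp hind {ω | count (Φu ω) (gridCell w i) ≠ 0}
        {ω | count (Φg ω) (shell R (3 * w) (gridPoint w i)) ≠ 0}
        (measurable_count_sigmaOf (measurableSet_gridCell w i)
          (MeasurableSet.of_discrete (s := {(0 : ℕ∞)}ᶜ)))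
        (measurable_count_sigmaOf (measurableSet_shell R (3 * w) (gridPoint w i))
          (MeasurableSet.of_discrete (s := {(0 : ℕ∞)}ᶜ)))
      rw [this, ENNReal.ofReal_mul (by positivity)]
      refine mul_le_mul' ?_ (hshell _ _ (by positivity) hwR)
      refine (hu.measure_count_ne_zero_le (measurableSet_gridCell w i)).trans ?_
      rw [Measure.smul_apply, smul_eq_mul, ENNReal.ofReal_mul hlu.le]
      exact mul_le_mul_right (volume_gridCell_le hw i) _
    refine (Finset.sum_le_sum h1).trans ?_
    rw [Finset.sum_const, nsmul_eq_mul, ← ENNReal.ofReal_natCast,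
      ← ENNReal.ofReal_mul (by positivity)]
    refine ENNReal.ofReal_le_ofReal (mul_le_mul_of_nonneg_right ?_ (by positivity))
    refine (card_gridIndex_le hw (by positivity)).trans (le_of_eq ?_)
    ring
  have e2 : P A2 ≤ ENNReal.ofReal ((16 * M / w + 5) ^ 2 *
      Real.exp (-(lm * (Real.pi * (w / 2) ^ 2)))) := by
    refine (measure_biUnion_finset_le _ _).trans ?_
    have h1 : ∀ i ∈ gridIndex (w / 4) (2 * M),
        P {ω | count (Φm ω) (Metric.ball (gridPoint (w / 4) i) (w / 2) ×ˢ univ) = 0} ≤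
        ENNReal.ofReal (Real.exp (-(lm * (Real.pi * (w / 2) ^ 2)))) := by
      intro i _
      have hv : stationMeasure lm (Metric.ball (gridPoint (w / 4) i) (w / 2) ×ˢ univ) =
          ENNReal.ofReal (lm * (Real.pi * (w / 2) ^ 2)) := by
        rw [stationMeasure_prod_univ, EuclideanSpace.volume_ball_fin_two,
          ← ENNReal.ofReal_pow (by positivity), ← ENNReal.ofReal_mul (by positivity),
          ← ENNReal.ofReal_mul hlm.le]
        congr 1
        ring
      rw [hm.measure_void (Metric.isOpen_ball.measurableSet.prod MeasurableSet.univ)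
        (by rw [hv]; exact ENNReal.ofReal_ne_top), hv, ENNReal.toReal_ofReal (by positivity)]
    refine (Finset.sum_le_sum h1).trans ?_
    rw [Finset.sum_const, nsmul_eq_mul, ← ENNReal.ofReal_natCast,
      ← ENNReal.ofReal_mul (by positivity)]
    refine ENNReal.ofReal_le_ofReal (mul_le_mul_of_nonneg_right ?_ (by positivity))
    refine (card_gridIndex_le (by positivity) (by positivity)).trans (le_of_eq ?_)
    field_simp
    ring
  have e3 := measure_netEvent_inside_le hg hlg hR (show 0 ≤ 2 * M by positivity) n
  have e4 := measure_netEvent_outside_le hg hlg hR (show 0 ≤ 2 * M by positivity) n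
  have e5 := measure_not_nearestIn_le hm hlm hδ K
  have hκ : 0 ≤ 1 - Real.exp (-(lg * (Real.pi * (3 * R / 2) ^ 2))) := by
    rw [sub_nonneg, Real.exp_le_one_iff, neg_nonpos]
    positivity
  rw [irregularBound, ENNReal.ofReal_add (by positivity) (by positivity),
    ENNReal.ofReal_add (by positivity) (by positivity),
    ENNReal.ofReal_add (by positivity) (by positivity),
    ENNReal.ofReal_add (by positivity) (by positivity),
    ENNReal.ofReal_add (by positivity) (by positivity)]
  refine (measure_mono hsub).trans ((measure_union_le _ _).trans (add_le_add ?_ e5))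
  refine (measure_union_le _ _).trans (add_le_add ?_ e4)
  refine (measure_union_le _ _).trans (add_le_add ?_ e3)
  refine (measure_union_le _ _).trans (add_le_add ?_ e2)
  exact (measure_union_le _ _).trans (add_le_add e0 e1)

/-- A bound for the probability that the origin sees from inside a room to distance `j + 1`. -/
lemma measure_seesInside_le (hg : IsPoissonProcess P Φg (ENNReal.ofReal lg • (volume : Measure Plane)))
    (hlg : 0 < lg) (hR : 0 < R) (hR1 : R ≤ 1) (j : ℕ) :
    P {ω | SeesInside R j (Φg ω)} ≤ ENNReal.ofReal ((13 * (j + 1) / R) ^ 4 *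
      (8 * lg * R ^ 2) ^ (5 * (j + 1))) := by
  have h := measure_netEvent_inside_le hg hlg hR (show (0 : ℝ) ≤ j + 1 by positivity) (5 * (j + 1))
  refine h.trans (ENNReal.ofReal_le_ofReal ?_)
  have hpi := Real.pi_pos
  have hκ : 0 ≤ 1 - Real.exp (-(lg * (Real.pi * (3 * R / 2) ^ 2))) := by
    rw [sub_nonneg, Real.exp_le_one_iff, neg_nonpos]
    positivity
  -- The constant 8 exceeds 9π/4.
  have h1 : 1 - Real.exp (-(lg * (Real.pi * (3 * R / 2) ^ 2))) ≤ 8 * lg * R ^ 2 := by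
    have e1 := Real.add_one_le_exp (-(lg * (Real.pi * (3 * R / 2) ^ 2)))
    have e2 : Real.pi < 3.15 := Real.pi_lt_d2
    have e3 : 0 < lg * R ^ 2 := by positivity
    nlinarith
  have h2 : 8 * ((j : ℝ) + 1) / R + 5 ≤ 13 * (j + 1) / R := by
    have e1 : 5 ≤ 5 * ((j : ℝ) + 1) / R := by
      rw [le_div_iff₀ hR]
      have : (0 : ℝ) ≤ j := by positivity
      nlinarith
    have e2 : 13 * ((j : ℝ) + 1) / R = 8 * (j + 1) / R + 5 * (j + 1) / R := by ring
    linarith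
  gcongr

end Irregular

/-! ### The lower bound with explicit error terms. -/

section LowerBound

open Set

lemma summable_pow_six : Summable fun j : ℕ => ((j : ℝ) + 1) ^ 6 * (1 / 2) ^ j := by
  have h := (summable_nat_add_iff 1).mpr
    (summable_pow_mul_geometric_of_norm_lt_one (R := ℝ) 6 (r := 1 / 2) (by norm_num))
  refine (h.mul_left 2).congr fun j => ?_
  push_cast
  ring

/-- The constant in the bound for the interference from far stations in a room. -/
def roomConst (lg : ℝ) : ℝ :=
  4 * Real.pi * 13 ^ 4 * (8 * lg) ^ 5 * ∑' j : ℕ, ((j : ℝ) + 1) ^ 6 * (1 / 2) ^ j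

lemma roomConst_nonneg {lg : ℝ} (hlg : 0 < lg) : 0 ≤ roomConst lg := by
  have : 0 ≤ ∑' j : ℕ, ((j : ℝ) + 1) ^ 6 * (1 / 2 : ℝ) ^ j := tsum_nonneg fun j => by positivity
  have := Real.pi_pos
  unfold roomConst
  positivity

lemma sum_room_le {lg R : ℝ} (hlg : 0 < lg) (hR : 0 < R) (hR1 : R ≤ 1) (h8 : 16 * lg * R ≤ 1)
    (J : ℕ) : ∑ j ∈ Finset.range J, (13 * ((j : ℝ) + 1) / R) ^ 4 * (8 * lg * R ^ 2) ^ (5 * (j + 1)) *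
      (Real.pi * (j + 2) ^ 2) ≤ roomConst lg * R := by
  have hpi := Real.pi_pos
  have hb : 8 * lg * R ^ 2 ≤ 1 / 2 := by nlinarith [mul_pos hlg hR]
  have hb0 : 0 ≤ 8 * lg * R ^ 2 := by positivity
  have hb5 : (8 * lg * R ^ 2) ^ 5 ≤ 1 / 2 :=
    (pow_le_of_le_one hb0 (by linarith) (by norm_num)).trans hb
  have h1 : ∀ j ∈ Finset.range J, (13 * ((j : ℝ) + 1) / R) ^ 4 *
      (8 * lg * R ^ 2) ^ (5 * (j + 1)) * (Real.pi * (j + 2) ^ 2) ≤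
      4 * Real.pi * 13 ^ 4 * (8 * lg) ^ 5 * R * (((j : ℝ) + 1) ^ 6 * (1 / 2) ^ j) := by
    intro j _
    have e1 : ((j : ℝ) + 2) ^ 2 ≤ 4 * (j + 1) ^ 2 := by
      have : (0 : ℝ) ≤ j := by positivity
      nlinarith
    have e2 : (8 * lg * R ^ 2) ^ (5 * (j + 1)) ≤ (8 * lg * R ^ 2) ^ 5 * (1 / 2) ^ j := by
      rw [pow_mul, pow_succ, mul_comm]
      gcongr
    calc _ ≤ (13 * ((j : ℝ) + 1) / R) ^ 4 * ((8 * lg * R ^ 2) ^ 5 * (1 / 2) ^ j) *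
          (Real.pi * (4 * (j + 1) ^ 2)) := by gcongr
      _ = 4 * Real.pi * 13 ^ 4 * (8 * lg) ^ 5 * R ^ 6 * (((j : ℝ) + 1) ^ 6 * (1 / 2) ^ j) := by
        field_simp
      _ ≤ _ := by
        -- Five chain points per unit of length give R^10, which outweighs the R^(-4) from the
        -- choice of grid points.
        have : R ^ 6 ≤ R := pow_le_of_le_one hR.le hR1 (by norm_num)
        gcongr
  refine (Finset.sum_le_sum h1).trans ?_
  rw [← Finset.mul_sum, roomConst]
  have h2 := summable_pow_six.sum_le_tsum (Finset.range J) fun j _ => by positivity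
  calc _ ≤ 4 * Real.pi * 13 ^ 4 * (8 * lg) ^ 5 * R *
        ∑' j : ℕ, ((j : ℝ) + 1) ^ 6 * (1 / 2 : ℝ) ^ j := by gcongr
    _ = _ := by ring

variable {Ω : Type*} [mΩ : MeasurableSpace Ω] {P : Measure Ω} [IsProbabilityMeasure P]
  {Φm : Ω → Set (Plane × ℝ)} {Φu Φg : Ω → Set Plane} {lm lu lg : ℝ}

/-- A lower bound for the spectral efficiency with explicit error terms. -/
lemma IsNetwork.ofReal_le_spectralEfficiency (hN : IsNetwork P lm lu lg Φm Φu Φg)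
    {α θ σ δ w M R L ψ τ ε p x : ℝ} {K n : ℕ}
    (hα : 2 < α) (hθ : 0 < θ) (hθ' : θ < 2 * Real.pi) (hσ : 0 < σ) (hlm : 0 < lm) (hlu : 0 < lu)
    (hlg : 0 < lg) (hw : 0 < w) (hM : 0 < M) (hδ : 0 < δ) (hT : K * δ ≤ lm * (Real.pi * w ^ 2))
    (hwR : 3 * w ≤ R) (hn : (3 * n + 1) * R < M) (hR' : R < 1 / 16) (h8 : 16 * lg * R ≤ 1)
    (hc : 0 ≤ logRatio 2 σ lm) (hlm' : 1 ≤ Real.pi * lm) (hψ : θ / (2 * Real.pi) < ψ)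
    (hτ : τ = σ ^ 2 / (lu * (ψ * (Real.pi * rho α))) ^ (α / 2))
    (hJ : Real.log τ ≤ (1 - α / 2) * meanLogExp) (hL : 0 ≤ L)
    (hLα : ENNReal.ofReal (meanLoss α + (1 - α / 2) * meanLogExp - ε) ≤
      ∫⁻ p in {p | p.1 < K * δ}, logGain α L p ∂(expMeasure 1).prod (expMeasure 1))
    (hL2 : ENNReal.ofReal (meanLoss 2 + (1 - 2 / 2) * meanLogExp - ε) ≤
      ∫⁻ p in {p | p.1 < K * δ}, logGain 2 L p ∂(expMeasure 1).prod (expMeasure 1))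
    (hp : p = Real.exp (-(lg * (Real.pi * R ^ 2))))
    (hx : irregularBound w M R lm lu lg δ n K * (logRatio α σ lm + L) ≤ x) :
    ENNReal.ofReal ((p * (α / 2) + (1 - p)) * Real.log (Real.pi * lm) - Real.log (σ ^ 2) +
      Real.log τ - τ ^ (1 / 2 : ℝ) * lossConst (α / 2) - (1 - p) * ((1 - α / 2) * meanLogExp) -
      lu * ψ * (roomConst lg * R) / σ ^ 2 - x - ε - L * δ) ≤
      spectralEfficiency P α θ σ R Φm Φu Φg := by
  have hpi := Real.pi_pos
  have hR : 0 < R := by linarith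
  have hψ0 : 0 < ψ := lt_trans (by positivity) hψ
  -- The slack between ψ and θ/(2π) pays for the thickening of the lobe; the mesh `h` may depend on
  -- `lm`.
  obtain ⟨h, hh, -, hC⟩ := exists_lobeMass_le hlm hθ hθ' (sub_pos.mpr hψ)
  rw [add_sub_cancel] at hC
  have hNh : w + h ≤ (⌈(w + h) / h⌉₊ : ℕ) * h := by
    rw [← div_le_iff₀ hh]; exact Nat.le_ceil _
  have hmain := hN.le_spectralEfficiency (L := L) (N := ⌈(w + h) / h⌉₊) (J := ⌈M⌉₊) hα hθ' hσ hlm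
    hlu hlg hw hM.le hδ hT hh hNh hR hR' (Nat.le_ceil M) hc hlm' hψ0 hC hτ
  have hcα : 0 ≤ logRatio α σ lm := by
    refine hc.trans ?_
    have := Real.log_nonneg hlm'
    simp only [logRatio]
    nlinarith
  have hp0 : 0 < p := hp ▸ Real.exp_pos _
  have hp1 : p ≤ 1 := by
    rw [hp, Real.exp_le_one_iff, neg_nonpos]; positivity
  have hq0 : 0 ≤ 1 - p := by linarith
  have hgα := ofReal_le_lintegral_logGain hN.stations hlm hL hδ K hLα
  have hg2 := ofReal_le_lintegral_logGain hN.stations hlm hL hδ K hL2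
  have hbad := hN.measure_irregular_le hlm hlu hlg hδ K hw hwR hM hn
  have hroom : (∑ j ∈ Finset.range ⌈M⌉₊, P {ω | SeesInside R j (Φg ω)} *
      (ENNReal.ofReal lu * (ENNReal.ofReal ψ * ENNReal.ofReal (Real.pi * (j + 2) ^ 2)))) /
      ENNReal.ofReal (σ ^ 2) ≤ ENNReal.ofReal (lu * ψ * (roomConst lg * R) / σ ^ 2) := by
    rw [ENNReal.ofReal_div_of_pos (by positivity)]
    refine ENNReal.div_le_div_right ?_ _
    have h1 : ∀ j ∈ Finset.range ⌈M⌉₊, P {ω | SeesInside R j (Φg ω)} *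
        (ENNReal.ofReal lu * (ENNReal.ofReal ψ * ENNReal.ofReal (Real.pi * (j + 2) ^ 2))) ≤
        ENNReal.ofReal (lu * ψ * ((13 * ((j : ℝ) + 1) / R) ^ 4 *
          (8 * lg * R ^ 2) ^ (5 * (j + 1)) * (Real.pi * (j + 2) ^ 2))) := by
      intro j _
      refine (mul_le_mul_left (measure_seesInside_le hN.rooms hlg hR (by linarith) j) _).trans
        (le_of_eq ?_)
      rw [← ENNReal.ofReal_mul hψ0.le, ← ENNReal.ofReal_mul hlu.le,
        ← ENNReal.ofReal_mul (by positivity)]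
      congr 1
      ring
    refine (Finset.sum_le_sum h1).trans ?_
    rw [← ENNReal.ofReal_sum_of_nonneg fun j _ => by positivity, ← Finset.mul_sum]
    refine ENNReal.ofReal_le_ofReal ?_
    have := sum_room_le hlg hR (by linarith) h8 ⌈M⌉₊
    gcongr
  have hirr : P (irregular Φm Φu Φg w M R lm δ K) *
      (ENNReal.ofReal (logRatio α σ lm) + ENNReal.ofReal L) ≤ ENNReal.ofReal x := by
    refine (mul_le_mul_left hbad _).trans ?_
    rw [← ENNReal.ofReal_add hcα hL, ← ENNReal.ofReal_mul']
    · exact ENNReal.ofReal_le_ofReal hx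
    · linarith
  have hx0 : 0 ≤ x :=
    le_trans (mul_nonneg (irregularBound_nonneg hw hM hR hlu hlg hδ n K) (by linarith)) hx
  have hr0 := roomConst_nonneg hlg
  have hρ := rho_pos hα
  have hτ0 : 0 < τ := by rw [hτ]; positivity
  have hloss := lossConst_nonneg (α / 2)
  have hτl : 0 ≤ τ ^ (1 / 2 : ℝ) * lossConst (α / 2) := mul_nonneg (by positivity) hloss
  have hmα := meanLoss_nonneg α
  have hm2 := meanLoss_nonneg 2
  rw [← hp] at hmain
  have hlow : ENNReal.ofReal (p * (logRatio α σ lm + (meanLoss α + (1 - α / 2) * meanLogExp - ε -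
      L * δ)) + (1 - p) * (logRatio 2 σ lm + (meanLoss 2 + (1 - 2 / 2) * meanLogExp - ε - L * δ))) ≤
      spectralEfficiency P α θ σ R Φm Φu Φg + ENNReal.ofReal (p * meanLoss α +
        (1 - p) * meanLoss 2 + ((1 - α / 2) * meanLogExp - Real.log τ +
        τ ^ (1 / 2 : ℝ) * lossConst (α / 2) + lu * ψ * (roomConst lg * R) / σ ^ 2) + x) := by
    refine le_trans ?_ (hmain.trans (add_le_add le_rfl ?_))
    · refine ENNReal.ofReal_add_le.trans ?_
      rw [ENNReal.ofReal_mul hp0.le, ENNReal.ofReal_mul hq0]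
      gcongr
      · exact ENNReal.ofReal_add_le.trans (add_le_add le_rfl hgα)
      · exact ENNReal.ofReal_add_le.trans (add_le_add le_rfl hg2)
    · have hpos : 0 ≤ (1 - α / 2) * meanLogExp - Real.log τ := by linarith
      have hrm : 0 ≤ lu * ψ * (roomConst lg * R) / σ ^ 2 := by positivity
      have hsplit : ∀ a b c d : ℝ, 0 ≤ a → 0 ≤ b → 0 ≤ c → 0 ≤ d → ENNReal.ofReal
          (p * a + (1 - p) * b + (c + d) + x) = ENNReal.ofReal p * ENNReal.ofReal a +
          ENNReal.ofReal (1 - p) * ENNReal.ofReal b + (ENNReal.ofReal c + ENNReal.ofReal d) +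
          ENNReal.ofReal x := by
        intro a b c d ha hb hc hd
        rw [ENNReal.ofReal_add (by positivity) hx0, ENNReal.ofReal_add (by positivity)
          (by positivity), ENNReal.ofReal_add (by positivity) (by positivity),
          ENNReal.ofReal_mul hp0.le, ENNReal.ofReal_mul hq0, ENNReal.ofReal_add hc hd]
      rw [hsplit _ _ _ _ hmα hm2 (by positivity) hrm]
      gcongr
  -- The terms `meanLoss` cancel in the difference. The means of the logarithmic powers remain, and
  -- the indoor one is 0.
  have hlow2 := tsub_le_iff_right.mpr hlow
  rw [← ENNReal.ofReal_sub] at hlow2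
  · refine le_trans (le_of_eq ?_) hlow2
    congr 1
    simp only [logRatio]
    ring
  · have hpos : 0 ≤ (1 - α / 2) * meanLogExp - Real.log τ := by linarith
    positivity

end LowerBound

/-! ### Irregular configurations are negligible against log lm. -/

section Asymptotics

open Filter Topology

lemma tendsto_pow_mul_exp_neg (k : ℕ) {b : ℝ} (hb : 0 < b) (C : ℝ) :
    Tendsto (fun x : ℝ => C * (x ^ k * Real.exp (-b * x))) atTop (𝓝 0) := by
  have h := (tendsto_rpow_mul_exp_neg_mul_atTop_nhds_zero k b hb).const_mul C
  rw [mul_zero] at h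
  refine h.congr fun x => ?_
  rw [Real.rpow_natCast]

/-- The length of the chain is linear in `x`, so its probability decays exponentially and outweighs
the polynomial number of grid pairs; the floor costs a factor κ⁻¹. -/
lemma net_term_le {R κ x : ℝ} (hR : 0 < R) (hR1 : R ≤ 1) (hκ0 : 0 < κ) (hκ1 : κ < 1) (hx : 1 ≤ x) :
    (8 * (2 * x) / R + 5) ^ 4 * κ ^ ⌊x / (4 * R)⌋₊ ≤
      (21 / R) ^ 4 * κ⁻¹ * (x ^ 4 * Real.exp (-(-Real.log κ / (4 * R)) * x)) := by
  have h1 : 8 * (2 * x) / R + 5 ≤ 21 / R * x := by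
    have : 5 ≤ 5 * x / R := by rw [le_div_iff₀ hR]; nlinarith
    have e : 21 / R * x = 8 * (2 * x) / R + 5 * x / R := by ring
    linarith
  have h2 : κ ^ ⌊x / (4 * R)⌋₊ ≤ κ⁻¹ * Real.exp (-(-Real.log κ / (4 * R)) * x) := by
    have e1 : κ⁻¹ * Real.exp (-(-Real.log κ / (4 * R)) * x) = κ ^ (x / (4 * R) - 1) := by
      have e2 : -(-Real.log κ / (4 * R)) * x = Real.log κ * (x / (4 * R)) := by ring
      rw [Real.rpow_sub_one hκ0.ne', Real.rpow_def_of_pos hκ0, e2]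
      ring
    rw [e1, ← Real.rpow_natCast]
    exact Real.rpow_le_rpow_of_exponent_ge hκ0 hκ1.le (Nat.sub_one_lt_floor _).le
  have h0 : 0 ≤ 8 * (2 * x) / R + 5 := by positivity
  calc _ ≤ (21 / R * x) ^ 4 * (κ⁻¹ * Real.exp (-(-Real.log κ / (4 * R)) * x)) := by gcongr
    _ = _ := by ring

/-- The probability of irregular configurations decreases faster than the logarithm of the density
of stations grows. -/
lemma eventually_irregularBound_le {R lu lg C ε : ℝ} (hR : 0 < R) (hR1 : R ≤ 1) (hlu : 0 < lu)
    (hlg : 0 < lg) (hC : 0 ≤ C) (hε : 0 < ε) :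
    ∀ᶠ x : ℝ in atTop, irregularBound (x ^ 4)⁻¹ x R (x ^ 16) lu lg (x ^ 2)⁻¹ ⌊x / (4 * R)⌋₊
      ⌊x ^ 10⌋₊ * (C * x) ≤ ε := by
  have hpi := Real.pi_pos
  set κ₁ : ℝ := 1 - Real.exp (-(lg * (Real.pi * (3 * R / 2) ^ 2))) with hκ₁
  set κ₂ : ℝ := Real.exp (-(lg * (Real.pi * (R / 2) ^ 2))) with hκ₂
  have hκ₁0 : 0 < κ₁ := by
    rw [hκ₁, sub_pos, Real.exp_lt_one_iff, neg_lt_zero]; positivity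
  have hκ₁1 : κ₁ < 1 := by
    rw [hκ₁]; linarith [Real.exp_pos (-(lg * (Real.pi * (3 * R / 2) ^ 2)))]
  have hκ₂0 : 0 < κ₂ := Real.exp_pos _
  have hκ₂1 : κ₂ < 1 := by
    rw [hκ₂, Real.exp_lt_one_iff, neg_lt_zero]; positivity
  have hb : ∀ κ : ℝ, 0 < κ → κ < 1 → 0 < -Real.log κ / (4 * R) := fun κ h0 h1 =>
    div_pos (neg_pos.mpr (Real.log_neg h0 h1)) (by positivity)
  set a₁ : ℝ := lg * (4 * Real.pi * R) + 81 * (lu * (4 * Real.pi) * (lg * (4 * Real.pi * R * 3))) + 1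
    with ha₁
  have ha₁0 : 0 ≤ a₁ := by positivity
  -- With lm = x^16, w = x^(-4), M = x and δ = x^(-2), the wall and ring terms are O(x^(-2)), and
  -- all others decay exponentially up to powers of x. The factor C x then leaves O(1/x).
  let f : ℝ → ℝ := fun x => C * a₁ * x⁻¹ + C * 441 * (x ^ 11 * Real.exp (-1 * x)) +
    C * ((21 / R) ^ 4 * κ₁⁻¹) * (x ^ 5 * Real.exp (-(-Real.log κ₁ / (4 * R)) * x)) +
    C * ((21 / R) ^ 4 * κ₂⁻¹) * (x ^ 5 * Real.exp (-(-Real.log κ₂ / (4 * R)) * x)) +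
    C * Real.exp 1 * (x ^ 1 * Real.exp (-1 * x))
  have hf : Tendsto f atTop (𝓝 0) := by
    have h1 : Tendsto (fun x : ℝ => C * a₁ * x⁻¹) atTop (𝓝 0) := by
      simpa using tendsto_inv_atTop_zero.const_mul (C * a₁)
    have := (((h1.add (tendsto_pow_mul_exp_neg 11 one_pos (C * 441))).add
      (tendsto_pow_mul_exp_neg 5 (hb κ₁ hκ₁0 hκ₁1) (C * ((21 / R) ^ 4 * κ₁⁻¹)))).add
      (tendsto_pow_mul_exp_neg 5 (hb κ₂ hκ₂0 hκ₂1) (C * ((21 / R) ^ 4 * κ₂⁻¹)))).add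
      (tendsto_pow_mul_exp_neg 1 one_pos (C * Real.exp 1))
    rw [add_zero, add_zero, add_zero, add_zero] at this
    exact this
  filter_upwards [hf.eventually (gt_mem_nhds hε), eventually_ge_atTop 2] with x hfx hx
  refine le_trans ?_ hfx.le
  have hx0 : 0 < x := by linarith
  have hx1 : 1 ≤ x := by linarith
  have hpw : ∀ k : ℕ, 1 ≤ x ^ k := fun k => one_le_pow₀ hx1
  have t1 : lg * (4 * Real.pi * R * (x ^ 4)⁻¹) ≤ lg * (4 * Real.pi * R) * (x ^ 2)⁻¹ := by
    have : (x ^ 4)⁻¹ ≤ (x ^ 2)⁻¹ :=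
      inv_anti₀ (by positivity) (pow_le_pow_right₀ hx1 (by norm_num))
    rw [← mul_assoc]
    gcongr
  have t2 : (4 * x / (x ^ 4)⁻¹ + 5) ^ 2 * ((lu * (4 * Real.pi * ((x ^ 4)⁻¹) ^ 2)) *
      (lg * (4 * Real.pi * R * (3 * (x ^ 4)⁻¹)))) ≤
      81 * (lu * (4 * Real.pi) * (lg * (4 * Real.pi * R * 3))) * (x ^ 2)⁻¹ := by
    have e1 : 4 * x / (x ^ 4)⁻¹ + 5 ≤ 9 * x ^ 5 := by
      have : 4 * x / (x ^ 4)⁻¹ = 4 * x ^ 5 := by field_simp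
      rw [this]
      linarith [hpw 5]
    calc _ ≤ (9 * x ^ 5) ^ 2 * ((lu * (4 * Real.pi * ((x ^ 4)⁻¹) ^ 2)) *
          (lg * (4 * Real.pi * R * (3 * (x ^ 4)⁻¹)))) := by gcongr
      _ = _ := by field_simp; norm_num
  have t3 : (16 * x / (x ^ 4)⁻¹ + 5) ^ 2 *
      Real.exp (-(x ^ 16 * (Real.pi * ((x ^ 4)⁻¹ / 2) ^ 2))) ≤
      441 * (x ^ 10 * Real.exp (-1 * x)) := by
    have e1 : 16 * x / (x ^ 4)⁻¹ + 5 ≤ 21 * x ^ 5 := by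
      have : 16 * x / (x ^ 4)⁻¹ = 16 * x ^ 5 := by field_simp
      rw [this]
      linarith [hpw 5]
    have e2 : x ≤ x ^ 16 * (Real.pi * ((x ^ 4)⁻¹ / 2) ^ 2) := by
      have h1 : x ^ 16 * (Real.pi * ((x ^ 4)⁻¹ / 2) ^ 2) = Real.pi / 4 * x ^ 8 := by
        field_simp
        norm_num
      rw [h1]
      have h2 : 2 ≤ x ^ 7 := by
        calc (2 : ℝ) ≤ x := hx
          _ ≤ x ^ 7 := le_self_pow₀ hx1 (by norm_num)
      have h3 := Real.pi_gt_three
      have h4 : x ^ 8 = x * x ^ 7 := by ring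
      rw [h4]
      nlinarith [mul_le_mul_of_nonneg_left h2 hx0.le]
    calc _ ≤ (21 * x ^ 5) ^ 2 * Real.exp (-1 * x) := by
          gcongr
          linarith
      _ = _ := by ring
  have t4 := net_term_le hR hR1 hκ₁0 hκ₁1 hx1
  have t5 := net_term_le hR hR1 hκ₂0 hκ₂1 hx1
  have t6 : Real.exp (-((⌊x ^ 10⌋₊ : ℕ) * (x ^ 2)⁻¹)) ≤ Real.exp 1 * Real.exp (-1 * x) := by
    rw [← Real.exp_add, Real.exp_le_exp]
    have e1 := (Nat.sub_one_lt_floor (x ^ 10)).le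
    have e2 : x ^ 8 - 1 ≤ (⌊x ^ 10⌋₊ : ℕ) * (x ^ 2)⁻¹ := by
      rw [← div_eq_mul_inv, le_div_iff₀ (by positivity)]
      have : (x ^ 8 - 1) * x ^ 2 = x ^ 10 - x ^ 2 := by ring
      linarith [hpw 2]
    have e3 : x ≤ x ^ 8 := le_self_pow₀ hx1 (by norm_num)
    linarith
  have hsum : irregularBound (x ^ 4)⁻¹ x R (x ^ 16) lu lg (x ^ 2)⁻¹ ⌊x / (4 * R)⌋₊ ⌊x ^ 10⌋₊ ≤
      a₁ * (x ^ 2)⁻¹ + 441 * (x ^ 10 * Real.exp (-1 * x)) +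
      (21 / R) ^ 4 * κ₁⁻¹ * (x ^ 4 * Real.exp (-(-Real.log κ₁ / (4 * R)) * x)) +
      (21 / R) ^ 4 * κ₂⁻¹ * (x ^ 4 * Real.exp (-(-Real.log κ₂ / (4 * R)) * x)) +
      Real.exp 1 * Real.exp (-1 * x) := by
    rw [irregularBound, ha₁]
    linarith
  refine (mul_le_mul_of_nonneg_right hsum (by positivity)).trans (le_of_eq ?_)
  simp only [f]
  have : (x ^ 2)⁻¹ * x = x⁻¹ := by field_simp
  rw [← this]
  ring

end Asymptotics

/-! ### Comparison with the claimed bound. -/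

section Final

open Filter Topology

lemma eventually_mul_lt (C : ℝ) {b : ℝ} (hb : 0 < b) : ∀ᶠ R : ℝ in 𝓝 0, C * R < b :=
  ((continuous_const.mul continuous_id).tendsto' (0 : ℝ) 0 (by simp)).eventually (gt_mem_nhds hb)

/-- The signal-to-noise ratio whose logarithm bounds the spectral efficiency from below. -/
def targetRatio (α θ σ lu lg S lm : ℝ) : ℝ :=
  Real.pi * lm ^ ((α / 2 - 1) * Real.exp (-lg * S) + 1) / σ ^ 2 *
    (2 * σ ^ 2 / θ * (Real.exp (lg * S) / (rho α * lu)) ^ (α / 2)) ^ Real.exp (-lg * S)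

lemma targetRatio_pos {α θ σ lu lg S lm : ℝ} (hα : 2 < α) (hθ : 0 < θ) (hσ : 0 < σ) (hlu : 0 < lu)
    (hlm : 0 < lm) : 0 < targetRatio α θ σ lu lg S lm := by
  have hρ := rho_pos hα
  have hpi := Real.pi_pos
  unfold targetRatio
  positivity

lemma log_targetRatio {α θ σ lu lg S lm : ℝ} (hα : 2 < α) (hθ : 0 < θ) (hσ : 0 < σ) (hlu : 0 < lu)
    (hlm : 0 < lm) : Real.log (targetRatio α θ σ lu lg S lm) =
      Real.log Real.pi + ((α / 2 - 1) * Real.exp (-lg * S) + 1) * Real.log lm - Real.log (σ ^ 2) +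
      Real.exp (-lg * S) * (Real.log 2 + Real.log (σ ^ 2) - Real.log θ +
        α / 2 * (lg * S - (Real.log (rho α) + Real.log lu))) := by
  have hρ := rho_pos hα
  have hpi := Real.pi_pos
  unfold targetRatio
  rw [Real.log_mul (by positivity) (by positivity), Real.log_div (by positivity) (by positivity),
    Real.log_mul (by positivity) (by positivity), Real.log_rpow hlm, Real.log_rpow (by positivity),
    Real.log_mul (by positivity) (by positivity), Real.log_rpow (by positivity),
    Real.log_div (by positivity) (by positivity), Real.log_mul (by positivity) (by positivity),
    Real.log_div (by positivity) (by positivity), Real.log_mul (by positivity) (by positivity),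
    Real.log_exp]

/-- The target ratio grows at least linearly with the density of stations. -/
lemma targetRatio_ge {α θ σ lu lg S lm : ℝ} (hα : 2 < α) (hθ : 0 < θ) (hσ : 0 < σ) (hlu : 0 < lu)
    (hlm : 1 ≤ lm) : targetRatio α θ σ lu lg S 1 * lm ≤ targetRatio α θ σ lu lg S lm := by
  have hρ := rho_pos hα
  have hpi := Real.pi_pos
  have h1 : lm ≤ lm ^ ((α / 2 - 1) * Real.exp (-lg * S) + 1) := by
    refine Real.self_le_rpow_of_one_le hlm ?_
    have : 0 < (α / 2 - 1) * Real.exp (-lg * S) := mul_pos (by linarith) (Real.exp_pos _)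
    linarith
  unfold targetRatio
  rw [Real.one_rpow, mul_one, mul_right_comm, div_mul_eq_mul_div]
  gcongr

lemma log_one_add_le {y b : ℝ} (hy : 0 < y) (hb : y⁻¹ ≤ b) : Real.log (1 + y) ≤ Real.log y + b := by
  have h1 : 1 + y = y * (1 + y⁻¹) := by field_simp; ring
  have h2 := Real.log_le_sub_one_of_pos (show 0 < 1 + y⁻¹ by positivity)
  rw [h1, Real.log_mul (by positivity) (by positivity)]
  linarith

/-- The comparison of the lower bound with the target. -/
lemma log_target_lt {α θ σ lu lg S lm p τ κ m g ψ loss room x e d y : ℝ}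
    (hα : 2 < α) (hθ : 0 < θ) (hσ : 0 < σ) (hlu : 0 < lu) (hlm : 0 < lm) (hm0 : 0 < m)
    (hm : m = (α / 2 - 1) * (Real.log 2 + Real.log Real.pi - Real.log θ))
    (hκ : α / 2 * κ = m / 8) (hψ : Real.log ψ = Real.log θ - Real.log 2 - Real.log Real.pi + κ)
    (hψ0 : 0 < ψ) (hτ : τ = σ ^ 2 / (lu * (ψ * (Real.pi * rho α))) ^ (α / 2))
    (hp : p = Real.exp (-lg * S)) (hp1 : p ≤ 1) (hp2 : 7 / 8 ≤ p) (hS0 : 0 ≤ α / 2 * (lg * S))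
    (hS : α / 2 * (lg * S) ≤ m / 8) (hq : (1 - p) * (g - Real.log τ) ≤ m / 16)
    (hloss : loss ≤ m / 8) (hroom : room ≤ m / 16) (hx : x ≤ m / 16) (he : e ≤ m / 16)
    (hd : d ≤ m / 16) (hy : y ≤ m / 16) :
    Real.log (targetRatio α θ σ lu lg S lm) + y <
      (p * (α / 2) + (1 - p)) * Real.log (Real.pi * lm) - Real.log (σ ^ 2) +
      Real.log τ - loss - (1 - p) * g - room - x - e - d := by
  have hρ := rho_pos hα
  have hpi := Real.pi_pos
  have hlogτ : Real.log τ = Real.log (σ ^ 2) -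
      α / 2 * (Real.log lu + (Real.log ψ + (Real.log Real.pi + Real.log (rho α)))) := by
    rw [hτ, Real.log_div (by positivity) (by positivity), Real.log_rpow (by positivity),
      Real.log_mul (by positivity) (by positivity), Real.log_mul (by positivity) (by positivity),
      Real.log_mul (by positivity) (by positivity)]
  -- The exact difference of the two logarithms: the gap `m`, less m/8 for the slack in ψ and less
  -- the term lg S, minus the interference loss counted needlessly indoors.
  have key : (p * (α / 2) + (1 - p)) * Real.log (Real.pi * lm) - Real.log (σ ^ 2) + Real.log τ -
      (1 - p) * g - Real.log (targetRatio α θ σ lu lg S lm) =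
      p * (7 / 8 * m - α / 2 * (lg * S)) - (1 - p) * (g - Real.log τ) := by
    rw [log_targetRatio hα hθ hσ hlu hlm, ← hp, Real.log_mul (by positivity) (by positivity),
      hlogτ, hψ]
    linear_combination -p * hκ - p * hm
  -- With p ≥ 7/8 the gain is at least (7/8)(6/8)m = 21m/32, while all errors together are at most
  -- m/2.
  nlinarith

end Final

/-! ### Thresholds for the density of stations. -/

section Regime

open Filter Topology

/-- The conditions on the density `x ^ 16` of stations. -/
lemma eventually_dense {α R σ lu lg L m Y : ℝ} (hR : 0 < R) (hR1 : R ≤ 1) (hα : 2 < α)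
    (hlu : 0 < lu) (hlg : 0 < lg) (hL : 0 ≤ L) (hm : 0 < m) (hY : 0 < Y) :
    ∀ᶠ x : ℝ in atTop, 1 ≤ x ∧ 3 * (x ^ 4)⁻¹ ≤ R ∧ (3 * (⌊x / (4 * R)⌋₊ : ℕ) + 1) * R < x ∧
      L * (x ^ 2)⁻¹ ≤ m ∧ L ≤ (⌊x ^ 10⌋₊ : ℕ) * (x ^ 2)⁻¹ ∧ 0 ≤ logRatio 2 σ (x ^ 16) ∧
      irregularBound (x ^ 4)⁻¹ x R (x ^ 16) lu lg (x ^ 2)⁻¹ ⌊x / (4 * R)⌋₊ ⌊x ^ 10⌋₊ *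
        (logRatio α σ (x ^ 16) + L) ≤ m ∧ (Y * x ^ 16)⁻¹ ≤ m := by
  have hpi := Real.pi_gt_three
  have hlogpi : 0 ≤ Real.log Real.pi := Real.log_nonneg (by linarith)
  set C : ℝ := α / 2 * (Real.log Real.pi + 16) + |Real.log (σ ^ 2)| + L with hCdef
  have hC : 0 ≤ C := by
    have := abs_nonneg (Real.log (σ ^ 2))
    have : 0 ≤ α / 2 * (Real.log Real.pi + 16) := by
      have : 0 < α / 2 := by linarith
      positivity
    linarith
  filter_upwards [eventually_irregularBound_le hR hR1 hlu hlg hC hm, eventually_ge_atTop 1,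
    eventually_ge_atTop (3 / R), eventually_gt_atTop (4 * R), eventually_ge_atTop (L / m),
    eventually_ge_atTop (L + 1), eventually_ge_atTop (σ ^ 2), eventually_ge_atTop (1 / (m * Y))]
    with x hirr h1 h2 h3 h4 h5 h6 h7
  have hx0 : 0 < x := by linarith
  have hself : ∀ k : ℕ, k ≠ 0 → x ≤ x ^ k := fun k hk => le_self_pow₀ h1 hk
  have hlog16 : Real.log (Real.pi * x ^ 16) = Real.log Real.pi + 16 * Real.log x := by
    rw [Real.log_mul (by positivity) (by positivity), Real.log_pow]
    norm_num
  refine ⟨h1, ?_, ?_, ?_, ?_, ?_, ?_, ?_⟩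
  · rw [← div_eq_mul_inv, div_le_iff₀ (by positivity)]
    rw [div_le_iff₀ hR] at h2
    nlinarith [hself 4 (by norm_num)]
  -- Here 3nR ≤ 3x/4, and R < x/4.
  · have e := Nat.floor_le (show 0 ≤ x / (4 * R) by positivity)
    rw [le_div_iff₀ (by positivity)] at e
    linarith
  · rw [← div_eq_mul_inv, div_le_iff₀ (by positivity)]
    rw [div_le_iff₀ hm] at h4
    nlinarith [hself 2 (by norm_num)]
  · have e1 := (Nat.sub_one_lt_floor (x ^ 10)).le
    have e2 : x ^ 8 - 1 ≤ (⌊x ^ 10⌋₊ : ℕ) * (x ^ 2)⁻¹ := by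
      rw [← div_eq_mul_inv, le_div_iff₀ (by positivity)]
      have : (x ^ 8 - 1) * x ^ 2 = x ^ 10 - x ^ 2 := by ring
      linarith [one_le_pow₀ (n := 2) h1]
    linarith [hself 8 (by norm_num)]
  · have e : Real.log (σ ^ 2) ≤ Real.log (Real.pi * x ^ 16) := by
      rcases (sq_nonneg σ).eq_or_lt with h0 | h0
      · rw [← h0, Real.log_zero, hlog16]
        have := Real.log_nonneg h1
        positivity
      · refine Real.log_le_log h0 ?_
        nlinarith [hself 16 (by norm_num)]
    rw [logRatio]
    linarith
  · refine le_trans (mul_le_mul_of_nonneg_left ?_ (irregularBound_nonneg (by positivity) hx0 hR hlu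
      hlg (by positivity) _ _)) hirr
    have e1 := Real.log_le_sub_one_of_pos hx0
    have e2 : Real.log Real.pi + 16 * Real.log x ≤ (Real.log Real.pi + 16) * x := by nlinarith
    have e3 : α / 2 * (Real.log Real.pi + 16 * Real.log x) ≤
        α / 2 * ((Real.log Real.pi + 16) * x) :=
      mul_le_mul_of_nonneg_left e2 (by linarith)
    have e4 := neg_abs_le (Real.log (σ ^ 2))
    have e5 := abs_nonneg (Real.log (σ ^ 2))
    rw [logRatio, hlog16, hCdef]
    nlinarith
  · rw [inv_le_comm₀ (by positivity) hm]
    rw [div_le_iff₀ (by positivity)] at h7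
    have e1 := hself 16 (by norm_num)
    calc m⁻¹ = m⁻¹ * 1 := (mul_one _).symm
      _ ≤ m⁻¹ * (x * (m * Y)) := by gcongr
      _ = Y * x := by field_simp
      _ ≤ _ := by gcongr

end Regime

end MmWave

end

/-! ### The proposition: choice of constants and conclusion. -/

theorem proposition2 (α θ : ℝ) (hα : 2 < α) (hθ : 0 < θ) (hθ' : θ < 2 * Real.pi) :
    ∃ c : ℝ, 0 < c ∧ ∀ lu σ : ℝ, 0 < lu → 0 < σ → σ ^ 2 < c * lu ^ (α / 2) →
      ∀ lg : ℝ, 0 < lg → ∃ S₀ : ℝ, 0 < S₀ ∧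
        ∀ S R : ℝ, 0 < R → S = Real.pi * R ^ 2 → S < S₀ →
          ∃ K : ℝ, 0 < K ∧ ∀ lm : ℝ, K * lu < lm →
            ∀ (Ω : Type*) [MeasurableSpace Ω] (P : Measure Ω) [IsProbabilityMeasure P]
              (Φm : Ω → Set (MmWave.Plane × ℝ)) (Φu Φg : Ω → Set MmWave.Plane),
              MmWave.IsNetwork P lm lu lg Φm Φu Φg →
              ENNReal.ofReal (Real.log (1 +
                  Real.pi * lm ^ ((α / 2 - 1) * Real.exp (-lg * S) + 1) / σ ^ 2 *
                    (2 * σ ^ 2 / θ *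
                      (Real.exp (lg * S) / (MmWave.rho α * lu)) ^ (α / 2)) ^
                        Real.exp (-lg * S)))
                < MmWave.spectralEfficiency P α θ σ R Φm Φu Φg := by
  have hpi := Real.pi_pos
  have hpi1 : 1 ≤ Real.pi := by linarith [Real.pi_gt_three]
  have hρ := MmWave.rho_pos hα
  have hlossC := MmWave.lossConst_nonneg (α / 2)
  -- The logarithmic gap (α/2 - 1) log(2π/θ), the budget for all errors.
  obtain ⟨m, hm⟩ : ∃ m, m = (α / 2 - 1) * (Real.log 2 + Real.log Real.pi - Real.log θ) := ⟨_, rfl⟩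
  have hm0 : 0 < m := by
    rw [hm, ← Real.log_mul (by norm_num) hpi.ne']
    exact mul_pos (by linarith) (sub_pos.mpr (Real.log_lt_log hθ hθ'))
  -- Enlarging the lobe mass by exp(κ) costs (α/2)κ in the logarithm, set to m/8.
  obtain ⟨κ, hκdef⟩ : ∃ κ, κ = m / (4 * α) := ⟨_, rfl⟩
  have hκ : α / 2 * κ = m / 8 := by
    have : α ≠ 0 := by linarith
    rw [hκdef]; field_simp; norm_num
  have hκ0 : 0 < κ := hκdef ▸ div_pos hm0 (by linarith)
  obtain ⟨ψ, hψdef⟩ : ∃ ψ, ψ = θ / (2 * Real.pi) * Real.exp κ := ⟨_, rfl⟩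
  have hψ0 : 0 < ψ := by rw [hψdef]; positivity
  have hψ1 : θ / (2 * Real.pi) < ψ := hψdef ▸
    lt_mul_of_one_lt_right (by positivity) (Real.one_lt_exp_iff.mpr hκ0)
  have hψ : Real.log ψ = Real.log θ - Real.log 2 - Real.log Real.pi + κ := by
    rw [hψdef, Real.log_mul (by positivity) (by positivity), Real.log_exp,
      Real.log_div (by positivity) (by positivity), Real.log_mul (by positivity) (by positivity)]
    ring
  obtain ⟨g, hg⟩ : ∃ g, g = (1 - α / 2) * MmWave.meanLogExp := ⟨_, rfl⟩
  obtain ⟨s, hs⟩ : ∃ s, s = m / 8 / (MmWave.lossConst (α / 2) + 1) := ⟨_, rfl⟩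
  have hs0 : 0 < s := by rw [hs]; positivity
  -- τ < exp(g) makes the bound for the interference loss nonnegative, and √τ ≤ s makes its error at
  -- most m/8.
  obtain ⟨τ₀, hτ₀⟩ : ∃ τ₀, τ₀ = min (Real.exp g) (s ^ 2) := ⟨_, rfl⟩
  have hτ₀0 : 0 < τ₀ := hτ₀ ▸ lt_min (Real.exp_pos _) (by positivity)
  -- This `c` turns the hypothesis on σ² into τ < τ₀; it uses θ/(2π) in place of ψ, which only
  -- strengthens the condition.
  refine ⟨τ₀ * (θ / (2 * Real.pi) * (Real.pi * MmWave.rho α)) ^ (α / 2), by positivity, ?_⟩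
  intro lu σ hlu hσ hσlu lg hlg
  obtain ⟨τ, hτ⟩ : ∃ τ, τ = σ ^ 2 / (lu * (ψ * (Real.pi * MmWave.rho α))) ^ (α / 2) := ⟨_, rfl⟩
  have hτ0 : 0 < τ := by rw [hτ]; positivity
  have hττ : τ < τ₀ := by
    rw [hτ, div_lt_iff₀ (by positivity)]
    refine hσlu.trans_le ?_
    rw [mul_assoc, ← Real.mul_rpow (by positivity) hlu.le, mul_comm _ lu]
    gcongr
  have hJ : Real.log τ ≤ g := by
    rw [← Real.log_exp g]
    exact Real.log_le_log hτ0 (hττ.le.trans (hτ₀ ▸ min_le_left _ _))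
  have hloss : τ ^ (1 / 2 : ℝ) * MmWave.lossConst (α / 2) ≤ m / 8 := by
    have h1 : τ ^ (1 / 2 : ℝ) ≤ s := by
      rw [← Real.sqrt_eq_rpow, Real.sqrt_le_left hs0.le]
      exact hττ.le.trans (hτ₀ ▸ min_le_right _ _)
    calc _ ≤ s * (MmWave.lossConst (α / 2) + 1) := by gcongr; linarith
      _ = m / 8 := by rw [hs]; field_simp
  obtain ⟨L₁, hL₁, hL₁'⟩ := MmWave.exists_truncation α (show 0 < m / 16 by positivity)
  obtain ⟨L₂, hL₂, hL₂'⟩ := MmWave.exists_truncation 2 (show 0 < m / 16 by positivity)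
  -- Six smallness conditions on R: the first two for chains inside rooms, then lg S against the
  -- gap, p ≥ 7/8, the indoor share of the interference loss, and the far indoor interference.
  have hsmall := (MmWave.eventually_mul_lt 16 one_pos).and
    ((MmWave.eventually_mul_lt (16 * lg) one_pos).and
    ((MmWave.eventually_mul_lt (α / 2 * (lg * Real.pi)) (show 0 < m / 8 by positivity)).and
    ((MmWave.eventually_mul_lt (lg * Real.pi) (show (0 : ℝ) < 1 / 8 by norm_num)).and
    ((MmWave.eventually_mul_lt (lg * Real.pi * (g - Real.log τ)) (show 0 < m / 16 by positivity)).and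
    (MmWave.eventually_mul_lt (lu * ψ * MmWave.roomConst lg / σ ^ 2)
      (show 0 < m / 16 by positivity))))))
  obtain ⟨R₀, hR₀, hsmall⟩ := Metric.eventually_nhds_iff.mp hsmall
  refine ⟨Real.pi * R₀ ^ 2, by positivity, ?_⟩
  intro S R hR hS hSR
  have hRR : R < R₀ := by
    rw [hS] at hSR
    exact lt_of_pow_lt_pow_left₀ 2 hR₀.le (lt_of_mul_lt_mul_left hSR hpi.le)
  obtain ⟨r1, r2, r3, r4, r5, r6⟩ := hsmall (y := R) (by
    rwa [Real.dist_eq, sub_zero, abs_of_pos hR])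
  have hR1 : R ≤ 1 := by linarith
  have hSle : lg * S ≤ lg * Real.pi * R := by
    have h2 : R ^ 2 ≤ R := pow_le_of_le_one hR.le hR1 two_ne_zero
    calc lg * S = lg * Real.pi * R ^ 2 := by rw [hS]; ring
      _ ≤ lg * Real.pi * R := by gcongr
  have hS0 : 0 ≤ lg * S := by rw [hS]; positivity
  obtain ⟨p, hp⟩ : ∃ p, p = Real.exp (-lg * S) := ⟨_, rfl⟩
  have hp1 : p ≤ 1 := by rw [hp, Real.exp_le_one_iff]; linarith
  have hplow : 1 - lg * S ≤ p := by
    have := Real.add_one_le_exp (-lg * S)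
    rw [hp]; linarith
  have hY0 := MmWave.targetRatio_pos (S := S) (lg := lg) hα hθ hσ hlu one_pos
  obtain ⟨x₀, hx₀⟩ := Filter.eventually_atTop.mp (MmWave.eventually_dense (σ := σ)
    (L := max L₁ L₂) (m := m / 16) hR hR1 hα hlu hlg (le_max_of_le_left hL₁.le)
    (by positivity) hY0)
  -- The density is parametrised as x^16, which makes all auxiliary scales powers of x, up to floors
  -- and constants.
  refine ⟨(max x₀ 1) ^ 16 / lu, by positivity, ?_⟩
  intro lm hlm Ω _ P _ Φm Φu Φg hN
  rw [div_mul_cancel₀ _ hlu.ne'] at hlm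
  obtain ⟨x, hx, rfl⟩ : ∃ x : ℝ, max x₀ 1 < x ∧ lm = x ^ 16 := by
    have h0 : 0 < lm := lt_trans (by positivity) hlm
    have h1 : (lm ^ (1 / 16 : ℝ)) ^ 16 = lm := by
      rw [← Real.rpow_natCast, ← Real.rpow_mul h0.le]
      norm_num
    refine ⟨lm ^ (1 / 16 : ℝ), ?_, h1.symm⟩
    refine lt_of_pow_lt_pow_left₀ 16 (by positivity) ?_
    rwa [h1]
  obtain ⟨d1, d2, d3, d4, d5, d6, d7, d8⟩ := hx₀ x ((le_max_left _ _).trans hx.le)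
  have hx0 : 0 < x := by linarith
  have hx16 : 1 ≤ x ^ 16 := one_le_pow₀ d1
  have hlow := hN.ofReal_le_spectralEfficiency (ψ := ψ) (ε := m / 16) (x := m / 16) (p := p)
    hα hθ hθ' hσ (by positivity) hlu hlg (w := (x ^ 4)⁻¹) (M := x) (δ := (x ^ 2)⁻¹)
    (K := ⌊x ^ 10⌋₊) (by positivity) hx0 (by positivity) (by
      have e1 := Nat.floor_le (show 0 ≤ x ^ 10 by positivity)
      have e2 : x ^ 16 * (Real.pi * ((x ^ 4)⁻¹) ^ 2) = Real.pi * x ^ 8 := by field_simp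
      rw [e2, ← div_eq_mul_inv, div_le_iff₀ (by positivity)]
      have e3 : Real.pi * x ^ 8 * x ^ 2 = Real.pi * x ^ 10 := by ring
      rw [e3]
      exact e1.trans (le_mul_of_one_le_left (by positivity) hpi1)) d2 d3 (by linarith) r2.le d6
    (one_le_mul_of_one_le_of_one_le hpi1 hx16) hψ1 hτ (hg ▸ hJ) (le_max_of_le_left hL₁.le)
    (hL₁' _ _ ((le_max_left _ _).trans d5) (le_max_left _ _))
    (hL₂' _ _ ((le_max_right _ _).trans d5) (le_max_right _ _)) (by rw [hp, hS, neg_mul]) d7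
  rw [← hg] at hlow
  refine lt_of_lt_of_le ?_ hlow
  have hY := MmWave.targetRatio_pos (S := S) (lg := lg) (lm := x ^ 16) hα hθ hσ hlu (by positivity)
  have hYinv : (MmWave.targetRatio α θ σ lu lg S (x ^ 16))⁻¹ ≤ m / 16 :=
    le_trans (inv_anti₀ (by positivity) (MmWave.targetRatio_ge hα hθ hσ hlu hx16)) d8
  change ENNReal.ofReal (Real.log (1 + MmWave.targetRatio α θ σ lu lg S (x ^ 16))) < _
  rw [ENNReal.ofReal_lt_ofReal_iff_of_nonneg (Real.log_nonneg (by linarith))]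
  refine (MmWave.log_one_add_le hY hYinv).trans_lt ?_
  have hgτ : 0 ≤ g - Real.log τ := by linarith
  refine MmWave.log_target_lt hα hθ hσ hlu (by positivity) hm0 hm hκ hψ hψ0 hτ hp hp1
    (by linarith) (mul_nonneg (by linarith) hS0) ?_ ?_ hloss ?_ le_rfl le_rfl d4 le_rfl
  · refine le_trans ?_ r3.le
    rw [mul_assoc]
    exact mul_le_mul_of_nonneg_left hSle (by linarith)
  · refine le_trans ?_ r5.le
    rw [mul_right_comm]
    exact mul_le_mul_of_nonneg_right (by linarith) hgτ
  · refine le_trans (le_of_eq ?_) r6.le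
    ring
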